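/- **Definitions.** An *arrowed binary sequence* (ABS) is a finite totally ordered set $\tilde S$ with a map $\delta:\tilde S\to\{0,1\}$ and a bijection $\pi:\tilde S\to\tilde S$. The *binary expansion* of $t\in\tilde S$ is $b(t)=0.b_1b_2\cdots$ with $b_r=\delta(\pi^{-r}(t))$, and the *length* is $\ell(S)=\#\{(t',t): t'<t,\ \delta(t')=0,\ \delta(t)=1\}$. Over a perfect field $K$ of characteristic $p>0$, a $\mathrm{DM}_1$ is a finite-dimensional $K$-vector space with a Frobenius-linear map $F$ and an inverse-Frobenius-linear map $V$ satisfying $\ker F=\operatorname{im}V$ and $\ker V=\operatorname{im}F$. To an ABS corresponds the $\mathrm{DM}_1$ with basis $(e_t)_{t\in\tilde S}$, in which $Fe_t=e_{\pi(t)}$ if $\delta(t)=0$ and $Fe_t=0$ otherwise, and $Ve_{\pi(t)}=e_t$ if $\delta(t)=1$ and $Ve_{\pi(t)}=0$ otherwise. For coprime $m,n\ge 0$ with $h=m+n$, the $\mathrm{DM}_1$ $N_{m,n}$ is the one of the ABS $t_1<\dots<t_h$ with $\delta(t_i)=1$ iff $i\le m$, and $\pi(t_i)=t_{i-m \bmod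 h}$. The direct sum of two ABS's is the disjoint union with the given $\delta$ and $\pi$, ordered by binary expansion (elements of one summand with the same expansion keep their order, and those of the first summand precede those of the second); it corresponds to the direct sum of $\mathrm{DM}_1$'s. A Newton polygon $\xi=(m_1,n_1)+(m_2,n_2)$ of two segments consists of coprime pairs of non-negative integers, with slopes $\lambda_r=n_r/(m_r+n_r)$; $S_\xi=A\oplus B$ is the direct sum of the ABS's of $N_{m_1,n_1}$ and $N_{m_2,n_2}$, and $N_\xi=N_{m_1,n_1}\oplus N_{m_2,n_2}$. The $i$-th element of $A$ (of $B$) is written $\tau^A_i$ ($\tau^B_i$), where $\tau$ is its value under $\delta$. Let $S$ be an ABS with elements $t<t'$ satisfying $\delta(t)=0$, $\delta(t')=1$. The ABS $S'$ is *obtained from $S$ by exchanging $t$ and $t'$* if it has the same underlying set and the same $\delta$, its bijection is that of $S$ except that the images $t$ and $t'$ are switched, and its order $<'$ is such that $u<'v$ implies $b(u)\le b(v)$ (expansions in $S'$) and, for $\delta(u)=\delta(v)$, $u<'v$ holds iff the images of $u,v$ under the new bijection are in the same order. The exchange is *good* if $\ell(S')=\ell(S)-1$; then $S'$ and its $\mathrm{DM}_1$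 are *generic specializations* of $S$ and of its $\mathrm{DM}_1$. All labels $\tau^A_i,\tau^B_j$ are kept. **Proposition.** Let $\xi=(m_1,n_1)+(m_2,n_2)$ be a Newton polygon of two segments with $0<\lambda_2<1/2<\lambda_1<1$, and let $h_1=m_1+n_1$. Consider the generic specializations $N^-_\xi$ of $N_\xi$ whose ABS $S^-$ is obtained from $S_\xi$ by a good exchange of some $0^A_i$ and $1^B_j$ with $m_1<i\le n_1$ and $1\le j\le n_2$. (I) Suppose $n_1>m_1+1$. There is $\rho=(f,g)$, depending only on $\xi$, with $0\le f\le m_1$, $0\le g\le n_1$ and $fn_1-gm_1=1$ such that, for every such $N_\xi^-$, at least one of the following exchanges is possible in $S^-$, is good, and yields an ABS $S^{--}$ whose $\mathrm{DM}_1$ $N_\xi^{--}$ satisfies $$N^{--}_\xi\cong N^-_{\xi'}\oplus N_\rho\qquad(*)$$ for some generic specialization $N^-_{\xi'}$ of $N_{\xi'}$, where $\xi'=(m_1-f,n_1-g)+(m_2,n_2)$: (a) the exchange of $0^A_{m_1+1}$ and $1^A_{m_1}$; (b) the exchange of $0^A_{i-1}$ and $1^B_j$. (II) Suppose $n_1=m_1+1$.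 There is $\rho=(f,g)$ with $f,g\ge0$, depending only on $\xi$, such that, for every such $N_\xi^-$, at least one of the following exchanges is possible in $S^-$, is good, and yields an $N_\xi^{--}$ with $(*)$ for some generic specialization $N^-_{\xi'}$ of $N_{\xi'}$: (c) the exchange of $0^B_{m_2+1}$ and $1^B_{m_2}$, with $f\le m_2$, $g\le n_2$, $gm_2-fn_2=1$ and $\xi'=(m_1,n_1)+(m_2-f,n_2-g)$; (d) the exchange of $0^A_i$ and $1^B_{j+1}$, with $f\le m_2$, $g\le n_2$, $gm_2-fn_2=1$ and $\xi'=(m_1,n_1)+(m_2-f,n_2-g)$; (e) the exchange of $0^A_{h_1}$ and $1^B_{n_2+1}$, with $\rho=(1,1)$ and $\xi'=(m_1-1,n_1-1)+(m_2,n_2)$. In all cases $\rho$ is a coprime pair, $\xi'$ is a Newton polygon of two segments whose slopes satisfy $\lambda_2'<1/2<\lambda_1'$, and $(*)$ also holds for the corresponding ABS's, i.e. $S^{--}\cong S^-_{\xi'}\oplus S_\rho$, where $S_\rho$ is the ABS of $N_\rho$. -/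

import Mathlib

/-- An arrowed binary sequence on the set `T` of its elements: a total order on `T`, a map
`δ : T → {0, 1}` and a bijection `π : T → T`. (Everywhere below `T` is finite.) -/
structure ABS (T : Type*) where
  ord : LinearOrder T
  δ : T → Fin 2
  π : Equiv.Perm T

namespace ABS

/-- The strict order of an arrowed binary sequence. -/
def lt {T : Type*} (S : ABS T) (s t : T) : Prop := S.ord.lt s t

/-- The binary expansion `b(t) = 0.b₁b₂b₃…` with `bᵢ = δ(π⁻ⁱ(t))`, recorded as its sequence of
digits (the entry `k` is `b_{k+1}`) and compared lexicographically. The expansions are purely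
periodic, so this is the comparison of the real numbers with these digits. -/
def bin {T : Type*} (S : ABS T) (t : T) : Lex (ℕ → Fin 2) :=
  toLex fun k => S.δ ((S.π⁻¹ ^ (k + 1)) t)

/-- The length: the number of pairs `t' < t` with `δ(t') = 0` and `δ(t) = 1`. -/
noncomputable def length {T : Type*} (S : ABS T) : ℕ :=
  {q : T × T | S.δ q.1 = 0 ∧ S.δ q.2 = 1 ∧ S.lt q.1 q.2}.ncard

/-- Isomorphisms of arrowed binary sequences. -/
structure Iso {T T' : Type*} (S : ABS T) (S' : ABS T') where
  toEquiv : T ≃ T'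
  map_lt : ∀ s t, S'.lt (toEquiv s) (toEquiv t) ↔ S.lt s t
  map_δ : ∀ t, S'.δ (toEquiv t) = S.δ t
  map_π : ∀ t, S'.π (toEquiv t) = toEquiv (S.π t)

/-- The arrowed binary sequence of the simple `DM₁` `N_{m,n}`: with `h = m + n` and elements
`t₁ < ⋯ < t_h`, one has `δ(tᵢ) = 1` if and only if `i ≤ m`, and `π(tᵢ) = t_{i - m mod h}`.
The element `tᵢ` is `i - 1 : Fin (m + n)`. -/
def simple (m n : ℕ) : ABS (Fin (m + n)) where
  ord := inferInstance
  δ := fun t => if t.val < m then 1 else 0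
  π :=
    { toFun := fun t => ⟨(t.val + n) % (m + n), Nat.mod_lt _ t.pos⟩
      invFun := fun t => ⟨(t.val + m) % (m + n), Nat.mod_lt _ t.pos⟩
      left_inv := by
        intro t
        apply Fin.ext
        simp only [Nat.mod_add_mod]
        rw [show t.val + n + m = t.val + (m + n) by omega, Nat.add_mod_right,
          Nat.mod_eq_of_lt t.isLt]
      right_inv := by
        intro t
        apply Fin.ext
        simp only [Nat.mod_add_mod]
        rw [show t.val + m + n = t.val + (m + n) by omega, Nat.add_mod_right,
          Nat.mod_eq_of_lt t.isLt] }

/-- The binary expansion of an element of a disjoint union `A ⊔ B`. -/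
def sumBin {α β : Type*} (A : ABS α) (B : ABS β) : α ⊕ β → Lex (ℕ → Fin 2) :=
  Sum.elim A.bin B.bin

/-- The order on the disjoint union by binary expansions. Among elements with the same expansion,
those of the same summand keep their order and those of `A` come before those of `B`. -/
@[reducible] noncomputable def sumOrd {α β : Type*} (A : ABS α) (B : ABS β) : LinearOrder (α ⊕ β) :=
  letI := A.ord
  letI := B.ord
  LinearOrder.lift' (fun t : α ⊕ β => toLex (sumBin A B t, toLex t))
    (fun _ _ h => (Prod.ext_iff.1 h).2)

/-- The direct sum `A ⊕ B` of (admissible) arrowed binary sequences. -/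
noncomputable def sum {α β : Type*} (A : ABS α) (B : ABS β) : ABS (α ⊕ β) where
  ord := sumOrd A B
  δ := Sum.elim A.δ B.δ
  π := Equiv.sumCongr A.π B.π

/-- `S'` is the specialization of `S` obtained by exchanging `t` and `t'`: here `δ(t) = 0`,
`δ(t') = 1` and `t < t'` in `S`, the bijection of `S'` is the small modification of that of `S`
by `t` and `t'`, and the order of `S'` satisfies: `s < u` implies `b(s) ≤ b(u)`, and for
`δ(s) = δ(u)`, `s < u` if and only if the images under the new bijection are in this order. -/
structure IsExchange {T : Type*} (S : ABS T) (t t' : T) (S' : ABS T) : Prop where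
  zero : S.δ t = 0
  one : S.δ t' = 1
  lt : S.lt t t'
  δ_eq : S'.δ = S.δ
  small_fst : S'.π (S.π.symm t) = t'
  small_snd : S'.π (S.π.symm t') = t
  small_other : ∀ s, s ≠ S.π.symm t → s ≠ S.π.symm t' → S'.π s = S.π s
  bin_le : ∀ s u, S'.lt s u → S'.bin s ≤ S'.bin u
  lt_iff : ∀ s u, S'.δ s = S'.δ u → (S'.lt s u ↔ S'.lt (S'.π s) (S'.π u))

/-- The exchange of `t` and `t'` in `S` is good, and `S'` is its result. -/
def IsGoodExchange {T : Type*} (S : ABS T) (t t' : T) (S' : ABS T) : Prop :=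
  IsExchange S t t' S' ∧ S'.length + 1 = S.length

/-- `S'` is a generic specialization of `S`. -/
def IsGenericSpecialization {T : Type*} (S S' : ABS T) : Prop :=
  ∃ t t', IsGoodExchange S t t' S'

end ABS

/-- The slope `λ = n / (m + n)` of the segment `(m, n)`. -/
def segSlope (m n : ℕ) : ℚ := (n : ℚ) / ((m : ℚ) + (n : ℚ))

/-- `(m₁, n₁) + (m₂, n₂)` is a Newton polygon of two segments with `λ₂ < 1/2 < λ₁`. -/
structure IsTwoSegment (m₁ n₁ m₂ n₂ : ℕ) : Prop where
  coprime₁ : Nat.Coprime m₁ n₁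
  coprime₂ : Nat.Coprime m₂ n₂
  slope₂ : segSlope m₂ n₂ < 1 / 2
  slope₁ : 1 / 2 < segSlope m₁ n₁

/-- The elements of the arrowed binary sequence of `N_{(m₁,n₁)+(m₂,n₂)}`. -/
abbrev Elt (m₁ n₁ m₂ n₂ : ℕ) : Type := Fin (m₁ + n₁) ⊕ Fin (m₂ + n₂)

/-- The arrowed binary sequence `S = A ⊕ B` of the minimal `DM₁` `N_ξ`, `ξ = (m₁,n₁)+(m₂,n₂)`. -/
noncomputable def minimalABS (m₁ n₁ m₂ n₂ : ℕ) : ABS (Elt m₁ n₁ m₂ n₂) :=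
  (ABS.simple m₁ n₁).sum (ABS.simple m₂ n₂)

/-- The name of an element: `Sum.inl i` for the `i`-th element `τᴬᵢ` of `A`, and `Sum.inr j` for
the `j`-th element `τᴮⱼ` of `B`, with indices starting at `1`. -/
def eltName {m₁ n₁ m₂ n₂ : ℕ} : Elt m₁ n₁ m₂ n₂ → ℕ ⊕ ℕ :=
  Sum.map (fun x => x.val + 1) (fun x => x.val + 1)

section DieudonneModules

/-- A truncated Dieudonné module of level one over a perfect field `K` of characteristic `p`, with
underlying vector space `N`. -/
structure DM1 (p : ℕ) [Fact p.Prime] (K : Type*) [Field K] [CharP K p] [PerfectRing K p]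
    (N : Type*) [AddCommGroup N] [Module K N] where
  F : N →ₛₗ[frobenius K p] N
  V : N →ₛₗ[((frobeniusEquiv K p).symm : K →+* K)] N
  finite : Module.Finite K N
  ker_F : ∀ x, F x = 0 ↔ ∃ y, V y = x
  ker_V : ∀ x, V x = 0 ↔ ∃ y, F y = x

/-- Isomorphisms of `DM₁`'s. -/
structure DM1.Iso {p : ℕ} [Fact p.Prime] {K : Type*} [Field K] [CharP K p] [PerfectRing K p]
    {N N' : Type*} [AddCommGroup N] [Module K N] [AddCommGroup N'] [Module K N']
    (D : DM1 p K N) (D' : DM1 p K N') where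
  toEquiv : N ≃ₗ[K] N'
  map_F : ∀ x, D'.F (toEquiv x) = toEquiv (D.F x)
  map_V : ∀ x, D'.V (toEquiv x) = toEquiv (D.V x)

/-- The direct sum of two `DM₁`'s. -/
noncomputable def DM1.prod {p : ℕ} [Fact p.Prime] {K : Type*} [Field K] [CharP K p] [PerfectRing K p]
    {N N' : Type*} [AddCommGroup N] [Module K N] [AddCommGroup N'] [Module K N']
    (D : DM1 p K N) (D' : DM1 p K N') : DM1 p K (N × N') where
  F :=
    { toFun := fun x => (D.F x.1, D'.F x.2)
      map_add' := fun x y => by simp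
      map_smul' := fun c x => by simp [LinearMap.map_smulₛₗ] }
  V :=
    { toFun := fun x => (D.V x.1, D'.V x.2)
      map_add' := fun x y => by simp
      map_smul' := fun c x => by simp [LinearMap.map_smulₛₗ] }
  finite := by
    have := D.finite
    have := D'.finite
    infer_instance
  ker_F := fun x => by
    change (D.F x.1, D'.F x.2) = 0 ↔ ∃ y : N × N', (D.V y.1, D'.V y.2) = x
    rw [Prod.mk_eq_zero, D.ker_F, D'.ker_F]
    constructor
    · rintro ⟨⟨a, ha⟩, ⟨b, hb⟩⟩
      exact ⟨(a, b), Prod.ext ha hb⟩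
    · rintro ⟨y, rfl⟩
      exact ⟨⟨y.1, rfl⟩, ⟨y.2, rfl⟩⟩
  ker_V := fun x => by
    change (D.V x.1, D'.V x.2) = 0 ↔ ∃ y : N × N', (D.F y.1, D'.F y.2) = x
    rw [Prod.mk_eq_zero, D.ker_V, D'.ker_V]
    constructor
    · rintro ⟨⟨a, ha⟩, ⟨b, hb⟩⟩
      exact ⟨(a, b), Prod.ext ha hb⟩
    · rintro ⟨y, rfl⟩
      exact ⟨⟨y.1, rfl⟩, ⟨y.2, rfl⟩⟩

/-- The `DM₁` corresponding to an arrowed binary sequence: on the vector space with standard basis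
`e_t`, `t ∈ T`, one has `F e_t = e_{π t}` if `δ t = 0` and `F e_t = 0` otherwise, while
`V e_{π t} = e_t` if `δ t = 1` and `V e_{π t} = 0` otherwise. -/
noncomputable def ABS.dm1 (p : ℕ) [Fact p.Prime] (K : Type*) [Field K] [CharP K p] [PerfectRing K p]
    {T : Type*} [Finite T] (S : ABS T) : DM1 p K (T → K) where
  F :=
    { toFun := fun x s => if S.δ (S.π.symm s) = 0 then frobenius K p (x (S.π.symm s)) else 0
      map_add' := fun x y => by
        funext s
        by_cases h : S.δ (S.π.symm s) = 0 <;> simp [h]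
      map_smul' := fun c x => by
        funext s
        by_cases h : S.δ (S.π.symm s) = 0 <;> simp [h] }
  V :=
    { toFun := fun x t => if S.δ t = 1 then (frobeniusEquiv K p).symm (x (S.π t)) else 0
      map_add' := fun x y => by
        funext t
        by_cases h : S.δ t = 1 <;> simp [h]
      map_smul' := fun c x => by
        funext t
        by_cases h : S.δ t = 1 <;> simp [h] }
  finite := inferInstance
  ker_F := by
    intro x
    constructor
    · intro hx
      refine ⟨fun s => frobenius K p (x (S.π.symm s)), ?_⟩
      funext t
      by_cases h : S.δ t = 1
      · simp only [LinearMap.coe_mk, AddHom.coe_mk, h, if_true, Equiv.symm_apply_apply]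
        exact frobeniusEquiv_symm_apply_frobenius K p (x t)
      · have h0 : S.δ t = 0 := by omega
        have := congrFun hx (S.π t)
        simp [h0] at this
        simp [h0, this]
    · rintro ⟨y, rfl⟩
      funext s
      by_cases h : S.δ (S.π.symm s) = 0 <;> simp [h]
  ker_V := by
    intro x
    constructor
    · intro hx
      refine ⟨fun t => (frobeniusEquiv K p).symm (x (S.π t)), ?_⟩
      funext s
      by_cases h : S.δ (S.π.symm s) = 0
      · simp [h]
      · have h1 : S.δ (S.π.symm s) = 1 := by omega
        have := congrFun hx (S.π.symm s)
        simp [h1] at this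
        simp [h1, this]
    · rintro ⟨y, rfl⟩
      funext t
      by_cases h : S.δ t = 1 <;> simp [h]

end DieudonneModules

/-- The equality `N = N⁻_{ξ'} ⊕ N_ρ` for the `DM₁` `N` corresponding to `S`, where
`ξ' = (m₁', n₁') + (m₂', n₂')` and `ρ = (f, g)`: there is a generic specialization `N⁻_{ξ'}`
of `N_{ξ'}`, with arrowed binary sequence `Ψ`, for which it holds, both for the `DM₁`'s over `K`
and for the corresponding arrowed binary sequences. -/
def SplitsAs (p : ℕ) [Fact p.Prime] (K : Type*) [Field K] [CharP K p] [PerfectRing K p]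
    {T : Type*} [Finite T] (S : ABS T) (m₁' n₁' m₂' n₂' f g : ℕ) : Prop :=
  IsTwoSegment m₁' n₁' m₂' n₂' ∧ Nat.Coprime f g ∧
    ∃ Ψ : ABS (Elt m₁' n₁' m₂' n₂'),
      (minimalABS m₁' n₁' m₂' n₂').IsGenericSpecialization Ψ ∧
      Nonempty (S.Iso (Ψ.sum (ABS.simple f g))) ∧
      Nonempty ((S.dm1 p K).Iso ((Ψ.dm1 p K).prod ((ABS.simple f g).dm1 p K)))

/-- The elements of `S⁻` named `u` and `v` can be exchanged in `S⁻`, this exchange is good, and the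
resulting `S⁻⁻` satisfies `N⁻⁻ = N⁻_{ξ'} ⊕ N_ρ`, for `ξ' = (m₁', n₁') + (m₂', n₂')`
and `ρ = (f, g)`. -/
def SecondExchange (p : ℕ) [Fact p.Prime] (K : Type*) [Field K] [CharP K p] [PerfectRing K p]
    {m₁ n₁ m₂ n₂ : ℕ} (Sm : ABS (Elt m₁ n₁ m₂ n₂)) (u v : ℕ ⊕ ℕ)
    (m₁' n₁' m₂' n₂' f g : ℕ) : Prop :=
  ∃ (s t : Elt m₁ n₁ m₂ n₂) (Smm : ABS (Elt m₁ n₁ m₂ n₂)),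
    eltName s = u ∧ eltName t = v ∧ Sm.IsGoodExchange s t Smm ∧
      SplitsAs p K Smm m₁' n₁' m₂' n₂' f g

/-!
Let `i`, `j` be the elements `0ᴬᵢ`, `1ᴮⱼ` of `S_ξ`. Their exchange is good if and only if, for
every element `k` strictly between them, the pair `(i, k)` (for `k` in `A` with `δ = 0`) or
`(k, j)` (for `k` in `B` with `δ = 1`), moved along `π`, keeps equal values of `δ` until it reaches
a pair with values `(1, 0)`, and does so before `i` or `j` recurs: the pair is *resolved*.
Composing the bijection of a simple sequence `N_{m,n}` with the switch of two consecutive elements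
cuts its cycle into two orbits. Summing the displacements of `π` along an orbit gives the relation
`f n - g m = ±1`, so that the two orbits are `N_{f,g}` and `N_{m-f,n-g}`. One may switch the two
elements at the boundary between the `1`s and the `0`s, as in (a) and (c), or `i` and its
predecessor, as in (b), or `j` and its successor, as in (d). For at least one of these choices all
remaining pairs are still resolved, so that the exchange of `i` and `j` in `S_{ξ'}` is again good.
Reversing the order interchanges `m` and `n` and deduces the statements on `B` from those on `A`.
If no such switch is available in `B`, a cycle of length two is split off instead, as in (e).
Finally, an exchange lowers the length by at least one, while counting the pairs with one element
in each summand shows that the length of `S⁻_{ξ'} ⊕ S_ρ` is at least `ℓ(S⁻) - 1`; hence the second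
exchange is good.
-/

theorem segSlope_lt_half_iff {m n : ℕ} (h : 0 < m + n) : segSlope m n < 1 / 2 ↔ n < m := by
  have hpos : (0 : ℚ) < m + n := mod_cast h
  rw [segSlope, div_lt_div_iff₀ hpos two_pos]
  norm_cast
  omega

theorem half_lt_segSlope_iff {m n : ℕ} (h : 0 < m + n) : 1 / 2 < segSlope m n ↔ m < n := by
  have hpos : (0 : ℚ) < m + n := mod_cast h
  rw [segSlope, div_lt_div_iff₀ two_pos hpos]
  norm_cast
  omega

theorem pos_of_segSlope_pos {m n : ℕ} (h : 0 < segSlope m n) : 0 < n := by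
  rw [Nat.pos_iff_ne_zero]
  rintro rfl
  simp [segSlope] at h

theorem pos_of_segSlope_lt_one {m n : ℕ} (hn : n ≠ 0) (h : segSlope m n < 1) : 0 < m := by
  rw [Nat.pos_iff_ne_zero]
  rintro rfl
  simp [segSlope, hn] at h

theorem add_pos_of_coprime {m n : ℕ} (h : Nat.Coprime m n) : 0 < m + n := by
  rw [Nat.add_pos_iff_pos_or_pos, Nat.pos_iff_ne_zero, Nat.pos_iff_ne_zero]
  by_contra! h0
  simp [h0.1, h0.2] at h

theorem isTwoSegment_iff {m₁ n₁ m₂ n₂ : ℕ} : IsTwoSegment m₁ n₁ m₂ n₂ ↔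
    Nat.Coprime m₁ n₁ ∧ Nat.Coprime m₂ n₂ ∧ n₂ < m₂ ∧ m₁ < n₁ := by
  constructor
  · rintro ⟨h₁, h₂, hlt, hgt⟩
    exact ⟨h₁, h₂, (segSlope_lt_half_iff (add_pos_of_coprime h₂)).1 hlt,
      (half_lt_segSlope_iff (add_pos_of_coprime h₁)).1 hgt⟩
  · rintro ⟨h₁, h₂, hlt, hgt⟩
    exact ⟨h₁, h₂, (segSlope_lt_half_iff (add_pos_of_coprime h₂)).2 hlt,
      (half_lt_segSlope_iff (add_pos_of_coprime h₁)).2 hgt⟩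

namespace ABS

open Equiv

section Basics

variable {T T' : Type*}

theorem lt_irrefl (S : ABS T) (x : T) : ¬ S.lt x x :=
  letI := S.ord; _root_.lt_irrefl x

theorem lt_asymm (S : ABS T) {x y : T} (h : S.lt x y) : ¬ S.lt y x :=
  letI := S.ord; _root_.lt_asymm (a := x) h

theorem lt_trichotomy (S : ABS T) (x y : T) : S.lt x y ∨ x = y ∨ S.lt y x :=
  letI := S.ord; _root_.lt_trichotomy x y

theorem δ_eq_zero_or_one (S : ABS T) (x : T) : S.δ x = 0 ∨ S.δ x = 1 := by
  have := (S.δ x).isLt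
  omega

theorem bin_π_zero (S : ABS T) (x : T) : ofLex (S.bin (S.π x)) 0 = S.δ x := by
  simp [bin]

theorem bin_π_succ (S : ABS T) (x : T) (k : ℕ) :
    ofLex (S.bin (S.π x)) (k + 1) = ofLex (S.bin x) k := by
  change S.δ ((S.π⁻¹ ^ (k + 1 + 1)) (S.π x)) = S.δ ((S.π⁻¹ ^ (k + 1)) x)
  rw [pow_succ _ (k + 1), Equiv.Perm.mul_apply, show S.π⁻¹ (S.π x) = x from S.π.symm_apply_apply x]

theorem lex_lt_iff_exists {a b : Lex (ℕ → Fin 2)} :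
    a < b ↔ ∃ k, (∀ l < k, ofLex a l = ofLex b l) ∧ ofLex a k < ofLex b k := Iff.rfl

theorem bin_π_eq_iff (S : ABS T) (S' : ABS T') (x : T) (y : T') :
    S.bin (S.π x) = S'.bin (S'.π y) ↔ S.δ x = S'.δ y ∧ S.bin x = S'.bin y := by
  constructor
  · intro h
    refine ⟨by rw [← bin_π_zero, h, bin_π_zero], ?_⟩
    apply ofLex.injective
    funext k
    rw [← bin_π_succ, h, bin_π_succ]
  · rintro ⟨h, h'⟩
    apply ofLex.injective
    funext k
    cases k with
    | zero => rw [bin_π_zero, bin_π_zero, h]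
    | succ k => rw [bin_π_succ, bin_π_succ, h']

theorem bin_π_lt_iff (S : ABS T) (S' : ABS T') (x : T) (y : T') :
    S.bin (S.π x) < S'.bin (S'.π y) ↔
      S.δ x < S'.δ y ∨ S.δ x = S'.δ y ∧ S.bin x < S'.bin y := by
  simp only [lex_lt_iff_exists]
  constructor
  · rintro ⟨k, hk, hlt⟩
    cases k with
    | zero => rw [bin_π_zero, bin_π_zero] at hlt; exact Or.inl hlt
    | succ k =>
      refine Or.inr ⟨?_, k, fun l hl => ?_, ?_⟩
      · have := hk 0 (by omega)
        rwa [bin_π_zero, bin_π_zero] at this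
      · have := hk (l + 1) (by omega)
        rwa [bin_π_succ, bin_π_succ] at this
      · rwa [bin_π_succ, bin_π_succ] at hlt
  · rintro (h | ⟨h, k, hk, hlt⟩)
    · exact ⟨0, by simp, by rwa [bin_π_zero, bin_π_zero]⟩
    · refine ⟨k + 1, fun l hl => ?_, by rwa [bin_π_succ, bin_π_succ]⟩
      cases l with
      | zero => rw [bin_π_zero, bin_π_zero, h]
      | succ l => rw [bin_π_succ, bin_π_succ]; exact hk l (by omega)

theorem δ_eq_of_bin_eq [Finite T] [Finite T'] (S : ABS T) (S' : ABS T') {x : T} {y : T'}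
    (h : S.bin x = S'.bin y) : S.δ x = S'.δ y := by
  -- `δ` is a digit of the expansion: as `π` has finite order, `δ x = δ (π ^ (-r) x)` for some
  -- `r ≥ 1`
  obtain ⟨k, hk⟩ : ∃ k, orderOf S.π⁻¹ * orderOf S'.π⁻¹ = k + 1 :=
    Nat.exists_eq_add_one.2 (Nat.mul_pos (orderOf_pos _) (orderOf_pos _))
  have e1 : S.π⁻¹ ^ (k + 1) = 1 := by rw [← hk, pow_mul, pow_orderOf_eq_one, one_pow]
  have e2 : S'.π⁻¹ ^ (k + 1) = 1 := by
    rw [← hk, mul_comm, pow_mul, pow_orderOf_eq_one, one_pow]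
  have := congrArg (fun b : Lex (ℕ → Fin 2) => ofLex b k) h
  simpa only [bin, ofLex_toLex, e1, e2, Equiv.Perm.one_apply] using this

theorem bin_π_eq_of_bin_eq [Finite T] [Finite T'] (S : ABS T) (S' : ABS T') {x : T} {y : T'}
    (h : S.bin x = S'.bin y) : S.bin (S.π x) = S'.bin (S'.π y) :=
  (bin_π_eq_iff _ _ _ _).2 ⟨δ_eq_of_bin_eq S S' h, h⟩

theorem bin_pow_eq_of_bin_eq [Finite T] [Finite T'] (S : ABS T) (S' : ABS T') {x : T} {y : T'}
    (h : S.bin x = S'.bin y) (k : ℕ) : S.bin ((S.π ^ k) x) = S'.bin ((S'.π ^ k) y) := by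
  induction k with
  | zero => simpa using h
  | succ k ih =>
    rw [pow_succ', pow_succ', Equiv.Perm.mul_apply, Equiv.Perm.mul_apply]
    exact bin_π_eq_of_bin_eq _ _ ih

/-- The compatibility of the order with `π` that makes the binary expansions weakly increasing:
`π` preserves the order of elements with the same value under `δ`, and moves every element with
value `0` below every element with value `1`. -/
structure Regular (S : ABS T) : Prop where
  lt_iff : ∀ x y, S.δ x = S.δ y → (S.lt x y ↔ S.lt (S.π x) (S.π y))
  lt_of : ∀ x y, S.δ x = 0 → S.δ y = 1 → S.lt (S.π x) (S.π y)

theorem Regular.bin_le {S : ABS T} (hS : S.Regular) {x y : T} (h : S.lt x y) :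
    S.bin x ≤ S.bin y := by
  by_contra hlt
  rw [not_le] at hlt
  replace hlt := lex_lt_iff_exists.1 hlt
  obtain ⟨k, hk, hlt⟩ := hlt
  induction k generalizing x y with
  | zero =>
    obtain ⟨x, rfl⟩ := S.π.surjective x
    obtain ⟨y, rfl⟩ := S.π.surjective y
    rw [bin_π_zero, bin_π_zero] at hlt
    exact S.lt_asymm h (hS.lt_of y x (by omega) (by omega))
  | succ k ih =>
    obtain ⟨x, rfl⟩ := S.π.surjective x
    obtain ⟨y, rfl⟩ := S.π.surjective y
    have h0 := hk 0 (by omega)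
    rw [bin_π_zero, bin_π_zero] at h0
    rw [bin_π_succ, bin_π_succ] at hlt
    refine ih ((hS.lt_iff x y h0.symm).2 h) (fun j hj => ?_) hlt
    have := hk (j + 1) (by omega)
    rwa [bin_π_succ, bin_π_succ] at this

theorem Regular.of_bin_le {S : ABS T} (h1 : ∀ x y, S.lt x y → S.bin x ≤ S.bin y)
    (h2 : ∀ x y, S.δ x = S.δ y → (S.lt x y ↔ S.lt (S.π x) (S.π y))) : S.Regular where
  lt_iff := h2
  lt_of x y hx hy := by
    have hb : S.bin (S.π x) < S.bin (S.π y) := by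
      rw [bin_π_lt_iff, hx, hy]; exact Or.inl (by decide)
    rcases S.lt_trichotomy (S.π x) (S.π y) with h | h | h
    · exact h
    · rw [h] at hb; exact absurd hb (_root_.lt_irrefl _)
    · exact absurd (h1 _ _ h) (not_le.2 hb)

theorem IsExchange.regular {S S' : ABS T} {t t' : T} (h : IsExchange S t t' S') : S'.Regular :=
  Regular.of_bin_le h.bin_le h.lt_iff

theorem Regular.lt_of_bin_lt {S : ABS T} (hS : S.Regular) {x y : T} (h : S.bin x < S.bin y) :
    S.lt x y := by
  rcases S.lt_trichotomy x y with h' | h' | h'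
  · exact h'
  · rw [h'] at h; exact absurd h (_root_.lt_irrefl _)
  · exact absurd (hS.bin_le h') (not_le.2 h)

theorem IsExchange.π_eq [DecidableEq T] {S S' : ABS T} {t t' : T} (h : IsExchange S t t' S') :
    S'.π = Equiv.swap t t' * S.π := by
  ext x
  rw [Equiv.Perm.mul_apply, Equiv.swap_apply_def]
  split_ifs with h1 h2
  · rw [← h.small_fst, ← h1]; simp
  · rw [← h.small_snd, ← h2]; simp
  · exact h.small_other x (fun e => h1 (by simp [e])) (fun e => h2 (by simp [e]))

theorem isExchange_of_π_eq [DecidableEq T] {S S' : ABS T} {t t' : T} (h0 : S.δ t = 0)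
    (h1 : S.δ t' = 1) (hlt : S.lt t t') (hδ : S'.δ = S.δ)
    (hπ : S'.π = Equiv.swap t t' * S.π) (hS' : S'.Regular) : IsExchange S t t' S' where
  zero := h0
  one := h1
  lt := hlt
  δ_eq := hδ
  small_fst := by simp [hπ]
  small_snd := by simp [hπ]
  small_other s h h' := by
    rw [hπ, Equiv.Perm.mul_apply, Equiv.swap_apply_of_ne_of_ne]
    · rintro rfl; exact h (by simp)
    · rintro rfl; exact h' (by simp)
  bin_le _ _ := hS'.bin_le
  lt_iff := hS'.lt_iff

theorem exists_rank [Finite T] (S : ABS T) :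
    ∃ φ : T → ℕ, Function.Injective φ ∧ ∀ x y, S.lt x y ↔ φ x < φ y := by
  classical
  let := S.ord
  have := Fintype.ofFinite T
  let e := Fintype.orderIsoFinOfCardEq T rfl
  refine ⟨fun x => (e.symm x).val, fun x y h => e.symm.injective (Fin.ext h), fun x y => ?_⟩
  exact (e.symm.lt_iff_lt (x := x) (y := y)).symm

end Basics

section Sum

variable {α β : Type*} (A : ABS α) (B : ABS β)

@[simp] theorem sum_δ_inl (a : α) : (A.sum B).δ (Sum.inl a) = A.δ a := rfl
@[simp] theorem sum_δ_inr (b : β) : (A.sum B).δ (Sum.inr b) = B.δ b := rfl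
@[simp] theorem sum_π_inl (a : α) : (A.sum B).π (Sum.inl a) = Sum.inl (A.π a) := rfl
@[simp] theorem sum_π_inr (b : β) : (A.sum B).π (Sum.inr b) = Sum.inr (B.π b) := rfl

theorem sum_lt_iff (x y : α ⊕ β) : (A.sum B).lt x y ↔
    sumBin A B x < sumBin A B y ∨
      sumBin A B x = sumBin A B y ∧ Sum.Lex A.lt B.lt x y := by
  let := A.ord
  let := B.ord
  change toLex (sumBin A B x, toLex x) < toLex (sumBin A B y, toLex y) ↔ _
  rw [Prod.Lex.toLex_lt_toLex]
  exact Iff.rfl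

theorem sum_lt_inl_inl {x y : α} : (A.sum B).lt (Sum.inl x) (Sum.inl y) ↔
    A.bin x < A.bin y ∨ A.bin x = A.bin y ∧ A.lt x y := by
  rw [sum_lt_iff, Sum.lex_inl_inl]; rfl

theorem sum_lt_inr_inr {x y : β} : (A.sum B).lt (Sum.inr x) (Sum.inr y) ↔
    B.bin x < B.bin y ∨ B.bin x = B.bin y ∧ B.lt x y := by
  rw [sum_lt_iff, Sum.lex_inr_inr]; rfl

theorem sum_lt_inl_inr {x : α} {y : β} : (A.sum B).lt (Sum.inl x) (Sum.inr y) ↔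
    A.bin x ≤ B.bin y := by
  rw [sum_lt_iff]
  simp only [sumBin, Sum.elim_inl, Sum.elim_inr, Sum.Lex.sep, and_true]
  exact le_iff_lt_or_eq.symm

theorem sum_lt_inr_inl {x : α} {y : β} : (A.sum B).lt (Sum.inr y) (Sum.inl x) ↔
    B.bin y < A.bin x := by
  rw [sum_lt_iff]
  simp [sumBin]

variable {A B}

theorem Regular.sum_lt_inl_inl (hA : A.Regular) {x y : α} :
    (A.sum B).lt (Sum.inl x) (Sum.inl y) ↔ A.lt x y := by
  rw [ABS.sum_lt_inl_inl]
  constructor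
  · rintro (h | h)
    exacts [hA.lt_of_bin_lt h, h.2]
  · intro h
    rcases (hA.bin_le h).lt_or_eq with h' | h'
    exacts [Or.inl h', Or.inr ⟨h', h⟩]

theorem Regular.sum_lt_inr_inr (hB : B.Regular) {x y : β} :
    (A.sum B).lt (Sum.inr x) (Sum.inr y) ↔ B.lt x y := by
  rw [ABS.sum_lt_inr_inr]
  constructor
  · rintro (h | h)
    exacts [hB.lt_of_bin_lt h, h.2]
  · intro h
    rcases (hB.bin_le h).lt_or_eq with h' | h'
    exacts [Or.inl h', Or.inr ⟨h', h⟩]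

theorem Regular.sum (hA : A.Regular) (hB : B.Regular) : (A.sum B).Regular where
  lt_iff x y h := by
    rcases x with x | x <;> rcases y with y | y
    · simp only [sum_δ_inl, sum_π_inl, hA.sum_lt_inl_inl] at h ⊢
      exact hA.lt_iff x y h
    · simp only [sum_δ_inl, sum_δ_inr, sum_π_inl, sum_π_inr, sum_lt_inl_inr] at h ⊢
      have hlt : B.bin (B.π y) < A.bin (A.π x) ↔ B.bin y < A.bin x := by
        rw [bin_π_lt_iff, h]
        simp
      exact not_lt.symm.trans ((not_congr hlt.symm).trans not_lt)
    · simp only [sum_δ_inl, sum_δ_inr, sum_π_inl, sum_π_inr, sum_lt_inr_inl] at h ⊢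
      rw [bin_π_lt_iff, h]
      simp
    · simp only [sum_δ_inr, sum_π_inr, hB.sum_lt_inr_inr] at h ⊢
      exact hB.lt_iff x y h
  lt_of x y hx hy := by
    rcases x with x | x <;> rcases y with y | y
    · simp only [sum_δ_inl, sum_π_inl, hA.sum_lt_inl_inl] at *
      exact hA.lt_of x y hx hy
    · simp only [sum_δ_inl, sum_δ_inr, sum_π_inl, sum_π_inr, sum_lt_inl_inr] at *
      exact ((bin_π_lt_iff _ _ _ _).2 (Or.inl (by rw [hx, hy]; decide))).le
    · simp only [sum_δ_inl, sum_δ_inr, sum_π_inl, sum_π_inr, sum_lt_inr_inl] at *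
      exact (bin_π_lt_iff _ _ _ _).2 (Or.inl (by rw [hx, hy]; decide))
    · simp only [sum_δ_inr, sum_π_inr, hB.sum_lt_inr_inr] at *
      exact hB.lt_of x y hx hy

end Sum

section Transport

variable {T T' : Type*}

/-- The arrowed binary sequence obtained by transport along a bijection. -/
def transport (e : T ≃ T') (S : ABS T') : ABS T where
  ord := letI := S.ord; LinearOrder.lift' e e.injective
  δ := S.δ ∘ e
  π := (e.trans S.π).trans e.symm

/-- The bijection `e`, as an isomorphism of arrowed binary sequences. -/
def transportIso (e : T ≃ T') (S : ABS T') : (S.transport e).Iso S where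
  toEquiv := e
  map_lt _ _ := Iff.rfl
  map_δ _ := rfl
  map_π t := by simp [transport]

theorem Iso.regular {S : ABS T} {S' : ABS T'} (e : S.Iso S') (h : S'.Regular) : S.Regular where
  lt_iff x y hxy := by
    rw [← e.map_lt, ← e.map_lt, h.lt_iff _ _ (by rw [e.map_δ, e.map_δ, hxy]), e.map_π, e.map_π]
  lt_of x y hx hy := by
    rw [← e.map_lt, ← e.map_π, ← e.map_π]
    exact h.lt_of _ _ (by rw [e.map_δ, hx]) (by rw [e.map_δ, hy])

theorem Iso.length_eq {S : ABS T} {S' : ABS T'} (e : S.Iso S') : S.length = S'.length := by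
  unfold length
  refine Set.ncard_congr (fun q _ => (e.toEquiv q.1, e.toEquiv q.2)) ?_ ?_ ?_
  · rintro ⟨x, y⟩ ⟨h1, h2, h3⟩
    exact ⟨by rw [e.map_δ]; exact h1, by rw [e.map_δ]; exact h2, (e.map_lt _ _).2 h3⟩
  · rintro ⟨x, y⟩ ⟨x', y'⟩ _ _ h
    simpa using h
  · rintro ⟨x, y⟩ ⟨h1, h2, h3⟩
    refine ⟨(e.toEquiv.symm x, e.toEquiv.symm y), ⟨?_, ?_, ?_⟩, by simp⟩
    · rw [← e.map_δ]; simpa using h1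
    · rw [← e.map_δ]; simpa using h2
    · rw [← e.map_lt]; simpa using h3

end Transport

section Cross

open Classical in
theorem ncard_eq_sum {α β : Type*} [Fintype α] [Fintype β] (P : α → β → Prop) :
    {q : α × β | P q.1 q.2}.ncard = ∑ a, ∑ b, if P a b then 1 else 0 := by
  rw [← Fintype.sum_prod_type' (f := fun a b => if P a b then 1 else 0), ← Finset.card_filter,
    ← Set.ncard_coe_finset]
  congr 1
  ext q
  simp

/-- The number of elements with a given value of `δ`. -/
noncomputable def count {α : Type*} (A : ABS α) (v : Fin 2) : ℕ := {a | A.δ a = v}.ncard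

/-- The number of pairs `(a, b)` of elements of `A` and `B` with `δ(a) = 0`, `δ(b) = 1` and
`b(a) < b(b)`: the contribution of these pairs to the length of `A ⊕ B`. -/
noncomputable def cross {α β : Type*} (A : ABS α) (B : ABS β) : ℕ :=
  {q : α × β | A.δ q.1 = 0 ∧ B.δ q.2 = 1 ∧ A.bin q.1 < B.bin q.2}.ncard

theorem ncard_add_of_iff {α : Type*} [Finite α] {s t u : Set α} (h : ∀ x, x ∈ s ↔ x ∈ t ∨ x ∈ u)
    (h' : ∀ x, x ∈ t → x ∉ u) : s.ncard = t.ncard + u.ncard := by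
  rw [← Set.ncard_union_eq (Set.disjoint_left.2 h')]
  congr 1
  ext x
  exact h x

variable {α β : Type*} (A : ABS α) (B : ABS β)

theorem ncard_bin_π_lt_bin_π :
    {q : α × β | A.bin (A.π q.1) < B.bin (B.π q.2)}.ncard =
      {q : α × β | A.bin q.1 < B.bin q.2}.ncard := by
  refine Set.ncard_congr (fun q _ => Equiv.prodCongr A.π B.π q) (fun q hq => hq)
    (fun q q' _ _ h => (Equiv.prodCongr A.π B.π).injective h) fun q hq =>
      ⟨(Equiv.prodCongr A.π B.π).symm q, ?_, Equiv.apply_symm_apply _ q⟩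
  simpa using hq

variable [Finite α] [Finite β]

theorem cross_add_ncard :
    A.cross B + {q : α × β | A.δ q.1 = 1 ∧ B.δ q.2 = 0 ∧ A.bin q.1 < B.bin q.2}.ncard =
      A.count 0 * B.count 1 := by
  have hπ : {q : α × β | A.bin (A.π q.1) < B.bin (B.π q.2)}.ncard =
      A.count 0 * B.count 1 +
        {q : α × β | A.δ q.1 = B.δ q.2 ∧ A.bin q.1 < B.bin q.2}.ncard := by
    rw [count, count, ← Set.ncard_prod]
    refine ncard_add_of_iff (fun q => ?_) ?_
    · simp only [Set.mem_ofPred_eq, Set.mem_prod, bin_π_lt_iff]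
      refine or_congr_left ?_
      omega
    · rintro q ⟨h0 : A.δ q.1 = 0, h1 : B.δ q.2 = 1⟩ ⟨h, -⟩
      omega
  have hδ : {q : α × β | A.bin q.1 < B.bin q.2}.ncard =
      {q : α × β | A.δ q.1 = B.δ q.2 ∧ A.bin q.1 < B.bin q.2}.ncard +
        {q : α × β | A.δ q.1 ≠ B.δ q.2 ∧ A.bin q.1 < B.bin q.2}.ncard := by
    refine ncard_add_of_iff (fun q => ?_) fun q h h' => h'.1 h.1
    simp only [Set.mem_ofPred_eq]
    tauto
  have hne : {q : α × β | A.δ q.1 ≠ B.δ q.2 ∧ A.bin q.1 < B.bin q.2}.ncard = A.cross B +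
      {q : α × β | A.δ q.1 = 1 ∧ B.δ q.2 = 0 ∧ A.bin q.1 < B.bin q.2}.ncard := by
    refine ncard_add_of_iff (fun q => ?_) ?_
    · simp only [Set.mem_ofPred_eq, ← and_assoc, ← or_and_right]
      refine and_congr_left' ?_
      omega
    · rintro q ⟨h0, -⟩ ⟨h1, -⟩
      omega
  have := ncard_bin_π_lt_bin_π A B
  omega

theorem count_mul_count_eq_ncard_add_cross :
    A.count 1 * B.count 0 =
      {q : α × β | A.δ q.1 = 1 ∧ B.δ q.2 = 0 ∧ A.bin q.1 < B.bin q.2}.ncard + B.cross A := by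
  have hswap : B.cross A =
      {q : α × β | A.δ q.1 = 1 ∧ B.δ q.2 = 0 ∧ B.bin q.2 < A.bin q.1}.ncard :=
    Set.ncard_congr (fun q _ => (q.2, q.1)) (fun q h => ⟨h.2.1, h.1, h.2.2⟩)
      (fun q q' _ _ h => Prod.ext (Prod.ext_iff.1 h).2 (Prod.ext_iff.1 h).1)
      fun q h => ⟨(q.2, q.1), ⟨h.2.1, h.1, h.2.2⟩, rfl⟩
  rw [hswap, count, count, ← Set.ncard_prod]
  refine ncard_add_of_iff (fun q => ⟨?_, ?_⟩) ?_
  · rintro ⟨h1 : A.δ q.1 = 1, h0 : B.δ q.2 = 0⟩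
    rcases _root_.lt_trichotomy (A.bin q.1) (B.bin q.2) with h | h | h
    · exact Or.inl ⟨h1, h0, h⟩
    · have := δ_eq_of_bin_eq A B h
      omega
    · exact Or.inr ⟨h1, h0, h⟩
  · rintro (h | h) <;> exact ⟨h.1, h.2.1⟩
  · rintro q ⟨-, -, h⟩ ⟨-, -, h'⟩
    exact _root_.lt_asymm h h'

theorem cross_add : A.cross B + A.count 1 * B.count 0 = B.cross A + A.count 0 * B.count 1 := by
  have := cross_add_ncard A B
  have := count_mul_count_eq_ncard_add_cross A B
  omega

variable {A B}

theorem length_sum (hA : A.Regular) (hB : B.Regular) :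
    (A.sum B).length = A.length + B.length + A.cross B + B.cross A := by
  classical
  have := Fintype.ofFinite α
  have := Fintype.ofFinite β
  have hle_iff : ∀ a b, (A.δ a = 0 ∧ B.δ b = 1 ∧ A.bin a ≤ B.bin b) ↔
      (A.δ a = 0 ∧ B.δ b = 1 ∧ A.bin a < B.bin b) := by
    refine fun a b => and_congr_right fun h0 => and_congr_right fun h1 =>
      ⟨fun hle => lt_of_le_of_ne hle fun h => ?_, le_of_lt⟩
    have := δ_eq_of_bin_eq A B h
    omega
  unfold length cross
  rw [ncard_eq_sum fun a b => (A.sum B).δ a = 0 ∧ (A.sum B).δ b = 1 ∧ (A.sum B).lt a b,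
    ncard_eq_sum fun a b => A.δ a = 0 ∧ A.δ b = 1 ∧ A.lt a b,
    ncard_eq_sum fun a b => B.δ a = 0 ∧ B.δ b = 1 ∧ B.lt a b,
    ncard_eq_sum fun a b => A.δ a = 0 ∧ B.δ b = 1 ∧ A.bin a < B.bin b,
    ncard_eq_sum fun a b => B.δ a = 0 ∧ A.δ b = 1 ∧ B.bin a < A.bin b]
  simp only [Fintype.sum_sum_type, Finset.sum_add_distrib, sum_δ_inl, sum_δ_inr, sum_lt_inl_inr,
    sum_lt_inr_inl, hA.sum_lt_inl_inl, hB.sum_lt_inr_inr, hle_iff]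
  rw [show ∀ p q r s : ℕ, p + q + (r + s) = p + s + r + q from fun _ _ _ _ => by ring]
  congr!

end Cross

section Exchange

theorem ncard_eq_of_bij {α β : Type*} {s : Set α} {u : Set β} (f : α → β) (g : β → α)
    (hf : ∀ x ∈ s, f x ∈ u ∧ g (f x) = x) (hg : ∀ y ∈ u, g y ∈ s ∧ f (g y) = y) :
    s.ncard = u.ncard :=
  Set.ncard_congr (fun x _ => f x) (fun x hx => (hf x hx).1)
    (fun x y hx hy h => by rw [← (hf x hx).2, ← (hf y hy).2, h])
    fun y hy => ⟨g y, (hg y hy).1, (hg y hy).2⟩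

variable {T : Type*} {S S' : ABS T} {t t' : T}

/-- The elements strictly between `t` and `t'`. -/
def between (S : ABS T) (t t' : T) : Set T :=
  {z | S.lt t z ∧ S.lt z t'}

/-- The pairs of elements with the same value under `δ` whose order in `S` is reversed in `S'`. -/
def reversals (S S' : ABS T) : Set (T × T) :=
  {q | S.δ q.1 = S.δ q.2 ∧ S.lt q.1 q.2 ∧ S'.lt q.2 q.1}

/-- The elements between `t` and `t'` that `S'` does not move past `t` (when `δ = 0`) or past `t'`
(when `δ = 1`). -/
def wrongSide (S : ABS T) (t t' : T) (S' : ABS T) : Set T :=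
  {z | z ∈ between S t t' ∧ ((S.δ z = 0 ∧ S'.lt t z) ∨ (S.δ z = 1 ∧ S'.lt z t'))}

-- Here and below, passing to ranks in `ℕ` leaves a case distinction to `grind`.
theorem ncard_between [Finite T] : (between S t t').ncard = (wrongSide S t t' S').ncard +
    {z | z ∈ between S t t' ∧ ((S.δ z = 0 ∧ S'.lt z t) ∨ (S.δ z = 1 ∧ S'.lt t' z))}.ncard := by
  obtain ⟨φ, -, hlt⟩ := S.exists_rank
  obtain ⟨ψ, hψ, hlt'⟩ := S'.exists_rank
  refine ncard_add_of_iff (fun z => ?_) ?_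
  · simp only [wrongSide, between, Set.mem_ofPred_eq, hlt, hlt']
    have := S.δ_eq_zero_or_one z
    have := @hψ z t
    have := @hψ z t'
    grind
  · rintro z ⟨-, h2⟩ ⟨-, h3⟩
    simp only [hlt'] at h2 h3
    omega

variable [DecidableEq T]

/-- The pairs of elements whose order is reversed on passing from the order of `S` with the places
of `t` and `t'` switched to the order of `S'`. -/
def inversions (S : ABS T) (t t' : T) (S' : ABS T) : Set (T × T) :=
  {q | S.lt (swap t t' q.1) (swap t t' q.2) ∧ S'.lt q.2 q.1}

/-- The inversions `(x, y)` with `δ(x) = 0` and `δ(y) = 1`. They, and the elements of `wrongSide`,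
measure how much more than `1` the length drops: see `IsExchange.length_add`. -/
def badInversions (S : ABS T) (t t' : T) (S' : ABS T) : Set (T × T) :=
  {q | S.δ q.1 = 0 ∧ S.δ q.2 = 1 ∧ q ∈ inversions S t t' S'}

theorem IsExchange.mem_inversions_π (hS : S.Regular) (h : IsExchange S t t' S') (x y : T) :
    (S'.π x, S'.π y) ∈ inversions S t t' S' ↔ (x, y) ∈ reversals S S' := by
  have hS' := h.regular
  have e : ∀ z, swap t t' (S'.π z) = S.π z := by intro z; simp [h.π_eq]
  simp only [inversions, reversals, Set.mem_ofPred_eq, e]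
  rcases S.δ_eq_zero_or_one x with hx | hx <;> rcases S.δ_eq_zero_or_one y with hy | hy
  · have h1 : S.δ x = S.δ y := by rw [hx, hy]
    have h2 : S'.δ y = S'.δ x := by rw [h.δ_eq, hx, hy]
    rw [← hS.lt_iff x y h1, ← hS'.lt_iff y x h2]
    tauto
  · rw [hx, hy]
    have := hS'.lt_of x y (by rw [h.δ_eq, hx]) (by rw [h.δ_eq, hy])
    have := S'.lt_asymm this
    simp [this]
  · rw [hx, hy]
    have := S.lt_asymm (hS.lt_of y x hy hx)
    simp [this]
  · have h1 : S.δ x = S.δ y := by rw [hx, hy]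
    have h2 : S'.δ y = S'.δ x := by rw [h.δ_eq, hx, hy]
    rw [← hS.lt_iff x y h1, ← hS'.lt_iff y x h2]
    tauto

theorem IsExchange.ncard_inversions (hS : S.Regular) (h : IsExchange S t t' S') :
    (inversions S t t' S').ncard = (reversals S S').ncard := by
  symm
  refine ncard_eq_of_bij (fun q => (S'.π q.1, S'.π q.2))
    (fun q => (S'.π.symm q.1, S'.π.symm q.2)) (fun q hq => ?_) fun q hq => ?_
  · exact ⟨(h.mem_inversions_π hS q.1 q.2).2 hq, by simp⟩
  · refine ⟨(h.mem_inversions_π hS _ _).1 ?_, by simp⟩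
    simpa using hq

variable [Finite T]

theorem ncard_inversions_eq_add : (inversions S t t' S').ncard =
    {q | S.δ q.1 = S.δ q.2 ∧ q ∈ inversions S t t' S'}.ncard +
      ((badInversions S t t' S').ncard +
        {q | S.δ q.1 = 1 ∧ S.δ q.2 = 0 ∧ q ∈ inversions S t t' S'}.ncard) := by
  rw [← ncard_add_of_iff (s := {q | S.δ q.1 ≠ S.δ q.2 ∧ q ∈ inversions S t t' S'})]
  · exact ncard_add_of_iff (fun q => by simp only [Set.mem_ofPred_eq]; tauto)
      fun q h h' => h'.1 h.1
  · intro q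
    simp only [badInversions, Set.mem_ofPred_eq, ← and_assoc, ← or_and_right]
    refine and_congr_left' ?_
    omega
  · rintro q ⟨h0, -⟩ ⟨h1, -⟩
    omega

theorem IsExchange.ncard_wrongSide (h : IsExchange S t t' S') : (wrongSide S t t' S').ncard =
    {q | S.δ q.1 = S.δ q.2 ∧ q ∈ inversions S t t' S' ∧ q ∉ reversals S S'}.ncard := by
  obtain ⟨φ, hφ, hlt⟩ := S.exists_rank
  obtain ⟨ψ, -, hlt'⟩ := S'.exists_rank
  have htt := h.lt
  have h0 := h.zero
  have h1 := h.one
  refine ncard_eq_of_bij (fun z => if S.δ z = 0 then (z, t) else (t', z))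
    (fun q => if S.δ q.1 = 0 then q.1 else q.2) ?_ ?_
  · intro z
    simp only [wrongSide, between, reversals, inversions, Set.mem_ofPred_eq, hlt, hlt',
      swap_apply_def] at *
    have := S.δ_eq_zero_or_one z
    grind
  · rintro ⟨x, y⟩
    simp only [wrongSide, between, reversals, inversions, Set.mem_ofPred_eq, hlt, hlt',
      swap_apply_def] at *
    have := S.δ_eq_zero_or_one x
    grind

theorem IsExchange.ncard_reversals_diff (h : IsExchange S t t' S') :
    {q | q ∈ reversals S S' ∧ q ∉ inversions S t t' S'}.ncard =
    {z | z ∈ between S t t' ∧ ((S.δ z = 0 ∧ S'.lt z t) ∨ (S.δ z = 1 ∧ S'.lt t' z))}.ncard := by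
  obtain ⟨φ, hφ, hlt⟩ := S.exists_rank
  obtain ⟨ψ, -, hlt'⟩ := S'.exists_rank
  have htt := h.lt
  have h0 := h.zero
  have h1 := h.one
  symm
  refine ncard_eq_of_bij (fun z => if S.δ z = 0 then (t, z) else (z, t'))
    (fun q => if S.δ q.1 = 0 then q.2 else q.1) ?_ ?_
  · intro z
    simp only [between, reversals, inversions, Set.mem_ofPred_eq, hlt, hlt', swap_apply_def] at *
    have := S.δ_eq_zero_or_one z
    grind
  · rintro ⟨x, y⟩
    simp only [between, reversals, inversions, Set.mem_ofPred_eq, hlt, hlt', swap_apply_def] at *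
    have := S.δ_eq_zero_or_one x
    grind

theorem IsExchange.ncard_reversals (h : IsExchange S t t' S') :
    (reversals S S').ncard + 2 * (wrongSide S t t' S').ncard =
      {q | S.δ q.1 = S.δ q.2 ∧ q ∈ inversions S t t' S'}.ncard + (between S t t').ncard := by
  have hrev : (reversals S S').ncard = {q | q ∈ reversals S S' ∧ q ∈ inversions S t t' S'}.ncard +
      {q | q ∈ reversals S S' ∧ q ∉ inversions S t t' S'}.ncard :=
    ncard_add_of_iff (fun q => by simp only [Set.mem_ofPred_eq]; tauto) fun q h h' => h'.2 h.2
  have hinv : {q | S.δ q.1 = S.δ q.2 ∧ q ∈ inversions S t t' S'}.ncard =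
      {q | q ∈ reversals S S' ∧ q ∈ inversions S t t' S'}.ncard +
        {q | S.δ q.1 = S.δ q.2 ∧ q ∈ inversions S t t' S' ∧ q ∉ reversals S S'}.ncard :=
    ncard_add_of_iff (fun q => by simp only [reversals, Set.mem_ofPred_eq]; tauto)
      fun q h h' => h'.2.2 h.1
  have := ncard_between (S := S) (S' := S') (t := t) (t' := t')
  have := h.ncard_wrongSide
  have := h.ncard_reversals_diff
  omega

/-- The pairs counted by the length of `S` with the places of `t` and `t'` switched in its order. -/
def switchedLengthPairs (S : ABS T) (t t' : T) : Set (T × T) :=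
  {q | S.δ q.1 = 0 ∧ S.δ q.2 = 1 ∧ S.lt (swap t t' q.1) (swap t t' q.2)}

theorem IsExchange.length_add_badInversions (h : IsExchange S t t' S') :
    S'.length + (badInversions S t t' S').ncard = (switchedLengthPairs S t t').ncard +
      {q | S.δ q.1 = 1 ∧ S.δ q.2 = 0 ∧ q ∈ inversions S t t' S'}.ncard := by
  obtain ⟨φ, hφ, hlt⟩ := S.exists_rank
  obtain ⟨ψ, hψ, hlt'⟩ := S'.exists_rank
  set P := switchedLengthPairs S t t' with hP
  set L : Set (T × T) := {q | S'.δ q.1 = 0 ∧ S'.δ q.2 = 1 ∧ S'.lt q.1 q.2} with hL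
  have hL_add : S'.length = {q | q ∈ L ∧ q ∈ P}.ncard + {q | q ∈ L ∧ q ∉ P}.ncard :=
    ncard_add_of_iff (fun q => by simp only [Set.mem_ofPred_eq, ← hL]; tauto) fun q h h' => h'.2 h.2
  have hP_add : P.ncard = {q | q ∈ L ∧ q ∈ P}.ncard + (badInversions S t t' S').ncard := by
    refine ncard_add_of_iff (fun q => ?_) ?_
    · simp only [badInversions, inversions, hP, switchedLengthPairs, hL, Set.mem_ofPred_eq, hlt,
        hlt', h.δ_eq]
      have := @hψ q.1 q.2
      grind
    · rintro q ⟨⟨-, -, h3⟩, -⟩ ⟨-, -, -, h4⟩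
      exact S'.lt_asymm h3 h4
  have hdiff : {q | S.δ q.1 = 1 ∧ S.δ q.2 = 0 ∧ q ∈ inversions S t t' S'}.ncard =
      {q | q ∈ L ∧ q ∉ P}.ncard := by
    refine ncard_eq_of_bij Prod.swap Prod.swap ?_ ?_ <;> rintro ⟨x, y⟩ <;>
      simp only [hP, switchedLengthPairs, hL, inversions, Set.mem_ofPred_eq, hlt, hlt', h.δ_eq,
        Prod.swap]
    · grind
    · have := @hφ (swap t t' x) (swap t t' y)
      have := (swap t t').injective.eq_iff (a := x) (b := y)
      grind
  omega

theorem ncard_switchedLengthPairs_add (h0 : S.δ t = 0) (h1 : S.δ t' = 1) (htt : S.lt t t') :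
    (switchedLengthPairs S t t').ncard + (between S t t').ncard + 1 = S.length := by
  obtain ⟨φ, hφ, hlt⟩ := S.exists_rank
  have hlen : S.length = (switchedLengthPairs S t t').ncard +
      {q | (S.δ q.1 = 0 ∧ S.δ q.2 = 1 ∧ S.lt q.1 q.2) ∧ q ∉ switchedLengthPairs S t t'}.ncard := by
    refine ncard_add_of_iff (fun q => ?_) fun q h h' => h'.2 h
    simp only [switchedLengthPairs, Set.mem_ofPred_eq, hlt, swap_apply_def] at *
    grind
  -- the pairs lost by the switch are `(z, t')` for `t ≤ z` and `(t, z)` for `z < t'`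
  have hlost : {z | z ∈ between S t t' ∨ z = t'}.ncard =
      {q | (S.δ q.1 = 0 ∧ S.δ q.2 = 1 ∧ S.lt q.1 q.2) ∧ q ∉ switchedLengthPairs S t t'}.ncard := by
    refine ncard_eq_of_bij (fun z => if S.δ z = 0 then (z, t') else (t, z))
      (fun q => if q.1 = t then q.2 else q.1) ?_ ?_
    · intro z
      simp only [switchedLengthPairs, between, Set.mem_ofPred_eq, hlt, swap_apply_def] at *
      have := S.δ_eq_zero_or_one z
      grind
    · rintro ⟨x, y⟩
      simp only [switchedLengthPairs, between, Set.mem_ofPred_eq, hlt, swap_apply_def] at *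
      have := @hφ x t
      have := @hφ y t'
      grind
  have hadd : {z | z ∈ between S t t' ∨ z = t'}.ncard =
      (between S t t').ncard + ({t'} : Set T).ncard := by
    refine ncard_add_of_iff (fun z => Iff.rfl) ?_
    rintro z ⟨-, hz⟩ rfl
    exact S.lt_irrefl _ hz
  rw [Set.ncard_singleton] at hadd
  omega

theorem IsExchange.length_add (hS : S.Regular) (h : IsExchange S t t' S') :
    S'.length + 1 + 2 * (wrongSide S t t' S').ncard + 2 * (badInversions S t t' S').ncard =
      S.length := by
  have := h.ncard_inversions hS
  have := ncard_inversions_eq_add (S := S) (S' := S') (t := t) (t' := t')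
  have := h.ncard_reversals
  have := h.length_add_badInversions
  have := ncard_switchedLengthPairs_add h.zero h.one h.lt
  omega

omit [DecidableEq T] in
theorem IsExchange.length_lt (hS : S.Regular) (h : IsExchange S t t' S') :
    S'.length < S.length := by
  classical
  have := h.length_add hS
  omega

theorem IsExchange.length_add_one_iff (hS : S.Regular) (h : IsExchange S t t' S') :
    S'.length + 1 = S.length ↔ (∀ z, z ∉ wrongSide S t t' S') ∧
      ∀ x y, (x, y) ∈ inversions S t t' S' → S.δ x = S.δ y ∨ (S.δ x = 1 ∧ S.δ y = 0) := by
  have e := h.length_add hS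
  have h1 : (wrongSide S t t' S').ncard = 0 ↔ ∀ z, z ∉ wrongSide S t t' S' := by
    rw [Set.ncard_eq_zero, Set.eq_empty_iff_forall_notMem]
  have h2 : (badInversions S t t' S').ncard = 0 ↔
      ∀ x y, (x, y) ∈ inversions S t t' S' → S.δ x = S.δ y ∨ (S.δ x = 1 ∧ S.δ y = 0) := by
    rw [Set.ncard_eq_zero, Set.eq_empty_iff_forall_notMem, Prod.forall]
    refine forall₂_congr fun x y => ?_
    simp only [badInversions, Set.mem_ofPred_eq]
    have := S.δ_eq_zero_or_one x
    have := S.δ_eq_zero_or_one y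
    grind
  rw [← h1, ← h2]
  omega

end Exchange

section Simple

variable {m n : ℕ}

theorem simple_δ_eq_one_iff {t : Fin (m + n)} : (simple m n).δ t = 1 ↔ t.val < m := by
  simp [simple]

theorem simple_δ_eq_zero_iff {t : Fin (m + n)} : (simple m n).δ t = 0 ↔ m ≤ t.val := by
  simp [simple]

theorem simple_π_val (t : Fin (m + n)) :
    ((simple m n).π t).val = if t.val < m then t.val + n else t.val - m := by
  change (t.val + n) % (m + n) = _
  have := t.isLt
  split_ifs with h
  · exact Nat.mod_eq_of_lt (by omega)
  · rw [show t.val + n = (t.val - m) + (m + n) by omega, Nat.add_mod_right,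
      Nat.mod_eq_of_lt (by omega)]

theorem simple_π_mk_of_lt {k : ℕ} (h : k < m) :
    (simple m n).π ⟨k, by omega⟩ = ⟨k + n, by omega⟩ := by
  apply Fin.ext; rw [simple_π_val]; simp [h]

theorem simple_π_mk_add {k : ℕ} (h : k < n) :
    (simple m n).π ⟨k + m, by omega⟩ = ⟨k, by omega⟩ := by
  apply Fin.ext; rw [simple_π_val]; simp

theorem simple_lt_iff {s t : Fin (m + n)} : (simple m n).lt s t ↔ s.val < t.val := Iff.rfl

variable (m n) in
theorem simple_regular : (simple m n).Regular where
  lt_iff x y h := by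
    rw [simple_lt_iff, simple_lt_iff, simple_π_val, simple_π_val]
    rcases (simple m n).δ_eq_zero_or_one x with hx | hx
    · rw [hx, eq_comm, simple_δ_eq_zero_iff] at h
      rw [simple_δ_eq_zero_iff] at hx
      split_ifs <;> omega
    · rw [hx, eq_comm, simple_δ_eq_one_iff] at h
      rw [simple_δ_eq_one_iff] at hx
      split_ifs; omega
  lt_of x y hx hy := by
    rw [simple_δ_eq_zero_iff] at hx
    rw [simple_δ_eq_one_iff] at hy
    rw [simple_lt_iff, simple_π_val, simple_π_val]
    have := x.isLt
    split_ifs <;> omega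

theorem ncard_lt_eq {h k : ℕ} (hk : k ≤ h) : {t : Fin h | t.val < k}.ncard = k := by
  have : {t : Fin h | t.val < k} = ↑((Finset.univ : Finset (Fin k)).map (Fin.castLEEmb hk)) := by
    ext t
    simp only [Set.mem_ofPred_eq, Finset.coe_map, Finset.coe_univ, Set.image_univ, Set.mem_range]
    exact ⟨fun ht => ⟨⟨t, ht⟩, rfl⟩, fun ⟨s, hs⟩ => hs ▸ s.isLt⟩
  rw [this, Set.ncard_coe_finset]
  simp

variable (m n) in
theorem count_one_simple : (simple m n).count 1 = m := by
  simp only [count, simple_δ_eq_one_iff]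
  exact ncard_lt_eq (Nat.le_add_right m n)

theorem count_zero_add_count_one {T : Type*} [Finite T] (S : ABS T) :
    S.count 0 + S.count 1 = Nat.card T := by
  rw [← Set.ncard_univ, eq_comm]
  refine ncard_add_of_iff (fun x => ?_) fun x (h : S.δ x = 0) (h' : S.δ x = 1) => ?_
  · simpa using S.δ_eq_zero_or_one x
  · omega

variable (m n) in
theorem count_zero_simple : (simple m n).count 0 = n := by
  have := (simple m n).count_zero_add_count_one
  rw [count_one_simple, Nat.card_eq_fintype_card, Fintype.card_fin] at this
  omega

variable (m n) in
theorem length_simple : (simple m n).length = 0 := by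
  rw [length, Set.ncard_eq_zero, Set.eq_empty_iff_forall_notMem]
  rintro q ⟨h1, h2, h3⟩
  rw [simple_δ_eq_zero_iff] at h1
  rw [simple_δ_eq_one_iff] at h2
  rw [simple_lt_iff] at h3
  omega

end Simple

section Minimal

variable {m₁ n₁ m₂ n₂ : ℕ}

theorem bin_simple_lt_of_lt {c : Fin (m₁ + n₁)} {l : Fin (m₂ + n₂)} (hc : c.val < n₁)
    (hl : n₂ ≤ l.val) : (simple m₁ n₁).bin c < (simple m₂ n₂).bin l := by
  obtain ⟨c, hc'⟩ := c
  obtain ⟨l, hl'⟩ := l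
  obtain ⟨l, rfl⟩ := Nat.exists_eq_add_of_le' hl
  rw [← simple_π_mk_add hc, ← simple_π_mk_of_lt (by omega), bin_π_lt_iff,
    simple_δ_eq_zero_iff.2 (by simp), simple_δ_eq_one_iff.2 (Nat.lt_of_add_lt_add_right hl')]
  exact Or.inl (by decide)

theorem bin_simple_lt_of_le {c : Fin (m₁ + n₁)} {l : Fin (m₂ + n₂)} (hc : n₁ ≤ c.val)
    (hl : l.val < n₂) : (simple m₂ n₂).bin l < (simple m₁ n₁).bin c := by
  obtain ⟨c, hc'⟩ := c
  obtain ⟨l, hl'⟩ := l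
  obtain ⟨c, rfl⟩ := Nat.exists_eq_add_of_le' hc
  rw [← simple_π_mk_add hl, ← simple_π_mk_of_lt (by omega), bin_π_lt_iff,
    simple_δ_eq_zero_iff.2 (by simp), simple_δ_eq_one_iff.2 (Nat.lt_of_add_lt_add_right hc')]
  exact Or.inl (by decide)

theorem bin_simple_lt_of_lt_of_lt (h₁ : m₁ < n₁) (h₂ : n₂ < m₂) {c : Fin (m₁ + n₁)}
    {l : Fin (m₂ + n₂)} (hc : c.val < n₁) (hl : l.val < n₂) :
    (simple m₁ n₁).bin c < (simple m₂ n₂).bin l := by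
  obtain ⟨c, hc'⟩ := c
  obtain ⟨l, hl'⟩ := l
  simp only at hc hl
  -- two steps backwards move `l` up to `l + m₂ - n₂`
  induction hk : m₂ + n₂ - l using Nat.strong_induction_on generalizing c l with
  | _ k ih =>
    rw [← simple_π_mk_add hc, ← simple_π_mk_add hl, bin_π_lt_iff,
      simple_δ_eq_zero_iff.2 (by simp), simple_δ_eq_zero_iff.2 (by simp)]
    refine Or.inr ⟨rfl, ?_⟩
    by_cases hc2 : c + m₁ < n₁
    · exact bin_simple_lt_of_lt hc2 (by simp; omega)
    · have e1 : c + m₁ = (c + m₁ - n₁) + n₁ := by omega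
      have e2 : l + m₂ = (l + m₂ - n₂) + n₂ := by omega
      have e3 := simple_π_mk_of_lt (m := m₁) (n := n₁) (k := c + m₁ - n₁) (by omega)
      have e4 := simple_π_mk_of_lt (m := m₂) (n := n₂) (k := l + m₂ - n₂) (by omega)
      simp only [← e1, ← e2] at e3 e4
      rw [← e3, ← e4, bin_π_lt_iff, simple_δ_eq_one_iff.2 (by simp; omega),
        simple_δ_eq_one_iff.2 (by simp; omega)]
      refine Or.inr ⟨rfl, ?_⟩
      by_cases hl2 : l + m₂ - n₂ < n₂
      · exact ih _ (by omega) _ _ (by omega) _ _ hl2 rfl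
      · exact bin_simple_lt_of_lt (by simp; omega) (by simpa using hl2)

theorem bin_simple_lt_of_le_of_le (h₁ : m₁ < n₁) (h₂ : n₂ < m₂) {c : Fin (m₁ + n₁)}
    {l : Fin (m₂ + n₂)} (hc : n₁ ≤ c.val) (hl : n₂ ≤ l.val) :
    (simple m₁ n₁).bin c < (simple m₂ n₂).bin l := by
  obtain ⟨c, hc'⟩ := c
  obtain ⟨l, hl'⟩ := l
  obtain ⟨c, rfl⟩ := Nat.exists_eq_add_of_le' hc
  obtain ⟨l, rfl⟩ := Nat.exists_eq_add_of_le' hl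
  rw [← simple_π_mk_of_lt (by omega), ← simple_π_mk_of_lt (by omega), bin_π_lt_iff,
    simple_δ_eq_one_iff.2 (Nat.lt_of_add_lt_add_right hc'),
    simple_δ_eq_one_iff.2 (Nat.lt_of_add_lt_add_right hl')]
  refine Or.inr ⟨rfl, ?_⟩
  by_cases hl2 : l < n₂
  · exact bin_simple_lt_of_lt_of_lt h₁ h₂ (by simp; omega) hl2
  · exact bin_simple_lt_of_lt (by simp; omega) (by simpa using hl2)

variable (m₁ n₁ m₂ n₂) in
theorem minimal_regular : (minimalABS m₁ n₁ m₂ n₂).Regular :=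
  (simple_regular m₁ n₁).sum (simple_regular m₂ n₂)

theorem minimal_lt_inl_inl {x y : Fin (m₁ + n₁)} :
    (minimalABS m₁ n₁ m₂ n₂).lt (Sum.inl x) (Sum.inl y) ↔ x.val < y.val :=
  (simple_regular m₁ n₁).sum_lt_inl_inl

theorem minimal_lt_inr_inr {x y : Fin (m₂ + n₂)} :
    (minimalABS m₁ n₁ m₂ n₂).lt (Sum.inr x) (Sum.inr y) ↔ x.val < y.val :=
  (simple_regular m₂ n₂).sum_lt_inr_inr

theorem minimal_lt_inl_inr (h₁ : m₁ < n₁) (h₂ : n₂ < m₂) {x : Fin (m₁ + n₁)}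
    {y : Fin (m₂ + n₂)} :
    (minimalABS m₁ n₁ m₂ n₂).lt (Sum.inl x) (Sum.inr y) ↔ x.val < n₁ ∨ n₂ ≤ y.val := by
  rw [minimalABS, sum_lt_inl_inr]
  rcases lt_or_ge x.val n₁ with hx | hx <;> rcases lt_or_ge y.val n₂ with hy | hy
  · simp [hx, (bin_simple_lt_of_lt_of_lt h₁ h₂ hx hy).le]
  · simp [hx, (bin_simple_lt_of_lt hx hy).le]
  · simp [not_le.2 (bin_simple_lt_of_le hx hy), not_lt.2 hx, not_le.2 hy]
  · simp [hy, (bin_simple_lt_of_le_of_le h₁ h₂ hx hy).le]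

theorem length_minimal (h₁ : m₁ < n₁) (h₂ : n₂ < m₂) :
    (minimalABS m₁ n₁ m₂ n₂).length + m₁ * n₂ = n₁ * m₂ := by
  have hadd := cross_add (simple m₁ n₁) (simple m₂ n₂)
  have hcross : (simple m₂ n₂).cross (simple m₁ n₁) = 0 := by
    rw [cross, Set.ncard_eq_zero, Set.eq_empty_iff_forall_notMem]
    rintro q ⟨hq1, hq2, hq3⟩
    rw [simple_δ_eq_zero_iff] at hq1
    rw [simple_δ_eq_one_iff] at hq2
    exact absurd hq3 (_root_.lt_asymm (bin_simple_lt_of_lt (by omega) (by omega)))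
  rw [minimalABS, length_sum (simple_regular _ _) (simple_regular _ _), length_simple,
    length_simple]
  rw [count_one_simple, count_one_simple, count_zero_simple, count_zero_simple] at hadd
  omega

end Minimal

section Good

variable {T : Type*} [DecidableEq T] {S S' : ABS T} {t t' : T}

theorem IsExchange.lt_of_mem_inversions [Finite T] (h : IsExchange S t t' S')
    (hg : ∀ z, z ∉ wrongSide S t t' S') {x y : T} (hxy : (x, y) ∈ inversions S t t' S')
    (hδ : S.δ x = S.δ y) : S.lt x y := by
  obtain ⟨φ, hφ, hlt⟩ := S.exists_rank
  have h0 := h.zero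
  have h1 := h.one
  have htt := h.lt
  have hx := hg x
  have hy := hg y
  have hlt' := hxy.2
  have := S.δ_eq_zero_or_one x
  clear hg
  simp only [wrongSide, between, inversions, Set.mem_ofPred_eq, hlt, swap_apply_def] at *
  split_ifs at hxy <;> grind

theorem IsGoodExchange.mem_inversions_cases [Finite T] (hS : S.Regular)
    (h : IsGoodExchange S t t' S') {x y : T} (hxy : (x, y) ∈ inversions S t t' S') :
    (S.δ x = S.δ y ∧ S.lt x y ∧ (S'.π x, S'.π y) ∈ inversions S t t' S') ∨
      (S.δ x = 1 ∧ S.δ y = 0) := by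
  obtain ⟨hw, hb⟩ := (h.1.length_add_one_iff hS).1 h.2
  refine (hb x y hxy).imp_left fun hδ => ?_
  have hlt := h.1.lt_of_mem_inversions hw hxy hδ
  exact ⟨hδ, hlt, (h.1.mem_inversions_π hS x y).2 ⟨hδ, hlt, hxy.2⟩⟩

theorem IsGoodExchange.π_mem_inversions_of_zero [Finite T] (hS : S.Regular)
    (h : IsGoodExchange S t t' S') {x y : T} (hxy : (x, y) ∈ inversions S t t' S')
    (hx : S.δ x = 0) : S.δ y = 0 ∧ (S'.π x, S'.π y) ∈ inversions S t t' S' := by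
  rcases h.mem_inversions_cases hS hxy with ⟨hδ, -, hI⟩ | ⟨hx', -⟩
  · exact ⟨hδ ▸ hx, hI⟩
  · omega

theorem IsGoodExchange.π_mem_inversions_of_one [Finite T] (hS : S.Regular)
    (h : IsGoodExchange S t t' S') {x y : T} (hxy : (x, y) ∈ inversions S t t' S')
    (hy : S.δ y = 1) : S.δ x = 1 ∧ (S'.π x, S'.π y) ∈ inversions S t t' S' := by
  rcases h.mem_inversions_cases hS hxy with ⟨hδ, -, hI⟩ | ⟨-, hy'⟩
  · exact ⟨hδ ▸ hy, hI⟩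
  · omega

theorem IsGoodExchange.π_fst_mem_inversions [Finite T] (hS : S.Regular)
    (h : IsGoodExchange S t t' S') {z : T} (hz : z ∈ between S t t') (hδ : S.δ z = 0) :
    (S'.π t, S'.π z) ∈ inversions S t t' S' := by
  refine (h.1.mem_inversions_π hS t z).2 ⟨h.1.zero.trans hδ.symm, hz.1, ?_⟩
  rcases S'.lt_trichotomy z t with hlt | rfl | hlt
  · exact hlt
  · exact absurd hz.1 (S.lt_irrefl _)
  · exact absurd ⟨hz, Or.inl ⟨hδ, hlt⟩⟩ (((h.1.length_add_one_iff hS).1 h.2).1 z)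

theorem IsGoodExchange.π_snd_mem_inversions [Finite T] (hS : S.Regular)
    (h : IsGoodExchange S t t' S') {z : T} (hz : z ∈ between S t t') (hδ : S.δ z = 1) :
    (S'.π z, S'.π t') ∈ inversions S t t' S' := by
  refine (h.1.mem_inversions_π hS z t').2 ⟨hδ.trans h.1.one.symm, hz.2, ?_⟩
  rcases S'.lt_trichotomy t' z with hlt | rfl | hlt
  · exact hlt
  · exact absurd hz.2 (S.lt_irrefl _)
  · exact absurd ⟨hz, Or.inr ⟨hδ, hlt⟩⟩ (((h.1.length_add_one_iff hS).1 h.2).1 z)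

end Good

section Resolves

/-- The pair `(x, y)` is resolved after `r` steps of `σ`: the pairs `(σˢ x, σˢ y)`, `0 < s < r`, are
in order and have equal values under `δ`, and `(σʳ x, σʳ y)` has the values `(1, 0)`. -/
def ResolvesAt {T : Type*} (S : ABS T) (σ : Perm T) (x y : T) (r : ℕ) : Prop :=
  1 ≤ r ∧
    (∀ s, 1 ≤ s → s < r → S.δ ((σ ^ s) x) = S.δ ((σ ^ s) y) ∧ S.lt ((σ ^ s) x) ((σ ^ s) y)) ∧
    S.δ ((σ ^ r) x) = 1 ∧ S.δ ((σ ^ r) y) = 0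

/-- The pair `(x, y)` is resolved by `σ` without having met `c`, and the pair reached when it is
resolved satisfies `E`. -/
def Resolves {T : Type*} (S : ABS T) (σ : Perm T) (c x y : T) (E : T → T → Prop) : Prop :=
  ∃ r, ResolvesAt S σ x y r ∧ (∀ s, 1 ≤ s → s ≤ r → (σ ^ s) x ≠ c ∧ (σ ^ s) y ≠ c) ∧
    E ((σ ^ r) x) ((σ ^ r) y)

variable {T T' : Type*} {S : ABS T} {S' : ABS T'} {σ : Perm T} {σ' : Perm T'} {c x y : T}
  {E E' : T → T → Prop}

theorem Resolves.mono (h : Resolves S σ c x y E) (hE : ∀ a b, E a b → E' a b) :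
    Resolves S σ c x y E' :=
  let ⟨r, hr, hc, hxy⟩ := h
  ⟨r, hr, hc, hE _ _ hxy⟩

theorem resolvesAt_map_iff {η : T → T'} (hδ : ∀ z, S'.δ (η z) = S.δ z)
    (hlt : ∀ z w, S'.lt (η z) (η w) ↔ S.lt z w) {r : ℕ}
    (hx : ∀ s, s ≤ r → (σ' ^ s) (η x) = η ((σ ^ s) x))
    (hy : ∀ s, s ≤ r → (σ' ^ s) (η y) = η ((σ ^ s) y)) :
    ResolvesAt S' σ' (η x) (η y) r ↔ ResolvesAt S σ x y r := by
  have hmid : ∀ s, s < r → ((S'.δ ((σ' ^ s) (η x)) = S'.δ ((σ' ^ s) (η y)) ∧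
      S'.lt ((σ' ^ s) (η x)) ((σ' ^ s) (η y))) ↔
        (S.δ ((σ ^ s) x) = S.δ ((σ ^ s) y) ∧ S.lt ((σ ^ s) x) ((σ ^ s) y))) := fun s hs => by
    rw [hx s hs.le, hy s hs.le, hδ, hδ, hlt]
  rw [ResolvesAt, ResolvesAt, hx r le_rfl, hy r le_rfl, hδ, hδ]
  refine and_congr_right fun _ => and_congr_left fun _ => ?_
  exact forall₃_congr fun s _ hs => hmid s hs

theorem resolves_of_step {I : ℕ → Prop} {q : ℕ} (hq : 0 < q)
    (hmeet : (σ ^ q) x = c ∨ (σ ^ q) y = c) (h0 : I 0)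
    (hstep : ∀ s, s < q → I s → ((σ ^ (s + 1)) x ≠ c ∧ (σ ^ (s + 1)) y ≠ c) ∧
      ((S.δ ((σ ^ (s + 1)) x) = S.δ ((σ ^ (s + 1)) y) ∧
          S.lt ((σ ^ (s + 1)) x) ((σ ^ (s + 1)) y) ∧ I (s + 1)) ∨
        (S.δ ((σ ^ (s + 1)) x) = 1 ∧ S.δ ((σ ^ (s + 1)) y) = 0 ∧
          E ((σ ^ (s + 1)) x) ((σ ^ (s + 1)) y)))) :
    Resolves S σ c x y E := by
  by_contra hno
  have hall : ∀ s, s ≤ q → I s ∧ ∀ u, 1 ≤ u → u ≤ s → ((σ ^ u) x ≠ c ∧ (σ ^ u) y ≠ c) ∧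
      S.δ ((σ ^ u) x) = S.δ ((σ ^ u) y) ∧ S.lt ((σ ^ u) x) ((σ ^ u) y) := by
    intro s
    induction s with
    | zero => exact fun _ => ⟨h0, by omega⟩
    | succ s ih =>
      intro hsq
      obtain ⟨hI, hs⟩ := ih (by omega)
      obtain ⟨hne, ⟨hδ, hlt, hI'⟩ | ⟨hx, hy, hE⟩⟩ := hstep s hsq hI
      · refine ⟨hI', fun u hu hus => ?_⟩
        rcases hus.lt_or_eq with hus | rfl
        · exact hs u hu (by omega)
        · exact ⟨hne, hδ, hlt⟩
      · refine absurd ⟨s + 1, ⟨by omega, fun u hu hus => (hs u hu (by omega)).2, hx, hy⟩,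
          fun u hu hus => ?_, hE⟩ hno
        rcases hus.lt_or_eq with hus | rfl
        · exact (hs u hu (by omega)).1
        · exact hne
  have hne := ((hall q le_rfl).2 q hq le_rfl).1
  tauto

end Resolves

section Transitive

theorem exists_first_pow_apply_eq {T : Type*} {σ : Perm T} {x c : T}
    (h : ∃ q, 0 < q ∧ (σ ^ q) x = c) :
    ∃ q, 0 < q ∧ (σ ^ q) x = c ∧ ∀ u, 0 < u → u < q → (σ ^ u) x ≠ c := by
  classical
  exact ⟨Nat.find h, (Nat.find_spec h).1, (Nat.find_spec h).2,
    fun u hu huq e => Nat.find_min h huq ⟨hu, e⟩⟩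

theorem pow_apply_self_ne_of_first {T : Type*} {σ : Perm T} {x c : T} {q : ℕ} (hxc : x ≠ c)
    (hq : (σ ^ q) x = c) (hmin : ∀ u, 0 < u → u < q → (σ ^ u) x ≠ c) {u : ℕ} (hu : 0 < u)
    (huq : u ≤ q) : (σ ^ u) c ≠ c := by
  intro e
  rcases huq.lt_or_eq with hlt | rfl
  · refine hmin (q - u) (by omega) (by omega) ((σ ^ u).injective ?_)
    rw [← Perm.mul_apply, ← pow_add, Nat.add_sub_cancel' huq, hq, e]
  · exact hxc ((σ ^ u).injective (hq.trans e.symm))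

theorem exists_pos_mul_modEq {n h : ℕ} (hh : 0 < h) (hc : Nat.Coprime n h) (d : ℕ) :
    ∃ q, 0 < q ∧ q * n ≡ d [MOD h] := by
  rcases Nat.lt_or_ge 1 h with h1 | h1
  · obtain ⟨u, -, hu⟩ := Nat.exists_mul_mod_eq_one_of_coprime hc h1
    refine ⟨u * d + h, by omega, ?_⟩
    have hu' : n * u ≡ 1 [MOD h] := by rw [Nat.ModEq, hu, Nat.mod_eq_of_lt h1]
    calc (u * d + h) * n = n * u * d + h * n := by ring
      _ ≡ n * u * d [MOD h] := by simp [Nat.ModEq]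
      _ ≡ 1 * d [MOD h] := hu'.mul_right d
      _ = d := one_mul d
  · obtain rfl : h = 1 := by omega
    exact ⟨1, one_pos, Nat.modEq_one⟩

theorem simple_π_pow_val {m n : ℕ} (t : Fin (m + n)) (s : ℕ) :
    (((simple m n).π ^ s) t).val = (t.val + s * n) % (m + n) := by
  induction s with
  | zero => simp [Nat.mod_eq_of_lt t.isLt]
  | succ s ih =>
    rw [pow_succ', Perm.mul_apply]
    change (_ + n) % (m + n) = _
    rw [ih, Nat.mod_add_mod]
    congr 1
    ring

theorem exists_simple_π_pow_eq {m n : ℕ} (hc : Nat.Coprime m n) (x y : Fin (m + n)) :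
    ∃ q, 0 < q ∧ ((simple m n).π ^ q) x = y := by
  have hh : 0 < m + n := x.pos
  obtain ⟨q, hq, hq'⟩ := exists_pos_mul_modEq hh
    (show Nat.Coprime n (m + n) by simpa using hc.symm) (y.val + (m + n - x.val))
  refine ⟨q, hq, Fin.ext ?_⟩
  rw [simple_π_pow_val]
  have := hq'.add_left x.val
  rw [show x.val + (y.val + (m + n - x.val)) = y.val + (m + n) by omega] at this
  rw [Nat.ModEq, Nat.add_mod_right, Nat.mod_eq_of_lt y.isLt] at this
  exact this

end Transitive

section SwitchedSum

variable {α β : Type*} [DecidableEq α] [DecidableEq β] {A : ABS α} {B : ABS β} {S : ABS (α ⊕ β)}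
  {i c : α} {j d : β} (hπ : S.π = swap (Sum.inl i) (Sum.inr j) * (A.sum B).π)

include hπ

theorem switched_π_inl (hc : A.π c ≠ i) : S.π (Sum.inl c) = Sum.inl (A.π c) := by
  rw [hπ, Perm.mul_apply, sum_π_inl, swap_apply_of_ne_of_ne (by simpa using hc) (by simp)]

theorem switched_π_inl_eq (hc : A.π c = i) : S.π (Sum.inl c) = Sum.inr j := by
  rw [hπ, Perm.mul_apply, sum_π_inl, hc, swap_apply_left]

theorem switched_π_inr (hd : B.π d ≠ j) : S.π (Sum.inr d) = Sum.inr (B.π d) := by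
  rw [hπ, Perm.mul_apply, sum_π_inr, swap_apply_of_ne_of_ne (by simp) (by simpa using hd)]

theorem switched_π_inr_eq (hd : B.π d = j) : S.π (Sum.inr d) = Sum.inl i := by
  rw [hπ, Perm.mul_apply, sum_π_inr, hd, swap_apply_right]

theorem switched_π_pow_inl {r : ℕ} (hr : ∀ s, 1 ≤ s → s ≤ r → (A.π ^ s) c ≠ i) {s : ℕ}
    (hs : s ≤ r) : (S.π ^ s) (Sum.inl c) = Sum.inl ((A.π ^ s) c) := by
  induction s with
  | zero => rfl
  | succ s ih =>
    have hne := hr (s + 1) (by omega) hs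
    rw [pow_succ', Perm.mul_apply] at hne
    rw [pow_succ', Perm.mul_apply, ih (by omega), switched_π_inl hπ hne, pow_succ', Perm.mul_apply]

theorem switched_π_pow_inr {r : ℕ} (hr : ∀ s, 1 ≤ s → s ≤ r → (B.π ^ s) d ≠ j) {s : ℕ}
    (hs : s ≤ r) : (S.π ^ s) (Sum.inr d) = Sum.inr ((B.π ^ s) d) := by
  induction s with
  | zero => rfl
  | succ s ih =>
    have hne := hr (s + 1) (by omega) hs
    rw [pow_succ', Perm.mul_apply] at hne
    rw [pow_succ', Perm.mul_apply, ih (by omega), switched_π_inr hπ hne, pow_succ', Perm.mul_apply]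

theorem exists_switched_π_pow_inl_eq (hc : ∃ q, 0 < q ∧ (A.π ^ q) c = i) :
    ∃ q, (S.π ^ q) (Sum.inl c) = Sum.inr j := by
  obtain ⟨q, hq, hqi, hmin⟩ := exists_first_pow_apply_eq hc
  obtain ⟨q, rfl⟩ := Nat.exists_eq_succ_of_ne_zero hq.ne'
  rw [pow_succ', Perm.mul_apply] at hqi
  refine ⟨q + 1, ?_⟩
  rw [pow_succ', Perm.mul_apply,
    switched_π_pow_inl hπ (fun s hs hsq => hmin s hs (Nat.lt_succ_of_le hsq)) le_rfl,
    switched_π_inl_eq hπ hqi]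

theorem exists_switched_π_pow_inr_eq (hd : ∃ q, 0 < q ∧ (B.π ^ q) d = j) :
    ∃ q, (S.π ^ q) (Sum.inr d) = Sum.inl i := by
  obtain ⟨q, hq, hqj, hmin⟩ := exists_first_pow_apply_eq hd
  obtain ⟨q, rfl⟩ := Nat.exists_eq_succ_of_ne_zero hq.ne'
  rw [pow_succ', Perm.mul_apply] at hqj
  refine ⟨q + 1, ?_⟩
  rw [pow_succ', Perm.mul_apply,
    switched_π_pow_inr hπ (fun s hs hsq => hmin s hs (Nat.lt_succ_of_le hsq)) le_rfl,
    switched_π_inr_eq hπ hqj]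

end SwitchedSum

section GoodMinimal

variable {m₁ n₁ m₂ n₂ : ℕ} {i : Fin (m₁ + n₁)} {j : Fin (m₂ + n₂)}
  {Sm : ABS (Elt m₁ n₁ m₂ n₂)}

theorem simple_δ_eq_iff {m n m' n' : ℕ} {a : Fin (m + n)} {b : Fin (m' + n')} :
    (simple m n).δ a = (simple m' n').δ b ↔ (a.val < m ↔ b.val < m') := by
  rcases (simple m n).δ_eq_zero_or_one a with ha | ha <;>
    rcases (simple m' n').δ_eq_zero_or_one b with hb | hb <;> rw [ha, hb] <;>
    simp only [simple_δ_eq_zero_iff, simple_δ_eq_one_iff] at ha hb <;> simp <;> omega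

variable (h₁ : m₁ < n₁) (h₂ : n₂ < m₂) (hm : 0 < m₁) (hi : m₁ ≤ i.val) (hi' : i.val < n₁)
  (hj : j.val < n₂) (h : IsGoodExchange (minimalABS m₁ n₁ m₂ n₂) (Sum.inl i) (Sum.inr j) Sm)

include h₁ h₂ hi' hj h

theorem exists_inl_inr_mem_inversions {c : Fin (m₁ + n₁)} {l : Fin (m₂ + n₂)} (hl : l.val ≤ j.val)
    (hI : (Sum.inl c, Sum.inr l) ∈
      inversions (minimalABS m₁ n₁ m₂ n₂) (Sum.inl i) (Sum.inr j) Sm) :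
    ∃ (c' : Fin (m₁ + n₁)) (l' : Fin (m₂ + n₂)), l'.val < l.val ∧ (Sum.inl c', Sum.inr l') ∈
      inversions (minimalABS m₁ n₁ m₂ n₂) (Sum.inl i) (Sum.inr j) Sm := by
  have hS := minimal_regular m₁ n₁ m₂ n₂
  obtain ⟨hδc, hI⟩ := h.π_mem_inversions_of_one hS hI (simple_δ_eq_one_iff.2 (by omega))
  have hπc : ((simple m₁ n₁).π c).val = c.val + n₁ := by
    rw [simple_π_val, if_pos (simple_δ_eq_one_iff.1 hδc)]
  have hπl : ((simple m₂ n₂).π l).val = l.val + n₂ := by rw [simple_π_val, if_pos (by omega)]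
  rw [switched_π_inl h.1.π_eq (fun e => by rw [e] at hπc; omega),
    switched_π_inr h.1.π_eq (fun e => by rw [e] at hπl; omega)] at hI
  generalize (simple m₁ n₁).π c = c₁ at *
  generalize (simple m₂ n₂).π l = l₁ at *
  obtain ⟨hδl₁, hI⟩ := h.π_mem_inversions_of_zero hS hI (simple_δ_eq_zero_iff.2 (by omega))
  have hl₁ := simple_δ_eq_zero_iff.1 hδl₁
  have hπl₁ : ((simple m₂ n₂).π l₁).val = l₁.val - m₂ := by
    rw [simple_π_val, if_neg (by omega)]
  rw [switched_π_inr h.1.π_eq (fun e => by rw [e] at hπl₁; omega)] at hI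
  by_cases hc : (simple m₁ n₁).π c₁ = i
  · rw [switched_π_inl_eq h.1.π_eq hc] at hI
    refine absurd ?_ (((h.1.length_add_one_iff hS).1 h.2).1 (Sum.inr ((simple m₂ n₂).π l₁)))
    exact ⟨⟨(minimal_lt_inl_inr h₁ h₂).2 (Or.inl hi'), minimal_lt_inr_inr.2 (by omega)⟩,
      Or.inr ⟨simple_δ_eq_one_iff.2 (by omega), hI.2⟩⟩
  · rw [switched_π_inl h.1.π_eq hc] at hI
    exact ⟨_, _, by omega, hI⟩

theorem inl_inr_notMem_inversions (c : Fin (m₁ + n₁)) {l : Fin (m₂ + n₂)} (hl : l.val ≤ j.val) :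
    (Sum.inl c, Sum.inr l) ∉
      inversions (minimalABS m₁ n₁ m₂ n₂) (Sum.inl i) (Sum.inr j) Sm := by
  intro hI
  induction hk : l.val using Nat.strong_induction_on generalizing c l with
  | _ k ih =>
    obtain ⟨c', l', hlt, hI'⟩ := exists_inl_inr_mem_inversions h₁ h₂ hi' hj h hl hI
    exact ih l' (by omega) c' (by omega) hI' rfl

include hm hi in
theorem inl_left_inr_notMem_inversions {y : Fin (m₂ + n₂)} (hy : y.val < j.val + m₂) :
    (Sum.inl i, Sum.inr y) ∉
      inversions (minimalABS m₁ n₁ m₂ n₂) (Sum.inl i) (Sum.inr j) Sm := by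
  intro hI
  obtain ⟨hδy, hI⟩ := h.π_mem_inversions_of_zero (minimal_regular _ _ _ _) hI h.1.zero
  have hym := simple_δ_eq_zero_iff.1 hδy
  have hπi : ((simple m₁ n₁).π i).val = i.val - m₁ := by rw [simple_π_val, if_neg (by omega)]
  have hπy : ((simple m₂ n₂).π y).val = y.val - m₂ := by rw [simple_π_val, if_neg (by omega)]
  rw [switched_π_inl h.1.π_eq (fun e => by rw [e] at hπi; omega),
    switched_π_inr h.1.π_eq (fun e => by rw [e] at hπy; omega)] at hI
  exact inl_inr_notMem_inversions h₁ h₂ hi' hj h _ (by omega) hI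

include hi in
theorem resolves_up (hc : Nat.Coprime m₁ n₁) (k : Fin (m₁ + n₁)) (hik : i.val < k.val)
    (hk : k.val < n₁) : Resolves (simple m₁ n₁) (simple m₁ n₁).π i i k
      fun x y => Sm.lt (Sum.inl y) (Sum.inl x) := by
  have hS := minimal_regular m₁ n₁ m₂ n₂
  set σ := (simple m₁ n₁).π
  obtain ⟨q, hq, hqk, hmin⟩ := exists_first_pow_apply_eq (exists_simple_π_pow_eq hc k i)
  have hki : k ≠ i := by rintro rfl; exact hik.false
  refine resolves_of_step (I := fun s => (Sm.π (Sum.inl ((σ ^ s) i)), Sm.π (Sum.inl ((σ ^ s) k))) ∈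
    inversions (minimalABS m₁ n₁ m₂ n₂) (Sum.inl i) (Sum.inr j) Sm) hq (Or.inr hqk) ?_ ?_
  · exact h.π_fst_mem_inversions hS ⟨minimal_lt_inl_inl.2 hik,
      (minimal_lt_inl_inr h₁ h₂).2 (Or.inl hk)⟩ (simple_δ_eq_zero_iff.2 (hi.trans hik.le))
  intro s hs hI
  have hi_ne := pow_apply_self_ne_of_first hki hqk hmin s.succ_pos hs
  rw [pow_succ', Perm.mul_apply] at hi_ne
  rw [switched_π_inl h.1.π_eq hi_ne] at hI
  have hk_ne : σ ((σ ^ s) k) ≠ i := fun e => by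
    rw [switched_π_inl_eq h.1.π_eq e] at hI
    exact inl_inr_notMem_inversions h₁ h₂ hi' hj h _ le_rfl hI
  rw [switched_π_inl h.1.π_eq hk_ne] at hI
  simp only [pow_succ' σ s, Perm.mul_apply]
  refine ⟨⟨hi_ne, hk_ne⟩, (h.mem_inversions_cases hS hI).imp ?_ ?_⟩
  · exact fun ⟨hδ, hlt, hI'⟩ => ⟨hδ, minimal_lt_inl_inl.1 hlt, hI'⟩
  · exact fun ⟨hδi, hδk⟩ => ⟨hδi, hδk, hI.2⟩

include hm hi in
theorem resolves_down (hc : Nat.Coprime m₂ n₂) (l : Fin (m₂ + n₂)) (hlj : l.val < j.val) :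
    Resolves (simple m₂ n₂) (simple m₂ n₂).π j l j
      fun x y => Sm.lt (Sum.inr y) (Sum.inr x) := by
  have hS := minimal_regular m₁ n₁ m₂ n₂
  set σ := (simple m₂ n₂).π
  have hσ_val : ∀ z, (σ z).val = if z.val < m₂ then z.val + n₂ else z.val - m₂ := simple_π_val
  obtain ⟨q, hq, hql, hmin⟩ := exists_first_pow_apply_eq (exists_simple_π_pow_eq hc l j)
  have hl_ne_j : l ≠ j := by rintro rfl; exact hlj.false
  refine resolves_of_step (I := fun s => (Sm.π (Sum.inr ((σ ^ s) l)), Sm.π (Sum.inr ((σ ^ s) j))) ∈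
      inversions (minimalABS m₁ n₁ m₂ n₂) (Sum.inl i) (Sum.inr j) Sm ∧
    (σ ((σ ^ s) j)).val = (σ ((σ ^ s) l)).val + (j.val - l.val)) hq (Or.inl hql) ⟨?_, ?_⟩ ?_
  · exact h.π_snd_mem_inversions hS ⟨(minimal_lt_inl_inr h₁ h₂).2 (Or.inl hi'),
      minimal_lt_inr_inr.2 hlj⟩ (simple_δ_eq_one_iff.2 (show l.val < m₂ by omega))
  · simp only [pow_zero, Perm.one_apply, hσ_val]
    split_ifs <;> omega
  rintro s hs ⟨hI, hdiff⟩
  have hj_ne := pow_apply_self_ne_of_first hl_ne_j hql hmin s.succ_pos hs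
  rw [pow_succ', Perm.mul_apply] at hj_ne
  rw [switched_π_inr (d := (σ ^ s) j) h.1.π_eq hj_ne] at hI
  have hl_ne : σ ((σ ^ s) l) ≠ j := fun e => by
    rw [switched_π_inr_eq h.1.π_eq e] at hI
    exact inl_left_inr_notMem_inversions h₁ h₂ hm hi hi' hj h (by rw [hdiff, e]; omega) hI
  rw [switched_π_inr h.1.π_eq hl_ne] at hI
  simp only [pow_succ' σ s, Perm.mul_apply]
  refine ⟨⟨hl_ne, hj_ne⟩, (h.mem_inversions_cases hS hI).imp ?_ ?_⟩
  · rintro ⟨hδ, hlt, hI'⟩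
    refine ⟨hδ, minimal_lt_inr_inr.1 hlt, hI', ?_⟩
    have hδ' : (σ ((σ ^ s) l)).val < m₂ ↔ (σ ((σ ^ s) j)).val < m₂ := simple_δ_eq_iff.1 hδ
    rw [hσ_val (σ ((σ ^ s) j)), hσ_val (σ ((σ ^ s) l))]
    split_ifs <;> omega
  · exact fun ⟨hδl, hδj⟩ => ⟨hδl, hδj, hI.2⟩

end GoodMinimal

section Criterion

variable {T : Type*} [Finite T] {S S' : ABS T} {t t' : T}

theorem IsExchange.eq_fst_or_eq_snd_of_mem_reversals [DecidableEq T] (h : IsExchange S t t' S')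
    {x y : T} (hr : (x, y) ∈ reversals S S') (hI : (x, y) ∉ inversions S t t' S') :
    (x = t ∧ y ∈ between S t t' ∧ S.δ y = 0) ∨ (y = t' ∧ x ∈ between S t t' ∧ S.δ x = 1) := by
  obtain ⟨hδ, hlt, hlt'⟩ := hr
  obtain ⟨φ, hφ, hφlt⟩ := S.exists_rank
  have hz := h.zero
  have ho := h.one
  have htt := h.lt
  simp only [between, inversions, Set.mem_ofPred_eq, hφlt, swap_apply_def, not_and] at *
  have hI' : ¬ _ := fun e => hI e hlt'
  split_ifs at hI' <;> grind

omit [Finite T] in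
theorem IsExchange.exists_mem_reversals_of_bin_ne [DecidableEq T] (hS : S.Regular)
    (h : IsExchange S t t' S') {N : ℕ} {x y : T} (hxy : (x, y) ∈ inversions S t t' S')
    (hN : ofLex (S'.bin x) N ≠ ofLex (S'.bin y) N) :
    ∃ a b s, 1 ≤ s ∧ (S'.π ^ s) a = x ∧ (S'.π ^ s) b = y ∧
      (∀ u, 1 ≤ u → u < s → S.δ ((S'.π ^ u) a) = S.δ ((S'.π ^ u) b)) ∧
      (a, b) ∈ reversals S S' ∧ (a, b) ∉ inversions S t t' S' := by
  induction N generalizing x y with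
  | zero =>
    obtain ⟨x, rfl⟩ := S'.π.surjective x
    obtain ⟨y, rfl⟩ := S'.π.surjective y
    rw [bin_π_zero, bin_π_zero, h.δ_eq] at hN
    exact absurd ((h.mem_inversions_π hS x y).1 hxy).1 hN
  | succ N ih =>
    obtain ⟨x, rfl⟩ := S'.π.surjective x
    obtain ⟨y, rfl⟩ := S'.π.surjective y
    rw [bin_π_succ, bin_π_succ] at hN
    have hr := (h.mem_inversions_π hS x y).1 hxy
    by_cases hI : (x, y) ∈ inversions S t t' S'
    · obtain ⟨a, b, s, hs, rfl, rfl, hu, hab⟩ := ih hI hN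
      refine ⟨a, b, s + 1, by omega, by rw [pow_succ', Perm.mul_apply],
        by rw [pow_succ', Perm.mul_apply], fun u hu1 hus => ?_, hab⟩
      rcases (Nat.lt_succ_iff.1 hus).lt_or_eq with hus | rfl
      · exact hu u hu1 hus
      · exact hr.1
    · exact ⟨x, y, 1, le_rfl, by simp, by simp, by omega, hr, hI⟩

theorem IsExchange.δ_of_mem_inversions [DecidableEq T] (hS : S.Regular) (h : IsExchange S t t' S')
    (hinj : Function.Injective S'.bin)
    (h0 : ∀ z ∈ between S t t', S.δ z = 0 → ∃ r, ResolvesAt S S'.π t z r)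
    (h1 : ∀ z ∈ between S t t', S.δ z = 1 → ∃ r, ResolvesAt S S'.π z t' r) {x y : T}
    (hxy : (x, y) ∈ inversions S t t' S') :
    (S.δ x = S.δ y ∧ S.lt x y) ∨ (S.δ x = 1 ∧ S.δ y = 0) := by
  have hbin : S'.bin x ≠ S'.bin y := fun e => S'.lt_irrefl y (hinj e ▸ hxy.2)
  obtain ⟨N, hN⟩ : ∃ N, ofLex (S'.bin x) N ≠ ofLex (S'.bin y) N :=
    Function.ne_iff.1 fun e => hbin (ofLex.injective e)
  obtain ⟨a, b, s, hs, rfl, rfl, hδ, hr, hI⟩ := h.exists_mem_reversals_of_bin_ne hS hxy hN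
  obtain ⟨r, hr1, hlt, ha, hb⟩ : ∃ r, ResolvesAt S S'.π a b r := by
    rcases h.eq_fst_or_eq_snd_of_mem_reversals hr hI with ⟨rfl, hy, hy0⟩ | ⟨rfl, hx, hx1⟩
    · exact h0 b hy hy0
    · exact h1 a hx hx1
  rcases _root_.lt_trichotomy s r with hsr | rfl | hsr
  · exact Or.inl (hlt s hs hsr)
  · exact Or.inr ⟨ha, hb⟩
  · have := hδ r hr1 hsr
    omega

theorem IsExchange.length_add_one_of_forall (hS : S.Regular) (h : IsExchange S t t' S')
    (hinj : Function.Injective S'.bin)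
    (h0 : ∀ z ∈ between S t t', S.δ z = 0 → ∃ r, ResolvesAt S S'.π t z r)
    (h1 : ∀ z ∈ between S t t', S.δ z = 1 → ∃ r, ResolvesAt S S'.π z t' r) :
    S'.length + 1 = S.length := by
  classical
  have hδ : ∀ {x y}, (x, y) ∈ inversions S t t' S' →
      (S.δ x = S.δ y ∧ S.lt x y) ∨ (S.δ x = 1 ∧ S.δ y = 0) := h.δ_of_mem_inversions hS hinj h0 h1
  refine (h.length_add_one_iff hS).2 ⟨?_, fun x y hxy => (hδ hxy).imp_left And.left⟩
  rintro z ⟨⟨htz, hzt'⟩, hside⟩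
  have hswap : swap t t' z = z := by
    refine swap_apply_of_ne_of_ne ?_ ?_ <;> rintro rfl
    · exact S.lt_irrefl _ htz
    · exact S.lt_irrefl _ hzt'
  rcases hside with ⟨hz, hlt⟩ | ⟨hz, hlt⟩
  · have hI : (z, t) ∈ inversions S t t' S' := ⟨by simpa [hswap] using hzt', hlt⟩
    rcases hδ hI with ⟨-, hlt'⟩ | ⟨hz', -⟩
    · exact S.lt_asymm htz hlt'
    · omega
  · have hI : (t', z) ∈ inversions S t t' S' := ⟨by simpa [hswap] using htz, hlt⟩
    rcases hδ hI with ⟨-, hlt'⟩ | ⟨-, hz'⟩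
    · exact S.lt_asymm hzt' hlt'
    · omega

omit [Finite T]

/-- The reordering of a sequence with injective expansions by these expansions. -/
@[reducible] noncomputable def orderByBin (S : ABS T) (hinj : Function.Injective S.bin) :
    ABS T where
  ord := LinearOrder.lift' S.bin hinj
  δ := S.δ
  π := S.π

theorem orderByBin_regular (S : ABS T) (hinj : Function.Injective S.bin) :
    (S.orderByBin hinj).Regular where
  lt_iff x y hxy := by
    change S.bin x < S.bin y ↔ S.bin (S.π x) < S.bin (S.π y)
    rw [bin_π_lt_iff]
    change S.δ x = S.δ y at hxy
    simp [hxy]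
  lt_of x y hx hy := by
    change S.bin (S.π x) < S.bin (S.π y)
    rw [bin_π_lt_iff]
    change S.δ x = 0 at hx
    change S.δ y = 1 at hy
    rw [hx, hy]
    exact Or.inl (by decide)

end Criterion

section Existence

variable {m₁ n₁ m₂ n₂ : ℕ}

/-- The minimal sequence with its bijection composed with the switch of two elements, with the
order unchanged. -/
noncomputable def preExchange (i : Fin (m₁ + n₁)) (j : Fin (m₂ + n₂)) : ABS (Elt m₁ n₁ m₂ n₂) where
  ord := (minimalABS m₁ n₁ m₂ n₂).ord
  δ := (minimalABS m₁ n₁ m₂ n₂).δ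
  π := swap (Sum.inl i) (Sum.inr j) * (minimalABS m₁ n₁ m₂ n₂).π

variable {i : Fin (m₁ + n₁)} {j : Fin (m₂ + n₂)}

theorem preExchange_π : (preExchange i j).π =
    swap (Sum.inl i) (Sum.inr j) * ((simple m₁ n₁).sum (simple m₂ n₂)).π := rfl

theorem exists_preExchange_π_pow_eq (hc₁ : Nat.Coprime m₁ n₁) (hc₂ : Nat.Coprime m₂ n₂)
    (x : Elt m₁ n₁ m₂ n₂) : ∃ k, ((preExchange i j).π ^ k) x = Sum.inl i := by
  have hinr : ∀ l, ∃ k, ((preExchange i j).π ^ k) (Sum.inr l) = Sum.inl i := fun l =>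
    exists_switched_π_pow_inr_eq preExchange_π (exists_simple_π_pow_eq hc₂ l j)
  rcases x with c | l
  · obtain ⟨q, hq⟩ :=
      exists_switched_π_pow_inl_eq (preExchange_π (j := j)) (exists_simple_π_pow_eq hc₁ c i)
    obtain ⟨k, hk⟩ := hinr j
    exact ⟨k + q, by rw [pow_add, Perm.mul_apply, hq, hk]⟩
  · exact hinr l

variable (h₁ : m₁ < n₁) (h₂ : n₂ < m₂) (hi : m₁ ≤ i.val) (hi' : i.val < n₁) (hj : j.val < n₂)

include hj in
theorem ne_and_le_of_preExchange_bin_eq {l : Fin (m₂ + n₂)} {c : Fin (m₁ + n₁)} (hl : n₂ ≤ l.val)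
    (hc : m₁ ≤ c.val)
    (e : (preExchange i j).bin (Sum.inr l) = (preExchange i j).bin (Sum.inl c)) :
    c ≠ i ∧ n₁ ≤ c.val := by
  obtain ⟨l, rfl⟩ := (simple m₂ n₂).π.surjective l
  have hlj : (simple m₂ n₂).π l ≠ j := fun e => by rw [e] at hl; omega
  have hl_val := simple_π_val l
  have hl_lt : l.val < m₂ := by split_ifs at hl_val <;> omega
  rw [← switched_π_inr (preExchange_π (i := i)) hlj] at e
  have hci : c ≠ i := by
    rintro rfl
    obtain ⟨k, rfl⟩ := (simple m₂ n₂).π.surjective j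
    rw [← switched_π_inr_eq preExchange_π rfl, bin_π_eq_iff] at e
    have hδ : l.val < m₂ ↔ k.val < m₂ := simple_δ_eq_iff.1 e.1
    rw [simple_π_val, if_pos (hδ.1 hl_lt)] at hj
    omega
  obtain ⟨c, rfl⟩ := (simple m₁ n₁).π.surjective c
  rw [← switched_π_inl preExchange_π hci, bin_π_eq_iff] at e
  have hδ : l.val < m₂ ↔ c.val < m₁ := simple_δ_eq_iff.1 e.1
  rw [simple_π_val, if_pos (hδ.1 hl_lt)]
  exact ⟨hci, by omega⟩

include h₁ h₂ hi hj in
theorem exists_preExchange_bin_eq_of_bin_eq {l : Fin (m₂ + n₂)} {c : Fin (m₁ + n₁)}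
    (hl : j.val + m₂ ≤ l.val) (hc : m₁ ≤ c.val)
    (e : (preExchange i j).bin (Sum.inr l) = (preExchange i j).bin (Sum.inl c)) :
    ∃ (l' : Fin (m₂ + n₂)) (c' : Fin (m₁ + n₁)), l.val < l'.val ∧ m₁ ≤ c'.val ∧
      (preExchange i j).bin (Sum.inr l') = (preExchange i j).bin (Sum.inl c') := by
  obtain ⟨hci, hcn⟩ := ne_and_le_of_preExchange_bin_eq hj (by omega) hc e
  obtain ⟨c₁, rfl⟩ := (simple m₁ n₁).π.surjective c
  obtain ⟨l₁, rfl⟩ := (simple m₂ n₂).π.surjective l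
  have hlj : (simple m₂ n₂).π l₁ ≠ j := fun e => by rw [e] at hl; omega
  rw [← switched_π_inl preExchange_π hci, ← switched_π_inr preExchange_π hlj, bin_π_eq_iff] at e
  have hc_val := simple_π_val c₁
  have hl_val := simple_π_val l₁
  have hc₁ : c₁.val < m₁ := by split_ifs at hc_val <;> omega
  have hl₁ : l₁.val < m₂ := by split_ifs at hl_val <;> omega
  rw [if_pos hl₁] at hl_val
  have hc₁i : c₁ ≠ i := by rintro rfl; omega
  have hl₁j : l₁ ≠ j := by rintro rfl; omega
  obtain ⟨c₂, rfl⟩ := (simple m₁ n₁).π.surjective c₁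
  obtain ⟨l₂, rfl⟩ := (simple m₂ n₂).π.surjective l₁
  rw [← switched_π_inl preExchange_π hc₁i, ← switched_π_inr preExchange_π hl₁j,
    bin_π_eq_iff (S := preExchange i j)] at e
  have hδ : l₂.val < m₂ ↔ c₂.val < m₁ := simple_δ_eq_iff.1 e.2.1
  have hc₂_val := simple_π_val c₂
  have hl₂_val := simple_π_val l₂
  have hc₂ : m₁ ≤ c₂.val := by split_ifs at hc₂_val <;> omega
  rw [if_neg (by omega)] at hl₂_val
  exact ⟨l₂, c₂, by omega, hc₂, e.2.2⟩

include h₁ h₂ hi hj in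
theorem preExchange_bin_inr_ne_inl {l : Fin (m₂ + n₂)} {c : Fin (m₁ + n₁)} (hl : j.val + m₂ ≤ l.val)
    (hc : m₁ ≤ c.val) : (preExchange i j).bin (Sum.inr l) ≠ (preExchange i j).bin (Sum.inl c) := by
  intro e
  induction hk : m₂ + n₂ - l using Nat.strong_induction_on generalizing c l with
  | _ k ih =>
    obtain ⟨l', c', hlt, hc', e'⟩ := exists_preExchange_bin_eq_of_bin_eq h₁ h₂ hi hj hl hc e
    exact ih _ (by omega) (by omega) hc' e' rfl

include h₁ h₂ hi hj in
theorem eq_of_preExchange_bin_inl_eq {y : Elt m₁ n₁ m₂ n₂}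
    (e : (preExchange i j).bin (Sum.inl i) = (preExchange i j).bin y) : Sum.inl i = y := by
  have hy := (δ_eq_of_bin_eq _ _ e).symm.trans (simple_δ_eq_zero_iff.2 hi)
  obtain ⟨k, hk⟩ := (simple m₂ n₂).π.surjective j
  have hk_val := simple_π_val k
  have hk_le : m₂ ≤ k.val := by rw [hk] at hk_val; split_ifs at hk_val <;> omega
  rw [hk, if_neg (by omega)] at hk_val
  rw [← switched_π_inr_eq preExchange_π hk] at e
  by_contra hne
  rcases y with c | l
  · obtain ⟨c, rfl⟩ := (simple m₁ n₁).π.surjective c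
    rw [← switched_π_inl preExchange_π (fun e' => hne (by rw [e'])), bin_π_eq_iff] at e
    have hδ : k.val < m₂ ↔ c.val < m₁ := simple_δ_eq_iff.1 e.1
    exact preExchange_bin_inr_ne_inl h₁ h₂ hi hj (by omega) (by omega) e.2
  · have hl : m₂ ≤ l.val := simple_δ_eq_zero_iff.1 hy
    obtain ⟨l, rfl⟩ := (simple m₂ n₂).π.surjective l
    have hlj : (simple m₂ n₂).π l ≠ j := fun e => by rw [e] at hl; omega
    rw [← switched_π_inr preExchange_π hlj, bin_π_eq_iff] at e
    have hδ : k.val < m₂ ↔ l.val < m₂ := simple_δ_eq_iff.1 e.1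
    rw [simple_π_val, if_neg (by omega)] at hl
    omega

include h₁ h₂ hi hj in
theorem preExchange_bin_injective (hc₁ : Nat.Coprime m₁ n₁) (hc₂ : Nat.Coprime m₂ n₂) :
    Function.Injective (preExchange i j).bin := by
  intro x y hxy
  obtain ⟨k, hk⟩ := exists_preExchange_π_pow_eq (i := i) (j := j) hc₁ hc₂ x
  have e := bin_pow_eq_of_bin_eq _ _ hxy k
  apply ((preExchange i j).π ^ k).injective
  rw [hk] at e ⊢
  exact eq_of_preExchange_bin_inl_eq h₁ h₂ hi hj e

include h₁ h₂ hi hi' hj in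
theorem exists_isGoodExchange (hc₁ : Nat.Coprime m₁ n₁) (hc₂ : Nat.Coprime m₂ n₂)
    (hup : ∀ k, i.val < k.val → k.val < n₁ →
      Resolves (simple m₁ n₁) (simple m₁ n₁).π i i k fun _ _ => True)
    (hdown : ∀ l, l.val < j.val →
      Resolves (simple m₂ n₂) (simple m₂ n₂).π j l j fun _ _ => True) :
    ∃ Ψ, IsGoodExchange (minimalABS m₁ n₁ m₂ n₂) (Sum.inl i) (Sum.inr j) Ψ := by
  have hinj := preExchange_bin_injective h₁ h₂ hi hj hc₁ hc₂
  have hex : IsExchange (minimalABS m₁ n₁ m₂ n₂) (Sum.inl i) (Sum.inr j)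
      ((preExchange i j).orderByBin hinj) :=
    isExchange_of_π_eq (simple_δ_eq_zero_iff.2 hi) (simple_δ_eq_one_iff.2 (by omega))
      ((minimal_lt_inl_inr h₁ h₂).2 (Or.inl hi')) rfl rfl (orderByBin_regular _ _)
  refine ⟨_, hex, hex.length_add_one_of_forall (minimal_regular m₁ n₁ m₂ n₂) hinj ?_ ?_⟩
  · rintro (k | l) ⟨htz, hzt'⟩ hz
    · rw [minimal_lt_inl_inl] at htz
      rw [minimal_lt_inl_inr h₁ h₂] at hzt'
      obtain ⟨r, hr, hc, -⟩ := hup k htz (by omega)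
      exact ⟨r, (resolvesAt_map_iff (S := simple m₁ n₁) (η := Sum.inl) (fun _ => rfl)
        (fun _ _ => minimal_lt_inl_inl)
        (fun _ => switched_π_pow_inl preExchange_π fun s h h' => (hc s h h').1)
        (fun _ => switched_π_pow_inl preExchange_π fun s h h' => (hc s h h').2)).2 hr⟩
    · rw [minimal_lt_inr_inr] at hzt'
      have hl : m₂ ≤ l.val := simple_δ_eq_zero_iff.1 hz
      omega
  · rintro (k | l) ⟨htz, hzt'⟩ hz
    · rw [minimal_lt_inl_inl] at htz
      have hk : k.val < m₁ := simple_δ_eq_one_iff.1 hz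
      omega
    · rw [minimal_lt_inr_inr] at hzt'
      obtain ⟨r, hr, hc, -⟩ := hdown l hzt'
      exact ⟨r, (resolvesAt_map_iff (S := simple m₂ n₂) (η := Sum.inr) (fun _ => rfl)
        (fun _ _ => minimal_lt_inr_inr)
        (fun _ => switched_π_pow_inr preExchange_π fun s h h' => (hc s h h').1)
        (fun _ => switched_π_pow_inr preExchange_π fun s h h' => (hc s h h').2)).2 hr⟩

end Existence

section Orbits

variable {T : Type*} {σ : Perm T} {p q x y z : T} {a b : ℕ}

theorem pow_apply_trans (hxy : (σ ^ a) x = y) (hyz : (σ ^ b) y = z) : (σ ^ (a + b)) x = z := by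
  rw [add_comm, pow_add, Perm.mul_apply, hxy, hyz]

theorem pow_sub_apply (hab : a ≤ b) (hxy : (σ ^ a) x = y) (hxz : (σ ^ b) x = z) :
    (σ ^ (b - a)) y = z := by
  rw [← hxy, ← hxz, ← Perm.mul_apply, ← pow_add, Nat.sub_add_cancel hab]

theorem pow_sub_apply_eq (hab : a ≤ b) (hxz : (σ ^ b) x = z) (hyz : (σ ^ a) y = z) :
    (σ ^ (b - a)) x = y := by
  refine (σ ^ a).injective ?_
  rw [← Perm.mul_apply, ← pow_add, Nat.add_sub_cancel' hab, hxz, hyz]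

theorem pow_apply_mem_iff {D : Set T} (h : ∀ x, σ x ∈ D ↔ x ∈ D) (s : ℕ) (x : T) :
    (σ ^ s) x ∈ D ↔ x ∈ D := by
  induction s with
  | zero => simp
  | succ s ih => rw [pow_succ', Perm.mul_apply, h, ih]

theorem apply_mem_iff_of_mapsTo [Finite T] {D : Set T} (h : ∀ x, x ∈ D → σ x ∈ D) (x : T) :
    σ x ∈ D ↔ x ∈ D := by
  refine ⟨fun hx => ?_, h x⟩
  simpa using Perm.perm_symm_mapsTo_of_mapsTo σ h hx

/-- The first `L` points `p, σ p, …, σᴸ⁻¹ p` of the orbit of `p`. When `σᴸ p = q`, composing `σ`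
with `swap p q` closes it up to a cycle. -/
def orbitSegment (σ : Perm T) (p : T) (L : ℕ) : Set T := {x | ∃ j < L, (σ ^ j) p = x}

variable {L : ℕ}

theorem self_mem_orbitSegment (hL : 0 < L) : p ∈ orbitSegment σ p L := ⟨0, hL, rfl⟩

theorem notMem_orbitSegment (hq : (σ ^ L) p = q) (hp : ∀ j, 0 < j → j ≤ L → (σ ^ j) p ≠ p) :
    q ∉ orbitSegment σ p L := by
  rintro ⟨j, hj, hjq⟩
  exact hp (L - j) (by omega) (by omega) (pow_sub_apply_eq hj.le hq hjq)

theorem swap_mul_apply_mem_orbitSegment_iff [Finite T] [DecidableEq T] (hq : (σ ^ L) p = q)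
    (hp : ∀ j, 0 < j → j ≤ L → (σ ^ j) p ≠ p) (x : T) :
    (swap p q * σ) x ∈ orbitSegment σ p L ↔ x ∈ orbitSegment σ p L := by
  refine apply_mem_iff_of_mapsTo ?_ x
  rintro _ ⟨j, hj, rfl⟩
  rw [Perm.mul_apply, ← Perm.mul_apply σ, ← pow_succ']
  rcases (show j + 1 ≤ L from hj).lt_or_eq with hlt | hL
  · have hne : (σ ^ (j + 1)) p ≠ q := fun e => notMem_orbitSegment hq hp ⟨j + 1, hlt, e⟩
    rw [swap_apply_of_ne_of_ne (hp _ (by omega) hj) hne]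
    exact ⟨j + 1, hlt, rfl⟩
  · rw [hL, hq, swap_apply_right]
    exact self_mem_orbitSegment (by omega)

theorem pow_apply_ne_of_notMem_orbitSegment (hL : 0 < L) (hq : (σ ^ L) p = q)
    (hx : x ∉ orbitSegment σ p L) {s : ℕ} (hs : 0 < s)
    (hp : ∀ u, 1 ≤ u → u < s → (σ ^ u) x ≠ p) : (σ ^ s) x ≠ q := by
  intro e
  rcases lt_or_ge L s with hLs | hLs
  · exact hp (s - L) (by omega) (by omega) (pow_sub_apply_eq hLs.le e hq)
  · exact hx ⟨L - s, by omega, pow_sub_apply_eq hLs hq e⟩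

theorem swap_mul_pow_apply [DecidableEq T] {s : ℕ}
    (h : ∀ u, 1 ≤ u → u ≤ s → (σ ^ u) x ≠ p ∧ (σ ^ u) x ≠ q) :
    ((swap p q * σ) ^ s) x = (σ ^ s) x := by
  induction s with
  | zero => simp
  | succ s ih =>
    obtain ⟨hp, hq⟩ := h (s + 1) (by omega) le_rfl
    rw [pow_succ', Perm.mul_apply, ih fun u hu hus => h u hu (by omega), Perm.mul_apply,
      ← Perm.mul_apply σ, ← pow_succ', swap_apply_of_ne_of_ne hp hq]

theorem swap_mul_pow_apply_of_eq [DecidableEq T] {s : ℕ} (hs : 0 < s) (hp : (σ ^ s) x = p)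
    (h : ∀ u, 1 ≤ u → u < s → (σ ^ u) x ≠ p ∧ (σ ^ u) x ≠ q) :
    ((swap p q * σ) ^ s) x = q := by
  obtain ⟨t, rfl⟩ : ∃ t, s = t + 1 := ⟨s - 1, by omega⟩
  rw [pow_succ', Perm.mul_apply, swap_mul_pow_apply fun u hu hut => h u hu (by omega),
    Perm.mul_apply, ← Perm.mul_apply σ, ← pow_succ', hp, swap_apply_left]

end Orbits

section SimpleOrbits

variable {m n : ℕ} {x y x' y' : Fin (m + n)} {s : ℕ}

theorem simple_π_pow_eq_iff :
    ((simple m n).π ^ s) x = y ↔ x.val + s * n ≡ y.val [MOD m + n] := by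
  rw [Fin.ext_iff, simple_π_pow_val, Nat.ModEq, Nat.mod_eq_of_lt y.isLt]

theorem simple_π_pow_translate (h : ((simple m n).π ^ s) x = y)
    (hadd : x.val + y'.val = x'.val + y.val) : ((simple m n).π ^ s) x' = y' := by
  rw [simple_π_pow_eq_iff] at h ⊢
  refine Nat.ModEq.add_left_cancel' x.val ?_
  calc x.val + (x'.val + s * n) = x'.val + (x.val + s * n) := by ring
    _ ≡ x'.val + y.val [MOD m + n] := h.add_left _
    _ = x.val + y'.val := hadd.symm

theorem simple_π_pow_card : (simple m n).π ^ (m + n) = 1 := by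
  ext x
  rw [simple_π_pow_val, Nat.add_mul_mod_self_left, Nat.mod_eq_of_lt x.isLt]
  rfl

theorem le_of_simple_π_pow_eq_self (hc : Nat.Coprime m n) (hs : 0 < s)
    (h : ((simple m n).π ^ s) x = x) : m + n ≤ s := by
  rw [simple_π_pow_eq_iff] at h
  have hdvd : m + n ∣ s * n := Nat.modEq_zero_iff_dvd.1 (h.add_left_cancel' x.val)
  exact Nat.le_of_dvd hs ((Nat.coprime_add_self_left.2 hc).dvd_of_dvd_mul_right hdvd)

theorem exists_simple_π_pow_eq_of_ne (hc : Nat.Coprime m n) (hxy : x ≠ y) :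
    ∃ s, 0 < s ∧ s < m + n ∧ ((simple m n).π ^ s) x = y := by
  obtain ⟨s, -, hs⟩ := exists_simple_π_pow_eq hc x y
  have hmod : ((simple m n).π ^ (s % (m + n))) x = y := by
    rw [← pow_eq_pow_mod s simple_π_pow_card, hs]
  refine ⟨s % (m + n), Nat.pos_of_ne_zero fun h0 => hxy ?_, Nat.mod_lt _ x.pos, hmod⟩
  rw [← hmod, h0]
  rfl

theorem simple_π_pow_val_add {d : ℕ} (hd : y.val = x.val + d)
    (h : ∀ u, u < s → (simple m n).δ (((simple m n).π ^ u) x) =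
      (simple m n).δ (((simple m n).π ^ u) y)) :
    (((simple m n).π ^ s) y).val = (((simple m n).π ^ s) x).val + d := by
  induction s with
  | zero => simpa using hd
  | succ s ih =>
    have ih := ih fun u hu => h u (by omega)
    have hδ := simple_δ_eq_iff.1 (h s (by omega))
    rw [pow_succ', Perm.mul_apply, Perm.mul_apply, simple_π_val, simple_π_val]
    split_ifs <;> omega

end SimpleOrbits

section SeparationTimes

/-- `rd k` is the time at which the pair `(i, k)` is resolved by the bijection of `simple m n`, for
every `k` with `i < k < N`; up to that time neither of the two orbits returns to `i`. -/
structure SeparationTimes (m n N : ℕ) (i : Fin (m + n)) (rd : Fin (m + n) → ℕ) : Prop where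
  coprime : Nat.Coprime m n
  le : m ≤ i.val
  resolvesAt : ∀ k, i.val < k.val → k.val < N →
    ResolvesAt (simple m n) (simple m n).π i k (rd k)
  pow_ne : ∀ k, i.val < k.val → k.val < N → ∀ s, 1 ≤ s → s ≤ rd k →
    ((simple m n).π ^ s) i ≠ i ∧ ((simple m n).π ^ s) k ≠ i

namespace SeparationTimes

variable {m n N : ℕ} {i k e : Fin (m + n)} {rd : Fin (m + n) → ℕ}
  (S : SeparationTimes m n N i rd)

include S

theorem one_le (hik : i.val < k.val) (hk : k.val < N) : 1 ≤ rd k := (S.resolvesAt k hik hk).1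

theorem δ_pow (hik : i.val < k.val) (hk : k.val < N) {s : ℕ} (hs : s < rd k) :
    (simple m n).δ (((simple m n).π ^ s) i) = (simple m n).δ (((simple m n).π ^ s) k) := by
  rcases Nat.eq_zero_or_pos s with rfl | hs0
  · have hi := S.le
    rw [simple_δ_eq_iff]
    simp only [pow_zero, Perm.coe_one, id_eq]
    omega
  · exact ((S.resolvesAt k hik hk).2.1 s hs0 hs).1

theorem pow_lt_iff (hik : i.val < k.val) (hk : k.val < N) {s : ℕ} (hs : s < rd k) :
    (((simple m n).π ^ s) i).val < m ↔ (((simple m n).π ^ s) k).val < m :=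
  simple_δ_eq_iff.1 (S.δ_pow hik hk hs)

theorem pow_val (hik : i.val < k.val) (hk : k.val < N) {s : ℕ} (hs : s ≤ rd k) :
    (((simple m n).π ^ s) k).val = (((simple m n).π ^ s) i).val + (k.val - i.val) :=
  simple_π_pow_val_add (by omega) fun _ hu => S.δ_pow hik hk (by omega)

theorem pow_rd_fst_lt (hik : i.val < k.val) (hk : k.val < N) :
    (((simple m n).π ^ rd k) i).val < m :=
  simple_δ_eq_one_iff.1 (S.resolvesAt k hik hk).2.2.1

theorem le_pow_rd_snd (hik : i.val < k.val) (hk : k.val < N) :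
    m ≤ (((simple m n).π ^ rd k) k).val :=
  simple_δ_eq_zero_iff.1 (S.resolvesAt k hik hk).2.2.2

theorem rd_add_lt (hik : i.val < k.val) (hk : k.val < N) {j : ℕ} (hj : j < m + n)
    (hjk : ((simple m n).π ^ j) i = k) : rd k + j < m + n := by
  by_contra! hlt
  refine (S.pow_ne k hik hk (m + n - j) (by omega) (by omega)).2 ?_
  exact pow_sub_apply hj.le hjk (by rw [simple_π_pow_card]; rfl)

variable (he : e.val = i.val + 1) (heN : e.val < N)

include he heN

theorem pow_rd_next : (((simple m n).π ^ rd e) i).val + 1 = m := by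
  have h0 := S.pow_rd_fst_lt (by omega) heN
  have h1 := S.le_pow_rd_snd (by omega) heN
  have h2 := S.pow_val (by omega) heN le_rfl
  omega

theorem rd_le_rd_next (hik : i.val < k.val) (hk : k.val < N) : rd k ≤ rd e := by
  by_contra! hlt
  have h0 := S.pow_rd_next he heN
  have h1 := S.pow_lt_iff hik hk hlt
  have h2 := S.pow_val hik hk hlt.le
  omega

variable {L : ℕ} (hLe : ((simple m n).π ^ L) i = e)

include hLe

/-- The time `L + z` at which the orbit of `i` reaches `k` leaves enough room before the orbit
closes up for the coincidences excluded by the next two lemmas. -/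
theorem exists_pow_next_eq (hek : e.val < k.val) (hk : k.val < N) (hr : rd k = rd e)
    (hD : ∀ j < L, ((simple m n).π ^ j) i ≠ k) :
    ∃ z, z + rd e + L < m + n ∧ rd e < z ∧ ((simple m n).π ^ z) e = k := by
  obtain ⟨j, -, hj, hjk⟩ := exists_simple_π_pow_eq_of_ne S.coprime
    (show i ≠ k from fun h => by omega)
  have hLj : L ≤ j := not_lt.1 fun hlt => hD j hlt hjk
  have hz : ((simple m n).π ^ (j - L)) e = k := pow_sub_apply hLj hLe hjk
  have hroom := S.rd_add_lt (by omega) hk hj hjk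
  refine ⟨j - L, by omega, ?_, hz⟩
  by_contra! hle
  have hz0 : 0 < j - L := Nat.pos_of_ne_zero fun h0 => by
    rw [h0] at hz
    exact hek.ne (congrArg Fin.val hz)
  have hmeet : ((simple m n).π ^ (rd e - (j - L))) k = ((simple m n).π ^ rd e) e :=
    pow_sub_apply hle hz rfl
  have h0 := S.pow_lt_iff (k := k) (s := rd e - (j - L)) (by omega) hk (by omega)
  have h1 := S.pow_val (k := k) (s := rd e - (j - L)) (by omega) hk (by omega)
  have h2 := S.pow_val (by omega) heN le_rfl
  have h3 := S.pow_rd_next he heN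
  rw [hmeet] at h0 h1
  omega

theorem exists_pow_eq_of_val_eq (hm : 0 < m) (hin : i.val = n) (hek : e.val < k.val)
    (hk : k.val < N) (hr : rd k = rd e) : ∃ j < L, ((simple m n).π ^ j) i = k := by
  by_contra! hD
  obtain ⟨z, hroom, hz, -⟩ := S.exists_pow_next_eq he heN hLe hek hk hr hD
  have hrd := S.one_le (by omega) heN
  have hp := S.pow_rd_next he heN
  have hn : 0 < n := by have := S.le; omega
  have hq : ((simple m n).π ^ L) (((simple m n).π ^ rd e) i) = ⟨0 + m, by omega⟩ :=
    simple_π_pow_translate hLe (by simp only; omega)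
  have hzero : ((simple m n).π ^ 1) ⟨0 + m, by omega⟩ = ⟨0, by omega⟩ := simple_π_mk_add hn
  have hi : ((simple m n).π ^ 1) ⟨0, by omega⟩ = i :=
    (simple_π_mk_of_lt hm).trans (Fin.ext (by simp [hin]))
  have hret := pow_apply_trans (pow_apply_trans (pow_apply_trans rfl hq) hzero) hi
  have := le_of_simple_π_pow_eq_self S.coprime (by omega) hret
  omega

theorem card_le_of_pow_eq_pred {w : Fin (m + n)} {a : ℕ} (hw : w.val + 1 = i.val)
    (ha : ((simple m n).π ^ a) (((simple m n).π ^ rd e) i) = w) : m + n ≤ rd e + a + L :=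
  le_of_simple_π_pow_eq_self S.coprime (by have := S.one_le (by omega) heN; omega)
    (pow_apply_trans (pow_apply_trans rfl ha) (simple_π_pow_translate hLe (by omega)))

theorem card_le_of_snd_pow_eq_pred {k₂ : Fin (m + n)} {s : ℕ} (hik₂ : i.val < k₂.val)
    (hk₂ : k₂.val + 1 < N) (hkN : N ≤ m + n) (hs : 1 ≤ s) (hsr : s ≤ rd k₂)
    (hks : (((simple m n).π ^ s) k₂).val + 1 = i.val) : m + n ≤ rd e + rd e + L := by
  obtain ⟨k₃, hk₃⟩ : ∃ k₃ : Fin (m + n), k₃.val = k₂.val + 1 := ⟨⟨k₂.val + 1, by omega⟩, rfl⟩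
  have hik₃ : i.val < k₃.val := by omega
  have hk₃N : k₃.val < N := by omega
  have hle := S.rd_le_rd_next he heN hik₂ (by omega)
  have hp := S.pow_rd_next he heN
  have hrs : rd k₃ < s := by
    by_contra! hsr₃
    refine (S.pow_ne k₃ hik₃ hk₃N s hs hsr₃).2 (Fin.ext ?_)
    have h₂ := S.pow_val hik₂ (by omega) hsr
    have h₃ := S.pow_val hik₃ hk₃N hsr₃
    omega
  have hmeet : ((simple m n).π ^ rd k₃) k₂ = ((simple m n).π ^ rd e) i := by
    have h₀ := S.pow_rd_fst_lt hik₃ hk₃N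
    have h₁ := S.le_pow_rd_snd hik₃ hk₃N
    have h₂ := S.pow_val hik₂ (by omega) (hrs.le.trans hsr)
    have h₃ := S.pow_val hik₃ hk₃N le_rfl
    have h₄ := S.pow_lt_iff hik₂ (by omega) (hrs.trans_le hsr)
    exact Fin.ext (by omega)
  have := S.card_le_of_pow_eq_pred he heN hLe hks (pow_sub_apply hrs.le hmeet rfl)
  omega

theorem pow_val_add_one_ne_or_exists_pow_eq (hm : 0 < m) (hmn : m < n) (hN : N = n ∨ N = m + n) :
    (∀ k, i.val < k.val → k.val < N → ∀ s, 1 ≤ s → s ≤ rd k →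
      (((simple m n).π ^ s) k).val + 1 ≠ i.val) ∨
      ∀ k, e.val < k.val → k.val < N → rd k = rd e → ∃ j < L, ((simple m n).π ^ j) i = k := by
  by_contra! hcon
  obtain ⟨⟨k₂, hik₂, hk₂, s, hs, hsr, hks⟩, k₁, hek₁, hk₁, hr, hD⟩ := hcon
  obtain ⟨z, hroom, hz, hzk⟩ := S.exists_pow_next_eq he heN hLe hek₁ hk₁ hr hD
  have hle := S.rd_le_rd_next he heN hik₂ hk₂
  have hp := S.pow_rd_next he heN
  rcases (show k₂.val + 1 ≤ N from hk₂).lt_or_eq with hlt | hlast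
  · have := S.card_le_of_snd_pow_eq_pred he heN hLe hik₂ hlt (by omega) hs hsr hks
    omega
  obtain ⟨top, htop⟩ : ∃ top : Fin (m + n), top.val + 1 = m + n :=
    ⟨⟨m + n - 1, by omega⟩, by simp only; omega⟩
  have hpt : ((simple m n).π ^ 1) (((simple m n).π ^ rd e) i) = top := by
    rw [pow_one]
    exact Fin.ext (by rw [simple_π_val, if_pos (by omega)]; omega)
  rcases hN with rfl | rfl
  · have htk : ((simple m N).π ^ 1) top = k₂ := by
      rw [pow_one]
      exact Fin.ext (by rw [simple_π_val, if_neg (by omega)]; omega)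
    have hle' := S.card_le_of_pow_eq_pred he heN hLe hks
      (pow_apply_trans (pow_apply_trans hpt htk) rfl)
    have hzt : ((simple m N).π ^ z) i = top := by
      rw [show z = rd e + 1 by omega]
      exact pow_apply_trans rfl hpt
    have htop_e : ((simple m N).π ^ z) i = ⟨k₁.val - 1, by omega⟩ :=
      simple_π_pow_translate hzk (by simp only; omega)
    have := congrArg Fin.val (hzt.symm.trans htop_e)
    simp only at this
    omega
  · have htk : top = k₂ := Fin.ext (by omega)
    have := S.card_le_of_pow_eq_pred he heN hLe hks (pow_apply_trans (hpt.trans htk) rfl)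
    omega

end SeparationTimes

end SeparationTimes

section ResolvesSwap

variable {T : Type*} [DecidableEq T] {S : ABS T} {σ : Perm T} {c p q x y : T} {R s : ℕ}

theorem resolves_swap_mul (hR : ResolvesAt S σ x y R)
    (hc : ∀ u, 1 ≤ u → u ≤ R → (σ ^ u) x ≠ c ∧ (σ ^ u) y ≠ c)
    (hx : ∀ u, 1 ≤ u → u ≤ R → (σ ^ u) x ≠ p ∧ (σ ^ u) x ≠ q)
    (hy : ∀ u, 1 ≤ u → u ≤ R → (σ ^ u) y ≠ p ∧ (σ ^ u) y ≠ q) :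
    Resolves S (swap p q * σ) c x y fun _ _ => True := by
  have ex : ∀ u, u ≤ R → ((swap p q * σ) ^ u) x = (σ ^ u) x := fun u hu =>
    swap_mul_pow_apply fun v hv hvu => hx v hv (hvu.trans hu)
  have ey : ∀ u, u ≤ R → ((swap p q * σ) ^ u) y = (σ ^ u) y := fun u hu =>
    swap_mul_pow_apply fun v hv hvu => hy v hv (hvu.trans hu)
  refine ⟨R, ?_, fun u hu huR => ?_, trivial⟩
  · exact (resolvesAt_map_iff (η := id) (fun _ => rfl) (fun _ _ => Iff.rfl) ex ey).2 hR
  · rw [ex u huR, ey u huR]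
    exact hc u hu huR

theorem resolves_swap_mul_of_pow_eq (hR : ResolvesAt S σ x y R)
    (hc : ∀ u, 1 ≤ u → u ≤ R → (σ ^ u) x ≠ c ∧ (σ ^ u) y ≠ c) (hs : 0 < s) (hsR : s < R)
    (hx : ∀ u, 1 ≤ u → u ≤ s → (σ ^ u) x ≠ p ∧ (σ ^ u) x ≠ q)
    (hy : ∀ u, 1 ≤ u → u < s → (σ ^ u) y ≠ p ∧ (σ ^ u) y ≠ q)
    (hyp : (σ ^ s) y = p) (hp : S.δ p = 1) (hq : S.δ q = 0) (hqc : q ≠ c) :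
    Resolves S (swap p q * σ) c x y fun _ _ => True := by
  have ex : ∀ u, u ≤ s → ((swap p q * σ) ^ u) x = (σ ^ u) x := fun u hu =>
    swap_mul_pow_apply fun v hv hvu => hx v hv (hvu.trans hu)
  have ey : ∀ u, u < s → ((swap p q * σ) ^ u) y = (σ ^ u) y := fun u hu =>
    swap_mul_pow_apply fun v hv hvu => hy v hv (hvu.trans_lt hu)
  have eys : ((swap p q * σ) ^ s) y = q := swap_mul_pow_apply_of_eq hs hyp hy
  refine ⟨s, ⟨hs, fun u hu hus => ?_, ?_, by rwa [eys]⟩, fun u hu hus => ?_, trivial⟩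
  · rw [ex u hus.le, ey u hus]
    exact hR.2.1 u hu (hus.trans hsR)
  · rw [ex s le_rfl, (hR.2.1 s hs hsR).1, hyp, hp]
  · rw [ex u hus]
    refine ⟨(hc u hu (hus.trans hsR.le)).1, ?_⟩
    rcases hus.lt_or_eq with hlt | rfl
    · rw [ey u hlt]
      exact (hc u hu (hus.trans hsR.le)).2
    · rwa [eys]

end ResolvesSwap

section ResolvingSwitch

variable {m n N : ℕ} {i : Fin (m + n)} {E : Fin (m + n) → Fin (m + n) → Prop}

theorem exists_separationTimes (hc : Nat.Coprime m n) (hi : m ≤ i.val)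
    (hup : ∀ k : Fin (m + n), i.val < k.val → k.val < N →
      Resolves (simple m n) (simple m n).π i i k E) :
    ∃ rd, SeparationTimes m n N i rd ∧ ∀ k : Fin (m + n), i.val < k.val → k.val < N →
      E (((simple m n).π ^ rd k) i) (((simple m n).π ^ rd k) k) := by
  choose! rd hrd using hup
  exact ⟨rd, ⟨hc, hi, fun k hik hk => (hrd k hik hk).1, fun k hik hk => (hrd k hik hk).2.1⟩,
    fun k hik hk => (hrd k hik hk).2.2⟩

theorem orbitSegment_simple (hc : Nat.Coprime m n) {L : ℕ} (hL0 : 0 < L) (hL : L < m + n)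
    {p q : Fin (m + n)} (hpq : ((simple m n).π ^ L) p = q) :
    p ∈ orbitSegment (simple m n).π p L ∧ q ∉ orbitSegment (simple m n).π p L ∧
      ∀ x, (swap p q * (simple m n).π) x ∈ orbitSegment (simple m n).π p L ↔
        x ∈ orbitSegment (simple m n).π p L := by
  have hp : ∀ j, 0 < j → j ≤ L → ((simple m n).π ^ j) p ≠ p := fun j hj hjL h => by
    have := le_of_simple_π_pow_eq_self hc hj h
    omega
  exact ⟨self_mem_orbitSegment hL0, notMem_orbitSegment hpq hp,
    swap_mul_apply_mem_orbitSegment_iff hpq hp⟩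

namespace SeparationTimes

variable {rd : Fin (m + n) → ℕ} {L : ℕ} {e p q k : Fin (m + n)} (S : SeparationTimes m n N i rd)
  (he : e.val = i.val + 1) (heN : e.val < N)

include S he heN

theorem resolves_swap_pred
    (hmeet : ∀ k : Fin (m + n), i.val < k.val → k.val < N → ∀ s, 1 ≤ s → s ≤ rd k →
      (((simple m n).π ^ s) k).val + 1 ≠ i.val)
    (hp : i.val = p.val + 1) (hik : i.val < k.val) (hk : k.val < N) :
    Resolves (simple m n) (swap p i * (simple m n).π) i i k fun _ _ => True := by
  have hle := S.rd_le_rd_next he heN hik hk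
  have hne := S.pow_ne k hik hk
  refine resolves_swap_mul (S.resolvesAt k hik hk) hne (fun u hu huR => ⟨fun h => ?_, ?_⟩)
    fun u hu huR => ⟨fun h => ?_, (hne u hu huR).2⟩
  · refine (S.pow_ne e (by omega) heN u hu (huR.trans hle)).2 ?_
    exact simple_π_pow_translate h (by omega)
  · exact (hne u hu huR).1
  · exact hmeet k hik hk u hu huR (by rw [h, hp])

theorem pow_rd_next_eq (hp : p.val + 1 = m) : ((simple m n).π ^ rd e) i = p :=
  Fin.ext (by have := S.pow_rd_next he heN; omega)

theorem pow_next_ne_boundary (hp : p.val + 1 = m) {u : ℕ} (hu : 1 ≤ u) (hur : u < rd e) :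
    ((simple m n).π ^ u) i ≠ p := fun h =>
  (S.pow_ne e (by omega) heN (rd e - u) (by omega) (by omega)).1
    (pow_sub_apply_eq hur.le (S.pow_rd_next_eq he heN hp) h)

variable (hL0 : 0 < L) (hL : L < m + n) (hLe : ((simple m n).π ^ L) i = e)

include hL hLe

theorem notMem_orbitSegment_boundary (hp : p.val + 1 = m) :
    i ∉ orbitSegment (simple m n).π p L := by
  rintro ⟨j, hj, hji⟩
  have hroom := S.rd_add_lt (by omega) heN hL hLe
  have hrd := S.one_le (by omega) heN
  have := le_of_simple_π_pow_eq_self S.coprime (by omega)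
    (pow_apply_trans (S.pow_rd_next_eq he heN hp) hji)
  omega

theorem rd_lt_rd_next
    (hmeet : ∀ k, e.val < k.val → k.val < N → rd k = rd e →
      ∃ j < L, ((simple m n).π ^ j) i = k)
    (hp : p.val + 1 = m) (hq : q.val = m) (hkD : k ∉ orbitSegment (simple m n).π p L)
    (hik : i.val < k.val) (hk : k.val < N)
    (hne : ∀ u, 1 ≤ u → u ≤ rd k →
      ((simple m n).π ^ u) k ≠ p ∧ ((simple m n).π ^ u) k ≠ q) : rd k < rd e := by
  refine (S.rd_le_rd_next he heN hik hk).lt_of_ne fun hr => hkD ?_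
  have hpq : ((simple m n).π ^ L) p = q := simple_π_pow_translate hLe (by omega)
  have hip := S.pow_rd_next_eq he heN hp
  have hek : e.val < k.val := by
    refine (show e.val ≤ k.val by omega).lt_of_ne fun h => ?_
    have hval := S.pow_val hik hk le_rfl
    rw [hr, hip] at hval
    refine (hne (rd k) (S.one_le hik hk) le_rfl).2 (Fin.ext ?_)
    rw [hr]
    omega
  obtain ⟨j, hj, hji⟩ := hmeet k hek hk hr
  have hmem : ((simple m n).π ^ rd k) k ∈ orbitSegment (simple m n).π p L := by
    refine ⟨j, hj, ?_⟩
    rw [hr, ← hip, ← hji, ← Perm.mul_apply, ← Perm.mul_apply, ← pow_add, ← pow_add, add_comm j]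
  have hinv := (orbitSegment_simple S.coprime (Nat.zero_lt_of_lt hj) hL hpq).2.2
  rwa [← swap_mul_pow_apply hne, pow_apply_mem_iff hinv] at hmem

include hL0

theorem pow_ne_boundary (hp : p.val + 1 = m) (hq : q.val = m) {u : ℕ} (hur : u ≤ rd e) :
    ((simple m n).π ^ u) i ≠ q := by
  intro h
  have hroom := S.rd_add_lt (by omega) heN hL hLe
  have hpq : ((simple m n).π ^ L) p = q := simple_π_pow_translate hLe (by omega)
  have := le_of_simple_π_pow_eq_self S.coprime (by omega)
    (pow_sub_apply_eq (hur.trans (Nat.le_add_right _ L))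
      (pow_apply_trans (S.pow_rd_next_eq he heN hp) hpq) h)
  omega

theorem resolves_swap_boundary
    (hmeet : ∀ k, e.val < k.val → k.val < N → rd k = rd e →
      ∃ j < L, ((simple m n).π ^ j) i = k)
    (him : i.val ≠ m) (hp : p.val + 1 = m) (hq : q.val = m)
    (hkD : k ∉ orbitSegment (simple m n).π p L) (hik : i.val < k.val) (hk : k.val < N) :
    Resolves (simple m n) (swap p q * (simple m n).π) i i k fun _ _ => True := by
  have hpq : ((simple m n).π ^ L) p = q := simple_π_pow_translate hLe (by omega)
  have hle := S.rd_le_rd_next he heN hik hk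
  have hR := S.resolvesAt k hik hk
  have hne := S.pow_ne k hik hk
  have hkq : ∀ s, (∀ u, 1 ≤ u → u < s → ((simple m n).π ^ u) k ≠ p) → ∀ u, 1 ≤ u → u ≤ s →
      ((simple m n).π ^ u) k ≠ q := fun s hs u hu hus =>
    pow_apply_ne_of_notMem_orbitSegment hL0 hpq hkD hu fun v hv hvu => hs v hv (by omega)
  have hi : ∀ u, 1 ≤ u → u < rd e → ((simple m n).π ^ u) i ≠ p ∧ ((simple m n).π ^ u) i ≠ q :=
    fun u hu hur => ⟨S.pow_next_ne_boundary he heN hp hu hur,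
      S.pow_ne_boundary he heN hL0 hL hLe hp hq hur.le⟩
  by_cases hhit : ∃ s, 0 < s ∧ s ≤ rd k ∧ ((simple m n).π ^ s) k = p
  · obtain ⟨s', hs', hsR', hsp'⟩ := hhit
    obtain ⟨s, hs, hsp, hfirst⟩ := exists_first_pow_apply_eq ⟨s', hs', hsp'⟩
    have hss' : s ≤ s' := not_lt.1 fun hlt => hfirst s' hs' hlt hsp'
    have hsR : s < rd k := by
      refine (hss'.trans hsR').lt_of_ne fun h => ?_
      have := S.le_pow_rd_snd hik hk
      rw [← h, hsp] at this
      omega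
    exact resolves_swap_mul_of_pow_eq hR hne hs hsR (fun u hu hus => hi u hu (by omega))
      (fun u hu hus => ⟨hfirst u hu hus, hkq s hfirst u hu hus.le⟩) hsp
      (simple_δ_eq_one_iff.2 (by omega)) (simple_δ_eq_zero_iff.2 hq.ge)
      fun h => him (h ▸ hq)
  · push Not at hhit
    have hk' : ∀ u, 1 ≤ u → u ≤ rd k → ((simple m n).π ^ u) k ≠ p ∧ ((simple m n).π ^ u) k ≠ q :=
      fun u hu huR => ⟨hhit u hu huR,
        hkq (rd k) (fun v hv hvR => hhit v hv hvR.le) u hu huR⟩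
    refine resolves_swap_mul hR hne (fun u hu huR => hi u hu (huR.trans_lt ?_)) hk'
    exact S.rd_lt_rd_next he heN hL hLe hmeet hp hq hkD hik hk hk'

end SeparationTimes

theorem resolves_swap_pred_or_boundary (hm : 0 < m) (hmn : m < n) (hc : Nat.Coprime m n)
    (hi : m ≤ i.val) (hiN : i.val < N)
    (hcase : (N = n ∧ m + 1 < n) ∨ (N = m + n ∧ n ≤ i.val ∧ 2 ≤ m))
    (hup : ∀ k : Fin (m + n), i.val < k.val → k.val < N →
      Resolves (simple m n) (simple m n).π i i k E)
    {i' p q : Fin (m + n)} (hi' : i.val = i'.val + 1) (hp : p.val + 1 = m) (hq : q.val = m)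
    {L : ℕ} (hL0 : 0 < L) (hL : L < m + n) (hpq : ((simple m n).π ^ L) p = q) :
    (m < i.val ∧ i.val ≠ n ∧ ∀ k : Fin (m + n), i.val < k.val → k.val < N →
      Resolves (simple m n) (swap i' i * (simple m n).π) i i k fun _ _ => True) ∨
    (i.val ≠ m ∧ E p q ∧ i ∉ orbitSegment (simple m n).π p L ∧
      ∀ k, k ∉ orbitSegment (simple m n).π p L → i.val < k.val → k.val < N →
        Resolves (simple m n) (swap p q * (simple m n).π) i i k fun _ _ => True) := by
  rcases Nat.lt_or_ge (i.val + 1) N with heN | hiN'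
  swap
  · exact Or.inl ⟨by omega, by omega, fun k hik hk => by omega⟩
  obtain ⟨e, he⟩ : ∃ e : Fin (m + n), e.val = i.val + 1 := ⟨⟨i.val + 1, by omega⟩, rfl⟩
  rw [← he] at heN
  obtain ⟨rd, S, hE⟩ := exists_separationTimes hc hi hup
  have hLe : ((simple m n).π ^ L) i = e := simple_π_pow_translate hpq (by omega)
  have hip := S.pow_rd_next_eq he heN hp
  have heq : ((simple m n).π ^ rd e) e = q :=
    Fin.ext (by have := S.pow_val (by omega) heN le_rfl; omega)
  have him : i.val ≠ m := fun him =>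
    (S.pow_ne e (by omega) heN (rd e) (S.one_le (by omega) heN) le_rfl).2
      (heq.trans (Fin.ext (by omega)))
  have boundary (hmeet : ∀ k, e.val < k.val → k.val < N → rd k = rd e →
      ∃ j < L, ((simple m n).π ^ j) i = k) : i.val ≠ m ∧ E p q ∧
      i ∉ orbitSegment (simple m n).π p L ∧
      ∀ k, k ∉ orbitSegment (simple m n).π p L → i.val < k.val → k.val < N →
        Resolves (simple m n) (swap p q * (simple m n).π) i i k fun _ _ => True :=
    ⟨him, by simpa only [hip, heq] using hE e (by omega) heN,
      S.notMem_orbitSegment_boundary he heN hL hLe hp, fun k hkD hik hk =>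
        S.resolves_swap_boundary he heN hL0 hL hLe hmeet him hp hq hkD hik hk⟩
  by_cases hin : i.val = n
  · exact Or.inr (boundary fun k => S.exists_pow_eq_of_val_eq he heN hLe hm hin)
  · rcases S.pow_val_add_one_ne_or_exists_pow_eq he heN hLe hm hmn (by omega) with hmeet | hmeet
    · exact Or.inl ⟨by omega, hin, fun k hik hk => S.resolves_swap_pred he heN hmeet hi' hik hk⟩
    · exact Or.inr (boundary hmeet)

theorem exists_resolving_switch (hm : 0 < m) (hmn : m < n) (hc : Nat.Coprime m n)
    (hi : m ≤ i.val) (hiN : i.val < N)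
    (hcase : (N = n ∧ m + 1 < n) ∨ (N = m + n ∧ n ≤ i.val ∧ 2 ≤ m))
    (hup : ∀ k : Fin (m + n), i.val < k.val → k.val < N →
      Resolves (simple m n) (simple m n).π i i k E) :
    ∃ (p q : Fin (m + n)) (D : Set (Fin (m + n))), q.val = p.val + 1 ∧
      ((q.val = m ∧ i ≠ q ∧ E p q) ∨ (q = i ∧ m ≤ p.val)) ∧ (p.val < n ↔ q.val < n) ∧
      p ∈ D ∧ q ∉ D ∧ i ∉ D ∧ (∀ x, (swap p q * (simple m n).π) x ∈ D ↔ x ∈ D) ∧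
      ∀ k, k ∉ D → i.val < k.val → k.val < N →
        Resolves (simple m n) (swap p q * (simple m n).π) i i k fun _ _ => True := by
  obtain ⟨p, hp⟩ : ∃ p : Fin (m + n), p.val + 1 = m := ⟨⟨m - 1, by omega⟩, by simp only; omega⟩
  obtain ⟨q, hq⟩ : ∃ q : Fin (m + n), q.val = m := ⟨⟨m, by omega⟩, rfl⟩
  obtain ⟨i', hi'⟩ : ∃ i' : Fin (m + n), i.val = i'.val + 1 :=
    ⟨⟨i.val - 1, by omega⟩, by simp only; omega⟩
  obtain ⟨L, hL0, hL, hpq⟩ :=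
    exists_simple_π_pow_eq_of_ne hc (show p ≠ q from fun h => by omega)
  rcases resolves_swap_pred_or_boundary hm hmn hc hi hiN hcase hup hi' hp hq hL0 hL hpq with
    ⟨him, hin, hres⟩ | ⟨him, hE, hiD, hres⟩
  · obtain ⟨hpD, hqD, hD⟩ := orbitSegment_simple hc hL0 hL
      (simple_π_pow_translate (x' := i') (y' := i) hpq (by omega))
    exact ⟨i', i, _, hi', Or.inr ⟨rfl, by omega⟩, by omega, hpD, hqD, hqD, hD, fun k _ => hres k⟩
  · obtain ⟨hpD, hqD, hD⟩ := orbitSegment_simple hc hL0 hL hpq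
    exact ⟨p, q, _, by omega, Or.inl ⟨hq, by rintro rfl; exact him hq, hE⟩, by omega, hpD, hqD,
      hiD, hD, hres⟩

end ResolvingSwitch

section Reversal

theorem Resolves.reverse {T T' : Type*} {S : ABS T} {S' : ABS T'} {σ : Perm T} {σ' : Perm T'}
    (e : T ≃ T') (hσ : ∀ x, σ' (e x) = e (σ x)) (hδ : ∀ x, S'.δ (e x) = 1 ↔ S.δ x = 0)
    (hlt : ∀ x y, S'.lt (e x) (e y) ↔ S.lt y x) {c x y : T} {E : T → T → Prop}
    (h : Resolves S σ c x y E) :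
    Resolves S' σ' (e c) (e y) (e x) fun a b => E (e.symm b) (e.symm a) := by
  have hpow (s : ℕ) (x : T) : (σ' ^ s) (e x) = e ((σ ^ s) x) := by
    rw [← Perm.iterate_eq_pow, ← Perm.iterate_eq_pow]
    exact (Function.Semiconj.iterate_right (fun x => (hσ x).symm) s x).symm
  obtain ⟨r, ⟨hr, hlt', hx, hy⟩, havoid, hE⟩ := h
  refine ⟨r, ⟨hr, fun s hs hsr => ?_, ?_, ?_⟩, fun s hs hsr => ?_, ?_⟩
  · rw [hpow, hpow, hlt]
    obtain ⟨hδxy, hltxy⟩ := hlt' s hs hsr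
    have hex := hδ ((σ ^ s) x)
    have hey := hδ ((σ ^ s) y)
    exact ⟨by omega, hltxy⟩
  · rwa [hpow, hδ]
  · rw [hpow]
    have hex := hδ ((σ ^ r) x)
    omega
  · simpa only [hpow, ne_eq, e.injective.eq_iff] using (havoid s hs hsr).symm
  · simpa only [hpow, e.symm_apply_apply] using hE

/-- The order reversal between the elements of `N_{m,n}` and of `N_{n,m}`. -/
def simpleRev (m n : ℕ) : Fin (m + n) ≃ Fin (n + m) where
  toFun x := ⟨m + n - 1 - x.val, by omega⟩
  invFun x := ⟨m + n - 1 - x.val, by omega⟩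
  left_inv x := Fin.ext (by simp only; omega)
  right_inv x := Fin.ext (by simp only; omega)

variable {m n : ℕ}

theorem simpleRev_val (x : Fin (m + n)) : (simpleRev m n x).val = m + n - 1 - x.val := rfl

theorem simpleRev_symm : (simpleRev m n).symm = simpleRev n m := by
  ext x
  change m + n - 1 - x.val = n + m - 1 - x.val
  omega

theorem π_simpleRev (x : Fin (m + n)) :
    (simple n m).π (simpleRev m n x) = simpleRev m n ((simple m n).π x) := by
  apply Fin.ext
  rw [simple_π_val, simpleRev_val, simpleRev_val, simple_π_val]
  split_ifs <;> omega

theorem δ_simpleRev (x : Fin (m + n)) :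
    (simple n m).δ (simpleRev m n x) = 1 ↔ (simple m n).δ x = 0 := by
  rw [simple_δ_eq_one_iff, simple_δ_eq_zero_iff, simpleRev_val]
  omega

theorem simpleRev_lt (x y : Fin (m + n)) :
    (simple n m).lt (simpleRev m n x) (simpleRev m n y) ↔ (simple m n).lt y x := by
  rw [simple_lt_iff, simple_lt_iff, simpleRev_val, simpleRev_val]
  omega

theorem swap_mul_π_simpleRev {p q : Fin (m + n)} (x : Fin (m + n)) :
    (swap (simpleRev m n q) (simpleRev m n p) * (simple n m).π) (simpleRev m n x) =
      simpleRev m n ((swap p q * (simple m n).π) x) := by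
  rw [Perm.mul_apply, Perm.mul_apply, π_simpleRev, swap_comm]
  exact (simpleRev m n).injective.swap_apply _ _ _

theorem exists_resolving_switch_down (hn : 2 ≤ n) (hmn : n < m) (hc : Nat.Coprime m n)
    {j : Fin (m + n)} (hj : j.val < n) {E : Fin (m + n) → Fin (m + n) → Prop}
    (hdown : ∀ l : Fin (m + n), l.val < j.val → Resolves (simple m n) (simple m n).π j l j E) :
    ∃ (p q : Fin (m + n)) (D : Set (Fin (m + n))), q.val = p.val + 1 ∧
      ((q.val = m ∧ j ≠ p ∧ E p q) ∨ (p = j ∧ q.val < m)) ∧ (p.val < n ↔ q.val < n) ∧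
      q ∈ D ∧ p ∉ D ∧ j ∉ D ∧ (∀ x, (swap p q * (simple m n).π) x ∈ D ↔ x ∈ D) ∧
      ∀ l, l ∉ D → l.val < j.val →
        Resolves (simple m n) (swap p q * (simple m n).π) j l j fun _ _ => True := by
  obtain ⟨q, p, D, hpq, hcase, hpn, hqD, hpD, hjD, hD, hres⟩ :=
    exists_resolving_switch (m := n) (n := m) (N := n + m) (i := simpleRev m n j)
      (E := fun a b => E ((simpleRev m n).symm b) ((simpleRev m n).symm a)) (by omega) hmn
      hc.symm (by rw [simpleRev_val]; omega) (by omega)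
      (Or.inr ⟨rfl, by rw [simpleRev_val]; omega, hn⟩) fun k hk _ => by
        obtain ⟨l, rfl⟩ := (simpleRev m n).surjective k
        rw [simpleRev_val, simpleRev_val] at hk
        exact (hdown l (by omega)).reverse _ π_simpleRev δ_simpleRev simpleRev_lt
  obtain ⟨p, rfl⟩ := (simpleRev m n).surjective p
  obtain ⟨q, rfl⟩ := (simpleRev m n).surjective q
  rw [simpleRev_val, simpleRev_val] at hpq
  refine ⟨p, q, simpleRev m n ⁻¹' D, by omega, ?_, ?_, hqD, hpD, hjD, fun x => ?_,
    fun l hl hlj => ?_⟩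
  · simp only [simpleRev_val, symm_apply_apply, ne_eq, (simpleRev m n).injective.eq_iff] at hcase
    rcases hcase with ⟨hpm, hjp, hE⟩ | ⟨hpj, hqm⟩
    · exact Or.inl ⟨by omega, hjp, hE⟩
    · exact Or.inr ⟨hpj, by omega⟩
  · rw [simpleRev_val, simpleRev_val] at hpn
    omega
  · rw [Set.mem_preimage, Set.mem_preimage, ← hD (simpleRev m n x), swap_mul_π_simpleRev]
  · have hrev := hres (simpleRev m n l) hl (by rw [simpleRev_val, simpleRev_val]; omega) (by omega)
    simpa only [symm_apply_apply] using hrev.reverse (S' := simple m n) (simpleRev m n).symm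
      (σ' := swap p q * (simple m n).π) (fun x => by
        obtain ⟨x, rfl⟩ := (simpleRev m n).surjective x
        rw [swap_mul_π_simpleRev, symm_apply_apply, symm_apply_apply])
      (by rw [simpleRev_symm]; exact δ_simpleRev) (by rw [simpleRev_symm]; exact simpleRev_lt)

end Reversal

section Rank

theorem Regular.map_π {T T' : Type*} [Finite T'] {S : ABS T} {S' : ABS T'} (hS : S.Regular)
    (hS' : S'.Regular) (e : T ≃ T') (hlt : ∀ x y, S'.lt (e x) (e y) ↔ S.lt x y)
    (hδ : ∀ x, S'.δ (e x) = S.δ x) (x : T) : S'.π (e x) = e (S.π x) := by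
  let _ := S'.ord
  -- A strictly increasing self-map of a finite linear order is the identity.
  have hmono : StrictMono fun t => e (S.π (e.symm (S'.π.symm t))) := by
    intro a b hab
    obtain ⟨a, rfl⟩ := (e.trans S'.π).surjective a
    obtain ⟨b, rfl⟩ := (e.trans S'.π).surjective b
    simp only [coe_trans, Function.comp_apply, symm_apply_apply] at hab ⊢
    refine (hlt _ _).2 ?_
    by_cases hab' : S.δ a = S.δ b
    · rw [← hS.lt_iff a b hab', ← hlt, hS'.lt_iff _ _ (by rw [hδ, hδ, hab'])]
      exact hab
    · rcases S.δ_eq_zero_or_one a with ha | ha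
      · exact hS.lt_of a b ha (by omega)
      · exact absurd (hS'.lt_of (e b) (e a) (by rw [hδ]; omega) (by rw [hδ, ha]))
          (S'.lt_asymm hab)
  simpa only [symm_apply_apply, id] using (congrFun hmono.eq_id (S'.π (e x))).symm

theorem eq_of_isLowerSet_of_ncard_eq {α : Type*} [LinearOrder α] [Finite α] {s t : Set α}
    (hs : IsLowerSet s) (ht : IsLowerSet t) (h : s.ncard = t.ncard) : s = t :=
  (hs.total ht).elim (fun hst => Set.eq_of_subset_of_ncard_le hst h.ge)
    fun hts => (Set.eq_of_subset_of_ncard_le hts h.le).symm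

theorem Regular.exists_iso_simple {T : Type*} [Finite T] {S : ABS T} (hS : S.Regular)
    (h : ∀ x y, S.δ x = 1 → S.δ y = 0 → S.lt x y) :
    Nonempty (S.Iso (simple (S.count 1) (S.count 0))) := by
  let _ := S.ord
  let _ := Fintype.ofFinite T
  have hcard : Fintype.card T = S.count 1 + S.count 0 := by
    rw [← Nat.card_eq_fintype_card, ← S.count_zero_add_count_one, add_comm]
  let φ : T ≃o Fin (S.count 1 + S.count 0) := (Fintype.orderIsoFinOfCardEq T hcard).symm
  have hlower : IsLowerSet {x | S.δ x = 1} := fun x y hyx hx => by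
    by_contra hy
    exact (h x y hx ((S.δ_eq_zero_or_one y).resolve_right hy)).not_ge hyx
  have himage : φ.symm ⁻¹' {x | S.δ x = 1} = {t | t.val < S.count 1} := by
    refine eq_of_isLowerSet_of_ncard_eq (hlower.preimage φ.symm.monotone)
      (fun _ _ hts (ht : _ < _) => lt_of_le_of_lt (Fin.le_def.1 hts) ht) ?_
    rw [ncard_lt_eq (Nat.le_add_right _ _), ← φ.image_eq_preimage_symm,
      Set.ncard_image_of_injective _ φ.injective, count]
  have hδ : ∀ x, (simple (S.count 1) (S.count 0)).δ (φ x) = S.δ x := fun x => by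
    have hx : S.δ (φ.symm (φ x)) = 1 ↔ (φ x).val < S.count 1 := Set.ext_iff.1 himage (φ x)
    rw [φ.symm_apply_apply, ← simple_δ_eq_one_iff] at hx
    omega
  have hlt (x y : T) : (simple (S.count 1) (S.count 0)).lt (φ x) (φ y) ↔ S.lt x y := φ.lt_iff_lt
  exact ⟨φ.toEquiv, hlt, hδ, hS.map_π (simple_regular _ _) φ.toEquiv hlt hδ⟩

/-- The restriction of the order and of `δ` to a set which is invariant under the permutation
`σ`. -/
def restrict {T : Type*} (S : ABS T) (σ : Perm T) (C : Set T) (hC : ∀ x, σ x ∈ C ↔ x ∈ C) :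
    ABS C where
  ord := letI := S.ord; inferInstance
  δ x := S.δ x
  π := σ.subtypePerm hC

variable {T : Type*} {S : ABS T} {σ : Perm T} {C : Set T} {hC : ∀ x, σ x ∈ C ↔ x ∈ C}

theorem restrict_lt {x y : C} : (S.restrict σ C hC).lt x y ↔ S.lt x y := Iff.rfl

theorem restrict_δ {x : C} : (S.restrict σ C hC).δ x = S.δ x := rfl

theorem restrict_π {x : C} : ((S.restrict σ C hC).π x : T) = σ x := rfl

theorem count_restrict_add [Finite T] (hC' : ∀ x, σ x ∈ Cᶜ ↔ x ∈ Cᶜ) (v : Fin 2) :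
    (S.restrict σ C hC).count v + (S.restrict σ Cᶜ hC').count v = S.count v := by
  have h1 : ∀ (D : Set T) (hD : ∀ x, σ x ∈ D ↔ x ∈ D), (S.restrict σ D hD).count v =
      {x | x ∈ D ∧ S.δ x = v}.ncard := by
    intro D hD
    rw [count, ← Set.ncard_image_of_injective _ Subtype.val_injective]
    congr 1
    ext x
    simp [restrict_δ, and_comm]
  rw [h1, h1, eq_comm]
  refine ncard_add_of_iff (fun x => ?_) fun x h2 h3 => h3.1 h2.1
  by_cases hx : x ∈ C <;> simp [hx]

end Rank

section SwitchedOrbit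

variable {m n : ℕ} {p q : Fin (m + n)} {C : Set (Fin (m + n))}
  {hC : ∀ x, (swap p q * (simple m n).π) x ∈ C ↔ x ∈ C}

theorem restrict_swap_regular (hpq : q.val = p.val + 1) (hex : p ∉ C ∨ q ∉ C) :
    ((simple m n).restrict _ C hC).Regular := by
  have hlt : ∀ x y : C, (simple m n).lt ((swap p q * (simple m n).π) x)
      ((swap p q * (simple m n).π) y) ↔ (simple m n).lt ((simple m n).π x) ((simple m n).π y) := by
    intro x y
    have hx := (hC x).2 x.2
    have hy := (hC y).2 y.2
    simp only [Perm.mul_apply] at hx hy ⊢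
    generalize (simple m n).π x = a at *
    generalize (simple m n).π y = b at *
    rw [simple_lt_iff, simple_lt_iff]
    simp only [swap_apply_def] at *
    split_ifs at hx hy ⊢ <;> simp_all <;> grind
  constructor
  · intro x y hxy
    rw [restrict_lt, restrict_lt, restrict_π, restrict_π, hlt]
    exact (simple_regular m n).lt_iff _ _ hxy
  · intro x y hx hy
    rw [restrict_lt, restrict_π, restrict_π, hlt]
    exact (simple_regular m n).lt_of _ _ hx hy

theorem exists_restrict_iso (hpq : q.val = p.val + 1) (hex : p ∉ C ∨ q ∉ C) {f g : ℕ}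
    (hf : ((simple m n).restrict _ C hC).count 1 = f)
    (hg : ((simple m n).restrict _ C hC).count 0 = g) :
    Nonempty (((simple m n).restrict _ C hC).Iso (simple f g)) := by
  subst hf hg
  refine (restrict_swap_regular hpq hex).exists_iso_simple fun x y hx hy => ?_
  rw [restrict_δ, simple_δ_eq_one_iff] at hx
  rw [restrict_δ, simple_δ_eq_zero_iff] at hy
  rw [restrict_lt, simple_lt_iff]
  omega

theorem sum_switch (C : Set (Fin (m + n))) [Fintype C]
    (hC : ∀ x, (swap p q * (simple m n).π) x ∈ C ↔ x ∈ C) :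
    ∑ x : C, ((((simple m n).π x : Fin (m + n)) : ℕ) - (x.1 : ℕ) : ℤ) =
      n * ((simple m n).restrict _ C hC).count 1 - m * ((simple m n).restrict _ C hC).count 0 := by
  classical
  have h1 : ∀ v, (((simple m n).restrict _ C hC).count v : ℤ) =
      ∑ x : C, if (simple m n).δ x = v then 1 else 0 := by
    intro v
    rw [count, Set.ncard_eq_toFinset_card', Set.toFinset_ofPred, Finset.card_filter]
    push_cast
    rfl
  rw [h1, h1, Finset.mul_sum, Finset.mul_sum, ← Finset.sum_sub_distrib]
  refine Finset.sum_congr rfl fun x _ => ?_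
  simp only [simple_π_val, simple_δ_eq_one_iff, simple_δ_eq_zero_iff]
  split_ifs <;> omega

theorem sum_switch_eq (C : Set (Fin (m + n))) [Fintype C]
    (hC : ∀ x, (swap p q * (simple m n).π) x ∈ C ↔ x ∈ C) :
    ∑ x : C, ((((simple m n).π x : Fin (m + n)) : ℕ) - (x.1 : ℕ) : ℤ) =
      ∑ x : C, (((swap p q x : Fin (m + n)) : ℕ) - (x.1 : ℕ) : ℤ) := by
  rw [Finset.sum_sub_distrib, Finset.sum_sub_distrib]
  congr 1
  refine Fintype.sum_equiv ((swap p q * (simple m n).π).subtypePerm hC) _ _ fun x => ?_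
  simp [Perm.subtypePerm_apply]

theorem count_switch_of_left (hpq : q.val = p.val + 1) (hp : p ∈ C) (hq : q ∉ C) :
    ((simple m n).restrict _ C hC).count 1 * n =
      ((simple m n).restrict _ C hC).count 0 * m + 1 := by
  classical
  have hsum := (sum_switch C hC).symm.trans (sum_switch_eq C hC)
  rw [Fintype.sum_eq_single ⟨p, hp⟩] at hsum
  · simp only [swap_apply_left, hpq] at hsum
    push_cast at hsum
    zify
    linarith
  · intro x hx
    rw [swap_apply_of_ne_of_ne, sub_self]
    · exact fun e => hx (Subtype.ext e)
    · exact fun e => hq (e ▸ x.2)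

theorem count_switch_of_right (hpq : q.val = p.val + 1) (hp : p ∉ C) (hq : q ∈ C) :
    ((simple m n).restrict _ C hC).count 0 * m =
      ((simple m n).restrict _ C hC).count 1 * n + 1 := by
  classical
  have hsum := (sum_switch C hC).symm.trans (sum_switch_eq C hC)
  rw [Fintype.sum_eq_single ⟨q, hq⟩] at hsum
  · simp only [swap_apply_right, hpq] at hsum
    push_cast at hsum
    zify
    linarith
  · intro x hx
    rw [swap_apply_of_ne_of_ne, sub_self]
    · exact fun e => hp (e ▸ x.2)
    · exact fun e => hx (Subtype.ext e)

theorem bezout_unique {m n f g f' g' : ℕ} (hc : Nat.Coprime m n) (hf : f ≤ m) (hf' : f' ≤ m)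
    (h : f * n = g * m + 1) (h' : f' * n = g' * m + 1) : f = f' ∧ g = g' := by
  have hf0 : 0 < f := Nat.pos_of_ne_zero fun e => by rw [e] at h; omega
  have hf0' : 0 < f' := Nat.pos_of_ne_zero fun e => by rw [e] at h'; omega
  have hmod : f ≡ f' [MOD m] :=
    Nat.ModEq.cancel_right_of_coprime hc (by rw [h, h']; simp [Nat.ModEq])
  obtain rfl : f = f' := hmod.eq_of_abs_lt (abs_sub_lt_iff.2 ⟨by omega, by omega⟩)
  exact ⟨rfl, Nat.eq_of_mul_eq_mul_right (by omega : 0 < m) (by omega)⟩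

theorem exists_bezout {m n : ℕ} (hc : Nat.Coprime m n) (hm : 0 < m) (hn : 0 < n) :
    ∃ f g, f ≤ m ∧ g ≤ n ∧ f * n = g * m + 1 := by
  obtain ⟨f, -, hf⟩ := exists_pos_mul_modEq (n := n) (h := m) hm hc.symm 1
  have hmod : f % m * n ≡ 1 [MOD m] := ((Nat.mod_modEq f m).mul_right n).trans hf
  have hlt : f % m < m := Nat.mod_lt _ hm
  generalize f % m = f at hmod hlt
  rcases Nat.eq_zero_or_pos f with rfl | hf0
  · rw [zero_mul] at hmod
    obtain rfl : m = 1 := Nat.dvd_one.1 ((Nat.modEq_iff_dvd' zero_le_one).1 hmod)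
    exact ⟨1, n - 1, le_rfl, by omega, by omega⟩
  · have hfn : 1 ≤ f * n := Nat.mul_pos hf0 hn
    obtain ⟨g, hg⟩ := (Nat.modEq_iff_dvd' hfn).1 hmod.symm
    refine ⟨f, g, hlt.le, le_of_not_gt fun hgn => ?_, by rw [mul_comm g]; omega⟩
    have hmng : m * n < m * g := Nat.mul_lt_mul_of_pos_left hgn hm
    have hfmn : f * n ≤ m * n := Nat.mul_le_mul_right _ hlt.le
    omega

end SwitchedOrbit

section DieudonneModules

variable (p : ℕ) [Fact p.Prime] (K : Type*) [Field K] [CharP K p] [PerfectRing K p]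
  {T T' α β : Type*} [Finite T] [Finite T'] [Finite α] [Finite β]

/-- The isomorphism of `DM₁`'s induced by an isomorphism of arrowed binary sequences: it permutes
the standard bases. -/
def Iso.dm1 {S : ABS T} {S' : ABS T'} (e : S.Iso S') : (S.dm1 p K).Iso (S'.dm1 p K) where
  toEquiv := LinearEquiv.funCongrLeft K K e.toEquiv.symm
  map_F x := by
    refine funext fun t => ?_
    obtain ⟨t, rfl⟩ := (S.π.trans e.toEquiv).surjective t
    have hπ : S'.π.symm (e.toEquiv (S.π t)) = e.toEquiv t := by
      rw [symm_apply_eq, e.map_π]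
    simp [ABS.dm1, hπ, e.map_δ]
  map_V x := by
    refine funext fun t => ?_
    obtain ⟨t, rfl⟩ := e.toEquiv.surjective t
    simp [ABS.dm1, e.map_π, e.map_δ]

/-- The `DM₁` of a direct sum of arrowed binary sequences is the direct sum of their `DM₁`'s. -/
def sumDM1Iso (A : ABS α) (B : ABS β) :
    ((A.sum B).dm1 p K).Iso ((A.dm1 p K).prod (B.dm1 p K)) where
  toEquiv := LinearEquiv.sumArrowLequivProdArrow α β K K
  map_F _ := rfl
  map_V _ := rfl

theorem Iso.nonempty_dm1_iso_prod {S : ABS T} {A : ABS α} {B : ABS β} (e : S.Iso (A.sum B)) :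
    Nonempty ((S.dm1 p K).Iso ((A.dm1 p K).prod (B.dm1 p K))) :=
  ⟨{  toEquiv := (e.dm1 p K).toEquiv.trans (sumDM1Iso p K A B).toEquiv
      map_F := fun x => by
        rw [LinearEquiv.trans_apply, (sumDM1Iso p K A B).map_F, (e.dm1 p K).map_F]
        rfl
      map_V := fun x => by
        rw [LinearEquiv.trans_apply, (sumDM1Iso p K A B).map_V, (e.dm1 p K).map_V]
        rfl }⟩

end DieudonneModules

section Splitting

theorem swap_inl_mul_sum_π {α β : Type*} [DecidableEq α] [DecidableEq β] (A : ABS α) (B : ABS β)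
    (x y : α) : swap (Sum.inl x) (Sum.inl y) * (A.sum B).π =
      Perm.sumCongr (swap x y * A.π) B.π := by
  change _ * Perm.sumCongr A.π B.π = _
  rw [← Perm.sumCongr_swap_one, Perm.sumCongr_mul, one_mul]

theorem swap_inr_mul_sum_π {α β : Type*} [DecidableEq α] [DecidableEq β] (A : ABS α) (B : ABS β)
    (x y : β) : swap (Sum.inr x) (Sum.inr y) * (A.sum B).π =
      Perm.sumCongr A.π (swap x y * B.π) := by
  change _ * Perm.sumCongr A.π B.π = _
  rw [← Perm.sumCongr_one_swap, Perm.sumCongr_mul, one_mul]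

theorem IsExchange.sum_π {α β : Type*} [DecidableEq α] [DecidableEq β] {A A' : ABS α} {x y : α}
    (h : A.IsExchange x y A') (B : ABS β) :
    (A'.sum B).π = swap (Sum.inl x) (Sum.inl y) * (A.sum B).π := by
  rw [swap_inl_mul_sum_π, ← h.π_eq]
  rfl

/-- A splitting of the map `δ` of `S`, together with a bijection `σ` of its elements in place of
`π`, as the disjoint union of those of `A` and `B`. The orders play no role, since `σ` does not
come with an order. -/
structure Splitting {T α β : Type*} (S : ABS T) (σ : Perm T) (A : ABS α) (B : ABS β) where
  toEquiv : T ≃ α ⊕ β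
  map_δ x : (A.sum B).δ (toEquiv x) = S.δ x
  map_π x : (A.sum B).π (toEquiv x) = toEquiv (σ x)

namespace Splitting

variable {T α β γ : Type*} {S : ABS T} {σ : Perm T} {A : ABS α} {B : ABS β}

theorem δ_symm_inl (e : Splitting S σ A B) (x : α) :
    S.δ (e.toEquiv.symm (Sum.inl x)) = A.δ x := by
  rw [← e.map_δ, apply_symm_apply, sum_δ_inl]

theorem apply_symm_inl (e : Splitting S σ A B) (x : α) :
    σ (e.toEquiv.symm (Sum.inl x)) = e.toEquiv.symm (Sum.inl (A.π x)) := by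
  rw [eq_symm_apply, ← e.map_π, apply_symm_apply, sum_π_inl]

theorem resolves (e : Splitting S σ A B)
    (hlt : ∀ x y, A.lt x y ↔ S.lt (e.toEquiv.symm (Sum.inl x)) (e.toEquiv.symm (Sum.inl y)))
    {c x y : α} {E : T → T → Prop}
    (h : Resolves S σ (e.toEquiv.symm (Sum.inl c)) (e.toEquiv.symm (Sum.inl x))
      (e.toEquiv.symm (Sum.inl y)) E) :
    Resolves A A.π c x y fun a b =>
      E (e.toEquiv.symm (Sum.inl a)) (e.toEquiv.symm (Sum.inl b)) := by
  have hpow (s : ℕ) (x : α) :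
      (σ ^ s) (e.toEquiv.symm (Sum.inl x)) = e.toEquiv.symm (Sum.inl ((A.π ^ s) x)) := by
    rw [← Perm.iterate_eq_pow, ← Perm.iterate_eq_pow]
    exact (Function.Semiconj.iterate_right (f := fun x => e.toEquiv.symm (Sum.inl x))
      (fun x => (e.apply_symm_inl x).symm) s x).symm
  obtain ⟨r, hr, havoid, hE⟩ := h
  rw [hpow, hpow] at hE
  refine ⟨r, (resolvesAt_map_iff (S := A) (η := fun x => e.toEquiv.symm (Sum.inl x))
    e.δ_symm_inl (fun x y => (hlt x y).symm) (fun s _ => hpow s x) fun s _ => hpow s y).1 hr,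
    fun s hs hsr => ?_, hE⟩
  obtain ⟨hx, hy⟩ := havoid s hs hsr
  rw [hpow] at hx hy
  exact ⟨fun hc => hx (by rw [hc]), fun hc => hy (by rw [hc])⟩

/-- The rearrangement `(α ⊔ β) ⊔ γ ≃ (α ⊔ γ) ⊔ β` applied to a splitting of the first summand of
`S ⊕ C`. -/
def sumRight (e : Splitting S σ A B) (C : ABS γ) :
    Splitting (S.sum C) (Perm.sumCongr σ C.π) (A.sum C) B where
  toEquiv := (sumCongr e.toEquiv (Equiv.refl γ)).trans ((sumAssoc α β γ).trans
    ((sumCongr (Equiv.refl α) (sumComm β γ)).trans (sumAssoc α γ β).symm))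
  map_δ := by
    rintro (x | x)
    · rw [sum_δ_inl, ← e.map_δ, trans_apply, sumCongr_apply, Sum.map_inl]
      rcases e.toEquiv x with y | y <;> rfl
    · rfl
  map_π := by
    rintro (x | x)
    · simp only [Perm.sumCongr_apply, Sum.map_inl, trans_apply, sumCongr_apply, ← e.map_π]
      rcases e.toEquiv x with y | y <;> rfl
    · rfl

/-- The rearrangement `γ ⊔ (α ⊔ β) ≃ (γ ⊔ α) ⊔ β` applied to a splitting of the second summand of
`C ⊕ S`. -/
def sumLeft (e : Splitting S σ A B) (C : ABS γ) :
    Splitting (C.sum S) (Perm.sumCongr C.π σ) (C.sum A) B where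
  toEquiv := (sumCongr (Equiv.refl γ) e.toEquiv).trans (sumAssoc γ α β).symm
  map_δ := by
    rintro (x | x)
    · rfl
    · rw [sum_δ_inr, ← e.map_δ, trans_apply, sumCongr_apply, Sum.map_inr]
      rcases e.toEquiv x with y | y <;> rfl
  map_π := by
    rintro (x | x)
    · rfl
    · simp only [Perm.sumCongr_apply, Sum.map_inr, trans_apply, sumCongr_apply, ← e.map_π]
      rcases e.toEquiv x with y | y <;> rfl

/-- The splitting of the conjugate `w⁻¹ * σ * w` obtained by relabelling with `w`. -/
def conj (e : Splitting S σ A B) (w : Perm T) (hw : ∀ x, S.δ (w x) = S.δ x) :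
    Splitting S (w⁻¹ * σ * w) A B where
  toEquiv := w.trans e.toEquiv
  map_δ x := by rw [trans_apply, e.map_δ, hw]
  map_π x := by
    simp [e.map_π]

/-- If `σ` preserves `D`, the isomorphism types of `σ` on `D` and on its complement give a
splitting. -/
noncomputable def ofRestrict {D : Set T} {hD : ∀ x, σ x ∈ D ↔ x ∈ D}
    {hD' : ∀ x, σ x ∈ Dᶜ ↔ x ∈ Dᶜ} (φ : (S.restrict σ Dᶜ hD').Iso A)
    (ψ : (S.restrict σ D hD).Iso B) : Splitting S σ A B :=
  haveI := Classical.decPred (· ∈ D)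
  let ε : T ≃ α ⊕ β := (Equiv.Set.sumCompl D).symm.trans
    ((sumCongr ψ.toEquiv φ.toEquiv).trans (sumComm β α))
  have hin (x : D) : ε x = Sum.inr (ψ.toEquiv x) := by simp [ε]
  have hout (x : (Dᶜ : Set T)) : ε x = Sum.inl (φ.toEquiv x) := by
    simp [ε, Equiv.Set.sumCompl_symm_apply_compl]
  { toEquiv := ε
    map_δ := fun x => by
      by_cases hx : x ∈ D
      · rw [hin ⟨x, hx⟩, sum_δ_inr, ψ.map_δ, restrict_δ]
      · rw [hout ⟨x, hx⟩, sum_δ_inl, φ.map_δ, restrict_δ]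
    map_π := fun x => by
      by_cases hx : x ∈ D
      · rw [hin ⟨x, hx⟩, sum_π_inr, ψ.map_π, ← hin, restrict_π]
      · rw [hout ⟨x, hx⟩, sum_π_inl, φ.map_π, ← hout, restrict_π] }

theorem ofRestrict_symm_inl {D : Set T} {hD : ∀ x, σ x ∈ D ↔ x ∈ D}
    {hD' : ∀ x, σ x ∈ Dᶜ ↔ x ∈ Dᶜ} (φ : (S.restrict σ Dᶜ hD').Iso A)
    (ψ : (S.restrict σ D hD).Iso B) (y : α) :
    (ofRestrict φ ψ).toEquiv.symm (Sum.inl y) = φ.toEquiv.symm y := by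
  simp [ofRestrict]

theorem isExchange [DecidableEq T] {Sm : ABS T} {Ψ : ABS α} {x y s t : T} {x' y' : α}
    (e : Splitting S σ A B) (hB : B.Regular) (hSm : S.IsExchange x y Sm)
    (hΨ : A.IsExchange x' y' Ψ) (hs : S.δ s = 0) (ht : S.δ t = 1) (hst : Sm.lt s t)
    (hσ : swap s t * Sm.π =
      swap (e.toEquiv.symm (Sum.inl x')) (e.toEquiv.symm (Sum.inl y')) * σ) :
    Sm.IsExchange s t ((Ψ.sum B).transport e.toEquiv) := by
  classical
  refine isExchange_of_π_eq (by rw [hSm.δ_eq, hs]) (by rw [hSm.δ_eq, ht]) hst ?_ ?_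
    ((transportIso e.toEquiv _).regular (hΨ.regular.sum hB))
  · have hδ : (Ψ.sum B).δ = (A.sum B).δ := by simp only [sum, hΨ.δ_eq]
    funext z
    rw [hSm.δ_eq, ← e.map_δ, ← hδ]
    exact ((transportIso e.toEquiv (Ψ.sum B)).map_δ z).symm
  · refine Perm.ext fun z => e.toEquiv.injective ?_
    calc e.toEquiv (((Ψ.sum B).transport e.toEquiv).π z)
        = (Ψ.sum B).π (e.toEquiv z) := ((transportIso e.toEquiv (Ψ.sum B)).map_π z).symm
      _ = swap (Sum.inl x') (Sum.inl y') (e.toEquiv (σ z)) := by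
        rw [hΨ.sum_π B, Perm.mul_apply, e.map_π]
      _ = e.toEquiv ((swap s t * Sm.π) z) := by
        rw [hσ, Perm.mul_apply, ← e.toEquiv.injective.swap_apply, apply_symm_apply,
          apply_symm_apply]

end Splitting

variable {m n : ℕ} {p q : Fin (m + n)} {D : Set (Fin (m + n))}

theorem simple_val_π_lt_iff (x : Fin (m + n)) :
    ((simple m n).π x).val < n ↔ (simple m n).δ x = 0 := by
  rw [simple_π_val, simple_δ_eq_zero_iff]
  have := x.isLt
  split_ifs <;> omega

theorem exists_splitting_simple (hpq : q.val = p.val + 1)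
    (hD : ∀ x, (swap p q * (simple m n).π) x ∈ D ↔ x ∈ D)
    (hex : p ∈ D ∧ q ∉ D ∨ q ∈ D ∧ p ∉ D) {f g : ℕ}
    (hf : ((simple m n).restrict _ D hD).count 1 = f)
    (hg : ((simple m n).restrict _ D hD).count 0 = g) :
    ∃ e : Splitting (simple m n) (swap p q * (simple m n).π) (simple (m - f) (n - g))
        (simple f g),
      (Set.range fun y => e.toEquiv.symm (Sum.inl y)) = Dᶜ ∧
      ∀ x y, (simple (m - f) (n - g)).lt x y ↔
        (simple m n).lt (e.toEquiv.symm (Sum.inl x)) (e.toEquiv.symm (Sum.inl y)) := by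
  have hD' (x) : (swap p q * (simple m n).π) x ∈ Dᶜ ↔ x ∈ Dᶜ := (hD x).not
  have hone := count_restrict_add (S := simple m n) (hC := hD) hD' 1
  have hzero := count_restrict_add (S := simple m n) (hC := hD) hD' 0
  rw [hf, count_one_simple] at hone
  rw [hg, count_zero_simple] at hzero
  obtain ⟨ψ⟩ := exists_restrict_iso (hC := hD) hpq (by tauto) hf hg
  obtain ⟨φ⟩ := exists_restrict_iso (hC := hD') hpq (f := m - f) (g := n - g)
    (by simp only [Set.mem_compl_iff]; tauto) (by omega) (by omega)
  refine ⟨.ofRestrict φ ψ, ?_, fun x y => ?_⟩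
  · simp only [Splitting.ofRestrict_symm_inl]
    exact (φ.toEquiv.symm.surjective.range_comp _).trans Subtype.range_coe
  · rw [Splitting.ofRestrict_symm_inl, Splitting.ofRestrict_symm_inl,
      ← restrict_lt (hC := hD'), ← φ.map_lt, apply_symm_apply, apply_symm_apply]

theorem Splitting.val_symm_inl_lt_iff {m' n' f g : ℕ}
    (e : Splitting (simple m n) (swap p q * (simple m n).π) (simple m' n') (simple f g))
    (hpqn : p.val < n ↔ q.val < n) (y : Fin (m' + n')) :
    (e.toEquiv.symm (Sum.inl y)).val < n ↔ y.val < n' := by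
  obtain ⟨y, rfl⟩ := (simple m' n').π.surjective y
  rw [simple_val_π_lt_iff, ← e.δ_symm_inl, ← simple_val_π_lt_iff, ← e.apply_symm_inl,
    Perm.mul_apply, swap_apply_def]
  split_ifs with hp hq
  · rw [hp, hpqn]
  · rw [hq, hpqn]
  · rfl

end Splitting

section SecondExchange

variable {m₁ n₁ m₂ n₂ m₁' n₁' m₂' n₂' f g : ℕ}

theorem count_sum {α β : Type*} [Finite α] [Finite β] (A : ABS α) (B : ABS β) (v : Fin 2) :
    (A.sum B).count v = A.count v + B.count v := by
  rw [count, count, count,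
    ← Set.ncard_image_of_injective {a | A.δ a = v} (Sum.inl_injective (β := β)),
    ← Set.ncard_image_of_injective {b | B.δ b = v} (Sum.inr_injective (α := α))]
  refine ncard_add_of_iff (fun x => ?_) ?_
  · rcases x with x | x <;> simp
  · rintro _ ⟨a, -, rfl⟩ ⟨b, -, hab⟩
    exact Sum.inr_ne_inl hab

theorem le_length_sum_simple {Ψ : ABS (Elt m₁ n₁ m₂ n₂)} {x y : Elt m₁ n₁ m₂ n₂} (h₁ : m₁ < n₁)
    (h₂ : n₂ < m₂) (hΨ : (minimalABS m₁ n₁ m₂ n₂).IsGoodExchange x y Ψ) :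
    n₁ * m₂ - m₁ * n₂ + |((n₁ + n₂) * f - (m₁ + m₂) * g : ℤ)| ≤
      (Ψ.sum (simple f g)).length + 1 := by
  have hcount (v : Fin 2) : Ψ.count v = (minimalABS m₁ n₁ m₂ n₂).count v := by
    rw [count, count, hΨ.1.δ_eq]
  have hcross := cross_add Ψ (simple f g)
  rw [hcount, hcount, minimalABS, count_sum, count_sum, count_one_simple, count_one_simple,
    count_one_simple, count_zero_simple, count_zero_simple, count_zero_simple] at hcross
  have hmin := length_minimal h₁ h₂
  have hgood := hΨ.2
  rw [length_sum hΨ.1.regular (simple_regular f g), length_simple]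
  zify at hcross hmin hgood
  push_cast
  have habs : |((n₁ + n₂) * f - (m₁ + m₂) * g : ℤ)| ≤
      Ψ.cross (simple f g) + (simple f g).cross Ψ := by
    rw [abs_le]
    constructor <;> linarith
  linarith

variable (p : ℕ) [Fact p.Prime] (K : Type*) [Field K] [CharP K p] [PerfectRing K p]

theorem exists_second_exchange (h₁ : m₁ < n₁) (h₂ : n₂ < m₂)
    (hξ' : IsTwoSegment m₁' n₁' m₂' n₂') (hρ : Nat.Coprime f g)
    {x y s t : Elt m₁ n₁ m₂ n₂} {x' y' : Elt m₁' n₁' m₂' n₂'} {Sm : ABS (Elt m₁ n₁ m₂ n₂)}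
    {Ψ : ABS (Elt m₁' n₁' m₂' n₂')} (hSm : (minimalABS m₁ n₁ m₂ n₂).IsGoodExchange x y Sm)
    (hΨ : (minimalABS m₁' n₁' m₂' n₂').IsGoodExchange x' y' Ψ)
    (hs : (minimalABS m₁ n₁ m₂ n₂).δ s = 0) (ht : (minimalABS m₁ n₁ m₂ n₂).δ t = 1)
    (hst : Sm.lt s t) {σ : Perm (Elt m₁ n₁ m₂ n₂)}
    (e : Splitting (minimalABS m₁ n₁ m₂ n₂) σ (minimalABS m₁' n₁' m₂' n₂') (simple f g))
    (hσ : swap s t * Sm.π =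
      swap (e.toEquiv.symm (Sum.inl x')) (e.toEquiv.symm (Sum.inl y')) * σ)
    (hlen : (n₁ * m₂ - m₁ * n₂ : ℤ) ≤
      n₁' * m₂' - m₁' * n₂' + |((n₁' + n₂') * f - (m₁' + m₂') * g : ℤ)| + 1) :
    ∃ Smm, Sm.IsGoodExchange s t Smm ∧ SplitsAs p K Smm m₁' n₁' m₂' n₂' f g := by
  have hex := e.isExchange (simple_regular f g) hSm.1 hΨ.1 hs ht hst hσ
  have hiso := transportIso e.toEquiv (Ψ.sum (simple f g))
  refine ⟨_, ⟨hex, le_antisymm (hex.length_lt hSm.1.regular) ?_⟩, hξ', hρ, Ψ, ⟨_, _, hΨ⟩,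
    ⟨hiso⟩, hiso.nonempty_dm1_iso_prod p K⟩
  obtain ⟨-, -, h₂', h₁'⟩ := isTwoSegment_iff.1 hξ'
  have hmin := length_minimal h₁ h₂
  have hgood := hSm.2
  have hle := le_length_sum_simple (f := f) (g := g) h₁' h₂' hΨ
  rw [hiso.length_eq]
  zify at hmin hgood ⊢
  linarith

end SecondExchange

section Bezout

variable {m n f g : ℕ}

theorem coprime_of_bezout (h : f * n = g * m + 1) : Nat.Coprime f g := by
  rw [← Nat.isCoprime_iff_coprime]
  exact ⟨n, -m, by zify at h; linear_combination h⟩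

theorem coprime_sub_of_bezout (hf : f ≤ m) (hg : g ≤ n) (h : f * n = g * m + 1) :
    Nat.Coprime (m - f) (n - g) := by
  rw [← Nat.isCoprime_iff_coprime]
  refine ⟨-g, f, ?_⟩
  push_cast [Nat.cast_sub hf, Nat.cast_sub hg]
  zify at h
  linear_combination h

theorem sub_lt_sub_of_bezout (hmn : m < n) (hf : f ≤ m) (hg : g ≤ n) (h : f * n = g * m + 1) :
    m - f < n - g := by
  by_contra! hle
  obtain ⟨a, rfl⟩ := Nat.exists_eq_add_of_le hf
  obtain ⟨b, rfl⟩ := Nat.exists_eq_add_of_le hg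
  rw [Nat.add_sub_cancel_left, Nat.add_sub_cancel_left] at hle
  have hdet : f * b = g * a + 1 := by linarith
  have hfb : f * b ≤ f * a := Nat.mul_le_mul_left f hle
  have hgf : g < f := by
    by_contra! hfg
    have := Nat.mul_le_mul_right a hfg
    omega
  omega

end Bezout

theorem lt_of_swap_lt {T : Type*} [DecidableEq T] [Finite T] {S S' : ABS T} {t t' : T}
    (hS : S.Regular) (h : S.IsGoodExchange t t' S') {x y : T} (hx : S.δ x = 0) (hy : S.δ y = 1)
    (hlt : S.lt (swap t t' x) (swap t t' y)) : S'.lt x y := by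
  rcases S'.lt_trichotomy x y with hxy | rfl | hyx
  · exact hxy
  · omega
  · have := ((h.1.length_add_one_iff hS).1 h.2).2 x y ⟨hlt, hyx⟩
    omega

section FirstSummand

variable {m₁ n₁ m₂ n₂ f g : ℕ} {i : Fin (m₁ + n₁)} {j : Fin (m₂ + n₂)}
  {Sm : ABS (Elt m₁ n₁ m₂ n₂)}

theorem exists_splitting_fst (hξ : IsTwoSegment m₁ n₁ m₂ n₂) (hm : 0 < m₁) (hmn : m₁ + 1 < n₁)
    (hf : f ≤ m₁) (hg : g ≤ n₁) (hfg : f * n₁ = g * m₁ + 1) (hi : m₁ ≤ i.val) (hi' : i.val < n₁)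
    (hj : j.val < n₂)
    (hSm : (minimalABS m₁ n₁ m₂ n₂).IsGoodExchange (Sum.inl i) (Sum.inr j) Sm) :
    ∃ (a b : Fin (m₁ + n₁)) (e : Splitting (simple m₁ n₁) (swap a b * (simple m₁ n₁).π)
        (simple (m₁ - f) (n₁ - g)) (simple f g)) (i' : Fin (m₁ - f + (n₁ - g)))
      (Ψ : ABS (Elt (m₁ - f) (n₁ - g) m₂ n₂)),
      b.val = a.val + 1 ∧
      (b.val = m₁ ∧ i ≠ b ∧ Sm.lt (Sum.inl b) (Sum.inl a) ∨ b = i ∧ m₁ ≤ a.val) ∧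
      e.toEquiv.symm (Sum.inl i') = i ∧
      (minimalABS (m₁ - f) (n₁ - g) m₂ n₂).IsGoodExchange (Sum.inl i') (Sum.inr j) Ψ := by
  obtain ⟨hc₁, hc₂, h₂, h₁⟩ := isTwoSegment_iff.1 hξ
  obtain ⟨a, b, D, hab, hcase, habn, haD, hbD, hiD, hD, hres⟩ :=
    exists_resolving_switch hm h₁ hc₁ hi hi' (Or.inl ⟨rfl, hmn⟩)
      (resolves_up h₁ h₂ hi hi' hj hSm hc₁)
  have hcount := count_restrict_add (S := simple m₁ n₁) (hC := hD) (fun x => (hD x).not) 1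
  rw [count_one_simple] at hcount
  obtain ⟨hfD, hgD⟩ := bezout_unique hc₁ (by omega) hf
    (count_switch_of_left (hC := hD) hab haD hbD) hfg
  obtain ⟨e, hrange, hlt⟩ := exists_splitting_simple hab hD (Or.inl ⟨haD, hbD⟩) hfD hgD
  obtain ⟨i', rfl⟩ : ∃ i', e.toEquiv.symm (Sum.inl i') = i := hrange.symm.le hiD
  obtain ⟨Ψ, hΨ⟩ := exists_isGoodExchange (i := i') (j := j) (sub_lt_sub_of_bezout h₁ hf hg hfg) h₂
    (by rwa [← simple_δ_eq_zero_iff, ← e.δ_symm_inl, simple_δ_eq_zero_iff])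
    (by rwa [← e.val_symm_inl_lt_iff habn]) hj (coprime_sub_of_bezout hf hg hfg) hc₂
    (fun k hik hk => e.resolves hlt (hres _ (hrange.le ⟨k, rfl⟩) ((hlt i' k).1 hik)
      ((e.val_symm_inl_lt_iff habn k).2 hk)))
    (fun l hl => (resolves_down h₁ h₂ hm hi hi' hj hSm hc₂ l hl).mono fun _ _ _ => trivial)
  exact ⟨a, b, e, i', Ψ, hab, hcase, rfl, hΨ⟩

variable (p : ℕ) [Fact p.Prime] (K : Type*) [Field K] [CharP K p] [PerfectRing K p]

theorem exists_second_exchange_fst (hξ : IsTwoSegment m₁ n₁ m₂ n₂) (hf : f ≤ m₁) (hg : g ≤ n₁)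
    (hfg : f * n₁ = g * m₁ + 1) {a b : Fin (m₁ + n₁)}
    (e : Splitting (simple m₁ n₁) (swap a b * (simple m₁ n₁).π) (simple (m₁ - f) (n₁ - g))
      (simple f g)) {i' : Fin (m₁ - f + (n₁ - g))} {Ψ : ABS (Elt (m₁ - f) (n₁ - g) m₂ n₂)}
    (hi : e.toEquiv.symm (Sum.inl i') = i)
    (hSm : (minimalABS m₁ n₁ m₂ n₂).IsGoodExchange (Sum.inl i) (Sum.inr j) Sm)
    (hΨ : (minimalABS (m₁ - f) (n₁ - g) m₂ n₂).IsGoodExchange (Sum.inl i') (Sum.inr j) Ψ)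
    {s t : Elt m₁ n₁ m₂ n₂} (hs : (minimalABS m₁ n₁ m₂ n₂).δ s = 0)
    (ht : (minimalABS m₁ n₁ m₂ n₂).δ t = 1) (hst : Sm.lt s t)
    (hτ : swap s t = swap (swap (Sum.inl i) (Sum.inr j) (Sum.inl a))
      (swap (Sum.inl i) (Sum.inr j) (Sum.inl b))) :
    ∃ Smm, Sm.IsGoodExchange s t Smm ∧ SplitsAs p K Smm (m₁ - f) (n₁ - g) m₂ n₂ f g := by
  obtain ⟨-, hc₂, h₂, h₁⟩ := isTwoSegment_iff.1 hξ
  have hξ' : IsTwoSegment (m₁ - f) (n₁ - g) m₂ n₂ := isTwoSegment_iff.2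
    ⟨coprime_sub_of_bezout hf hg hfg, hc₂, h₂, sub_lt_sub_of_bezout h₁ hf hg hfg⟩
  refine exists_second_exchange p K h₁ h₂ hξ' (coprime_of_bezout hfg) hSm hΨ hs ht hst
    (e.sumRight (simple m₂ n₂)) ?_ ?_
  · have hi' : (e.sumRight (simple m₂ n₂)).toEquiv.symm (Sum.inl (Sum.inl i')) = Sum.inl i :=
      congrArg Sum.inl hi
    have hj' : (e.sumRight (simple m₂ n₂)).toEquiv.symm (Sum.inl (Sum.inr j)) = Sum.inr j := rfl
    rw [hi', hj', hSm.1.π_eq, ← mul_assoc, hτ, ← mul_swap_eq_swap_mul, mul_assoc, minimalABS,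
      swap_inl_mul_sum_π]
  · push_cast [Nat.cast_sub hf, Nat.cast_sub hg]
    have := neg_le_abs (((n₁ - g + n₂) * f - (m₁ - f + m₂) * g : ℤ))
    zify at hfg
    linarith

theorem second_exchange_fst (hξ : IsTwoSegment m₁ n₁ m₂ n₂) (hm : 0 < m₁) (hmn : m₁ + 1 < n₁)
    (hf : f ≤ m₁) (hg : g ≤ n₁) (hfg : f * n₁ = g * m₁ + 1) (hi : m₁ ≤ i.val) (hi' : i.val < n₁)
    (hj : j.val < n₂)
    (hSm : (minimalABS m₁ n₁ m₂ n₂).IsGoodExchange (Sum.inl i) (Sum.inr j) Sm) :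
    SecondExchange p K Sm (Sum.inl (m₁ + 1)) (Sum.inl m₁) (m₁ - f) (n₁ - g) m₂ n₂ f g ∨
      SecondExchange p K Sm (Sum.inl i.val) (Sum.inr (j.val + 1)) (m₁ - f) (n₁ - g) m₂ n₂ f g := by
  obtain ⟨-, -, h₂, -⟩ := isTwoSegment_iff.1 hξ
  obtain ⟨a, b, e, i', Ψ, hab, hcase, hii', hΨ⟩ :=
    exists_splitting_fst hξ hm hmn hf hg hfg hi hi' hj hSm
  have hne : a ≠ b := Fin.ne_of_val_ne (by omega)
  rcases hcase with ⟨hbm, hib, hlt⟩ | ⟨rfl, ham⟩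
  · left
    have hia : i ≠ a := Fin.ne_of_val_ne (by omega)
    have hδb : (minimalABS m₁ n₁ m₂ n₂).δ (Sum.inl b) = 0 := simple_δ_eq_zero_iff.2 hbm.ge
    have hδa : (minimalABS m₁ n₁ m₂ n₂).δ (Sum.inl a) = 1 := simple_δ_eq_one_iff.2 (by omega)
    obtain ⟨Smm, hSmm⟩ := exists_second_exchange_fst p K hξ hf hg hfg e hii' hSm hΨ hδb hδa hlt (by
        rw [swap_apply_of_ne_of_ne (by simpa using hia.symm) (by simp),
          swap_apply_of_ne_of_ne (by simpa using hib.symm) (by simp), swap_comm (Sum.inl b)])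
    exact ⟨_, _, Smm, by simp [eltName, hbm], by simp [eltName, ← hab, hbm], hSmm⟩
  · right
    have ha : swap (Sum.inl b) (Sum.inr j) (Sum.inl a) = Sum.inl a :=
      swap_apply_of_ne_of_ne (by simpa using hne) (by simp)
    have hδa : (minimalABS m₁ n₁ m₂ n₂).δ (Sum.inl a) = 0 := simple_δ_eq_zero_iff.2 ham
    have hδj : (minimalABS m₁ n₁ m₂ n₂).δ (Sum.inr j) = 1 := simple_δ_eq_one_iff.2 (by omega)
    obtain ⟨Smm, hSmm⟩ := exists_second_exchange_fst p K hξ hf hg hfg e hii' hSm hΨ hδa hδj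
      (lt_of_swap_lt (minimal_regular m₁ n₁ m₂ n₂) hSm hδa hδj (by
        rw [ha, swap_apply_right, minimal_lt_inl_inl]
        omega))
      (by rw [ha, swap_apply_left])
    exact ⟨_, _, Smm, by simp [eltName, hab], by simp [eltName], hSmm⟩

end FirstSummand

section SecondSummand

variable {m₁ n₁ m₂ n₂ f g : ℕ} {i : Fin (m₁ + n₁)} {j : Fin (m₂ + n₂)}
  {Sm : ABS (Elt m₁ n₁ m₂ n₂)}

theorem exists_splitting_snd (hξ : IsTwoSegment m₁ n₁ m₂ n₂) (hm : 0 < m₁) (hn : 2 ≤ n₂)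
    (hf : f ≤ m₂) (hg : g ≤ n₂) (hfg : g * m₂ = f * n₂ + 1) (hi : m₁ ≤ i.val) (hi' : i.val < n₁)
    (hj : j.val < n₂)
    (hSm : (minimalABS m₁ n₁ m₂ n₂).IsGoodExchange (Sum.inl i) (Sum.inr j) Sm) :
    ∃ (a b : Fin (m₂ + n₂)) (e : Splitting (simple m₂ n₂) (swap a b * (simple m₂ n₂).π)
        (simple (m₂ - f) (n₂ - g)) (simple f g)) (j' : Fin (m₂ - f + (n₂ - g)))
      (Ψ : ABS (Elt m₁ n₁ (m₂ - f) (n₂ - g))),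
      b.val = a.val + 1 ∧
      (b.val = m₂ ∧ j ≠ a ∧ Sm.lt (Sum.inr b) (Sum.inr a) ∨ a = j ∧ b.val < m₂) ∧
      e.toEquiv.symm (Sum.inl j') = j ∧
      (minimalABS m₁ n₁ (m₂ - f) (n₂ - g)).IsGoodExchange (Sum.inl i) (Sum.inr j') Ψ := by
  obtain ⟨hc₁, hc₂, h₂, h₁⟩ := isTwoSegment_iff.1 hξ
  obtain ⟨a, b, D, hab, hcase, habn, hbD, haD, hjD, hD, hres⟩ :=
    exists_resolving_switch_down hn h₂ hc₂ hj (resolves_down h₁ h₂ hm hi hi' hj hSm hc₂)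
  have hcount := count_restrict_add (S := simple m₂ n₂) (hC := hD) (fun x => (hD x).not) 0
  rw [count_zero_simple] at hcount
  obtain ⟨hgD, hfD⟩ := bezout_unique hc₂.symm (by omega) hg
    (count_switch_of_right (hC := hD) hab haD hbD) hfg
  obtain ⟨e, hrange, hlt⟩ := exists_splitting_simple hab hD (Or.inr ⟨hbD, haD⟩) hfD hgD
  obtain ⟨j', rfl⟩ : ∃ j', e.toEquiv.symm (Sum.inl j') = j := hrange.symm.le hjD
  obtain ⟨Ψ, hΨ⟩ := exists_isGoodExchange (i := i) (j := j') h₁ (sub_lt_sub_of_bezout h₂ hg hf hfg)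
    hi hi' (by rwa [← e.val_symm_inl_lt_iff habn]) hc₁ (coprime_sub_of_bezout hg hf hfg).symm
    (fun k hik hk => (resolves_up h₁ h₂ hi hi' hj hSm hc₁ k hik hk).mono fun _ _ _ => trivial)
    (fun l hl => e.resolves hlt (hres _ (hrange.le ⟨l, rfl⟩) ((hlt l j').1 hl)))
  exact ⟨a, b, e, j', Ψ, hab, hcase, rfl, hΨ⟩

variable (p : ℕ) [Fact p.Prime] (K : Type*) [Field K] [CharP K p] [PerfectRing K p]

theorem exists_second_exchange_snd (hξ : IsTwoSegment m₁ n₁ m₂ n₂) (hf : f ≤ m₂) (hg : g ≤ n₂)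
    (hfg : g * m₂ = f * n₂ + 1) {a b : Fin (m₂ + n₂)}
    (e : Splitting (simple m₂ n₂) (swap a b * (simple m₂ n₂).π) (simple (m₂ - f) (n₂ - g))
      (simple f g)) {j' : Fin (m₂ - f + (n₂ - g))} {Ψ : ABS (Elt m₁ n₁ (m₂ - f) (n₂ - g))}
    (hj : e.toEquiv.symm (Sum.inl j') = j)
    (hSm : (minimalABS m₁ n₁ m₂ n₂).IsGoodExchange (Sum.inl i) (Sum.inr j) Sm)
    (hΨ : (minimalABS m₁ n₁ (m₂ - f) (n₂ - g)).IsGoodExchange (Sum.inl i) (Sum.inr j') Ψ)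
    {s t : Elt m₁ n₁ m₂ n₂} (hs : (minimalABS m₁ n₁ m₂ n₂).δ s = 0)
    (ht : (minimalABS m₁ n₁ m₂ n₂).δ t = 1) (hst : Sm.lt s t)
    (hτ : swap s t = swap (swap (Sum.inl i) (Sum.inr j) (Sum.inr a))
      (swap (Sum.inl i) (Sum.inr j) (Sum.inr b))) :
    ∃ Smm, Sm.IsGoodExchange s t Smm ∧ SplitsAs p K Smm m₁ n₁ (m₂ - f) (n₂ - g) f g := by
  obtain ⟨hc₁, -, h₂, h₁⟩ := isTwoSegment_iff.1 hξ
  have hξ' : IsTwoSegment m₁ n₁ (m₂ - f) (n₂ - g) := isTwoSegment_iff.2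
    ⟨hc₁, (coprime_sub_of_bezout hg hf hfg).symm, sub_lt_sub_of_bezout h₂ hg hf hfg, h₁⟩
  refine exists_second_exchange p K h₁ h₂ hξ' (coprime_of_bezout hfg).symm hSm hΨ hs ht hst
    (e.sumLeft (simple m₁ n₁)) ?_ ?_
  · have hi' : (e.sumLeft (simple m₁ n₁)).toEquiv.symm (Sum.inl (Sum.inl i)) = Sum.inl i := rfl
    have hj' : (e.sumLeft (simple m₁ n₁)).toEquiv.symm (Sum.inl (Sum.inr j')) = Sum.inr j :=
      congrArg Sum.inr hj
    rw [hi', hj', hSm.1.π_eq, ← mul_assoc, hτ, ← mul_swap_eq_swap_mul, mul_assoc, minimalABS,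
      swap_inr_mul_sum_π]
  · push_cast [Nat.cast_sub hf, Nat.cast_sub hg]
    have := le_abs_self (((n₁ + (n₂ - g)) * f - (m₁ + (m₂ - f)) * g : ℤ))
    zify at hfg
    linarith

theorem second_exchange_snd (hξ : IsTwoSegment m₁ n₁ m₂ n₂) (hm : 0 < m₁) (hn : 2 ≤ n₂)
    (hf : f ≤ m₂) (hg : g ≤ n₂) (hfg : g * m₂ = f * n₂ + 1) (hi : m₁ ≤ i.val) (hi' : i.val < n₁)
    (hj : j.val < n₂)
    (hSm : (minimalABS m₁ n₁ m₂ n₂).IsGoodExchange (Sum.inl i) (Sum.inr j) Sm) :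
    SecondExchange p K Sm (Sum.inr (m₂ + 1)) (Sum.inr m₂) m₁ n₁ (m₂ - f) (n₂ - g) f g ∨
      SecondExchange p K Sm (Sum.inl (i.val + 1)) (Sum.inr (j.val + 2))
        m₁ n₁ (m₂ - f) (n₂ - g) f g := by
  obtain ⟨-, -, h₂, -⟩ := isTwoSegment_iff.1 hξ
  obtain ⟨a, b, e, j', Ψ, hab, hcase, hjj', hΨ⟩ :=
    exists_splitting_snd hξ hm hn hf hg hfg hi hi' hj hSm
  have hne : b ≠ a := Fin.ne_of_val_ne (by omega)
  rcases hcase with ⟨hbm, hja, hlt⟩ | ⟨rfl, hbm⟩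
  · left
    have hjb : j ≠ b := Fin.ne_of_val_ne (by omega)
    have hδb : (minimalABS m₁ n₁ m₂ n₂).δ (Sum.inr b) = 0 := simple_δ_eq_zero_iff.2 hbm.ge
    have hδa : (minimalABS m₁ n₁ m₂ n₂).δ (Sum.inr a) = 1 := simple_δ_eq_one_iff.2 (by omega)
    obtain ⟨Smm, hSmm⟩ := exists_second_exchange_snd p K hξ hf hg hfg e hjj' hSm hΨ hδb hδa hlt (by
        rw [swap_apply_of_ne_of_ne (by simp) (by simpa using hja.symm),
          swap_apply_of_ne_of_ne (by simp) (by simpa using hjb.symm), swap_comm (Sum.inr b)])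
    exact ⟨_, _, Smm, by simp [eltName, hbm], by simp [eltName, ← hab, hbm], hSmm⟩
  · right
    have hb : swap (Sum.inl i) (Sum.inr a) (Sum.inr b) = Sum.inr b :=
      swap_apply_of_ne_of_ne (by simp) (by simpa using hne)
    have hδi : (minimalABS m₁ n₁ m₂ n₂).δ (Sum.inl i) = 0 := simple_δ_eq_zero_iff.2 hi
    have hδb : (minimalABS m₁ n₁ m₂ n₂).δ (Sum.inr b) = 1 := simple_δ_eq_one_iff.2 hbm
    obtain ⟨Smm, hSmm⟩ := exists_second_exchange_snd p K hξ hf hg hfg e hjj' hSm hΨ hδi hδb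
      (lt_of_swap_lt (minimal_regular m₁ n₁ m₂ n₂) hSm hδi hδb (by
        rw [hb, swap_apply_left, minimal_lt_inr_inr]
        omega))
      (by rw [hb, swap_apply_right])
    exact ⟨_, _, Smm, by simp [eltName], by simp [eltName, hab], hSmm⟩

end SecondSummand

section EqualRank

variable {m m₂ n₂ : ℕ} {a i : Fin (m + 1 + (m + 2))} {j : Fin (m₂ + n₂)}

theorem simple_π_val_of_val_eq (ha : a.val = m) :
    ((simple (m + 1) (m + 2)).π a).val = 2 * m + 2 := by
  rw [simple_π_val, if_pos (by omega)]
  omega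

theorem apply_mem_pair_iff {T : Type*} {σ : Perm T} {x y : T} (hx : σ x = y) (hy : σ y = x)
    (z : T) : σ z ∈ ({x, y} : Set T) ↔ z ∈ ({x, y} : Set T) := by
  rw [Set.mem_insert_iff, Set.mem_singleton_iff, Set.mem_insert_iff, Set.mem_singleton_iff,
    or_comm, ← σ.apply_eq_iff_eq (x := z) (y := x), ← σ.apply_eq_iff_eq (x := z) (y := y), hx, hy]

theorem exists_splitting_one_one (ha : a.val = m) (hi : i.val = m + 1) :
    ∃ (e : Splitting (simple (m + 1) (m + 2)) (swap a i * (simple (m + 1) (m + 2)).π)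
        (simple m (m + 1)) (simple 1 1)) (i' : Fin (m + (m + 1))),
      e.toEquiv.symm (Sum.inl i') = i := by
  have hai : i.val = a.val + 1 := by omega
  obtain ⟨c, hc⟩ : ∃ c, (simple (m + 1) (m + 2)).π a = c := ⟨_, rfl⟩
  have hcval : c.val = 2 * m + 2 := by rw [← hc, simple_π_val_of_val_eq ha]
  have hci : c ≠ i := Fin.ne_of_val_ne (by omega)
  have hσa : (swap a i * (simple (m + 1) (m + 2)).π) a = c := by
    rw [Perm.mul_apply, hc, swap_apply_of_ne_of_ne (Fin.ne_of_val_ne (by omega)) hci]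
  have hσc : (swap a i * (simple (m + 1) (m + 2)).π) c = a := by
    have hπc : (simple (m + 1) (m + 2)).π c = i :=
      Fin.ext (by rw [simple_π_val, if_neg (by omega)]; omega)
    rw [Perm.mul_apply, hπc, swap_apply_right]
  have hD := apply_mem_pair_iff hσa hσc
  have hiD : i ∉ ({a, c} : Set _) := by
    rintro (h | h)
    · omega
    · exact hci h.symm
  have hcount := count_restrict_add (S := simple (m + 1) (m + 2)) (hC := hD)
    (fun x => (hD x).not) 1
  rw [count_one_simple] at hcount
  obtain ⟨hf, hg⟩ := bezout_unique (f' := 1) (g' := 1)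
    (by simp : Nat.Coprime (m + 1) (m + 1 + 1)) (by omega) (by omega)
    (count_switch_of_left (hC := hD) hai (Or.inl rfl) hiD) (by ring)
  obtain ⟨e, hrange, -⟩ := exists_splitting_simple hai hD (Or.inl ⟨Or.inl rfl, hiD⟩) hf hg
  exact ⟨e, hrange.symm.le hiD⟩

theorem exists_isGoodExchange_one_one (hc₂ : Nat.Coprime m₂ n₂) (h₂ : n₂ < m₂) (hn₂ : 0 < n₂)
    (ha : a.val = m) (hi : i.val = m + 1) (hj : j.val = 0) :
    ∃ (e : Splitting (simple (m + 1) (m + 2)) (swap a i * (simple (m + 1) (m + 2)).π)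
        (simple m (m + 1)) (simple 1 1)) (i' : Fin (m + (m + 1))) (Ψ : ABS (Elt m (m + 1) m₂ n₂)),
      e.toEquiv.symm (Sum.inl i') = i ∧
      (minimalABS m (m + 1) m₂ n₂).IsGoodExchange (Sum.inl i') (Sum.inr j) Ψ := by
  obtain ⟨e, i', hii'⟩ := exists_splitting_one_one ha hi
  have hi' : m ≤ i'.val := by
    rw [← simple_δ_eq_zero_iff, ← e.δ_symm_inl, hii', simple_δ_eq_zero_iff, hi]
  have hi'' : i'.val < m + 1 := by
    rw [← e.val_symm_inl_lt_iff (by omega), hii']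
    omega
  obtain ⟨Ψ, hΨ⟩ := exists_isGoodExchange (i := i') (j := j) (Nat.lt_succ_self m) h₂ hi' hi''
    (by omega) (by simp) hc₂ (fun k hk hk' => by omega) (fun l hl => by omega)
  exact ⟨e, i', Ψ, hii', hΨ⟩

theorem swap_mul_conj_swap {T : Type*} [DecidableEq T] {x y z : T} (hzx : z ≠ x) (hzy : z ≠ y)
    (ρ : Perm T) : swap x y * ((swap y z)⁻¹ * (swap y x * ρ) * swap y z) =
      swap x z * ρ * swap y z := by
  rw [← swap_mul_swap_mul_swap hzy hzx, swap_inv, swap_comm z y, swap_comm x y]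
  group

variable {Sm : ABS (Elt (m + 1) (m + 2) m₂ n₂)}

theorem exists_swap_images (h₂ : n₂ < m₂) (hn₂ : 0 < n₂)
    (hSm : (minimalABS (m + 1) (m + 2) m₂ n₂).IsGoodExchange (Sum.inl i) (Sum.inr j) Sm)
    (ha : a.val = m) (hi : i.val = m + 1) (hj : j.val = 0) :
    ∃ c d, c.val = 2 * m + 2 ∧ d.val = n₂ ∧ Sm.lt (Sum.inl c) (Sum.inr d) ∧
      swap (Sum.inl c) (Sum.inr d) * Sm.π = swap (Sum.inl i) (Sum.inr j) *
        (minimalABS (m + 1) (m + 2) m₂ n₂).π * swap (Sum.inl a) (Sum.inr j) := by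
  set S := minimalABS (m + 1) (m + 2) m₂ n₂
  obtain ⟨c, hπa, hc⟩ : ∃ c, S.π (Sum.inl a) = Sum.inl c ∧ c.val = 2 * m + 2 :=
    ⟨_, rfl, simple_π_val_of_val_eq ha⟩
  obtain ⟨d, hπj, hd⟩ : ∃ d, S.π (Sum.inr j) = Sum.inr d ∧ d.val = n₂ :=
    ⟨_, rfl, by rw [simple_π_val, if_pos (by omega), hj, zero_add]⟩
  have hfixc : swap (Sum.inl i) (Sum.inr j) (Sum.inl c) = Sum.inl c :=
    swap_apply_of_ne_of_ne (by simpa using Fin.ne_of_val_ne (by omega)) (by simp)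
  have hfixd : swap (Sum.inl i) (Sum.inr j) (Sum.inr d) = Sum.inr d :=
    swap_apply_of_ne_of_ne (by simp) (by simpa using Fin.ne_of_val_ne (by omega))
  refine ⟨c, d, hc, hd, ?_, ?_⟩
  · refine lt_of_swap_lt (minimal_regular _ _ _ _) hSm (simple_δ_eq_zero_iff.2 (by omega))
      (simple_δ_eq_one_iff.2 (by omega)) ?_
    rw [hfixc, hfixd, minimal_lt_inl_inr (Nat.lt_succ_self _) h₂]
    exact Or.inr hd.ge
  · rw [← hSm.1.π_eq, mul_swap_eq_swap_mul, hSm.1.π_eq, Perm.mul_apply, Perm.mul_apply, hπa, hπj,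
      hfixc, hfixd]

variable (p : ℕ) [Fact p.Prime] (K : Type*) [Field K] [CharP K p] [PerfectRing K p]

theorem second_exchange_one_one (hξ : IsTwoSegment (m + 1) (m + 2) m₂ n₂) (hn₂ : 0 < n₂)
    (hi : i.val = m + 1) (hj : j.val = 0)
    (hSm : (minimalABS (m + 1) (m + 2) m₂ n₂).IsGoodExchange (Sum.inl i) (Sum.inr j) Sm) :
    SecondExchange p K Sm (Sum.inl (m + 1 + (m + 2))) (Sum.inr (n₂ + 1)) m (m + 1) m₂ n₂ 1 1 := by
  obtain ⟨-, hc₂, h₂, h₁⟩ := isTwoSegment_iff.1 hξ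
  have hξ' : IsTwoSegment m (m + 1) m₂ n₂ := isTwoSegment_iff.2
    ⟨by simp, hc₂, h₂, Nat.lt_succ_self m⟩
  obtain ⟨a, ha⟩ : ∃ a : Fin (m + 1 + (m + 2)), a.val = m := ⟨⟨m, by omega⟩, rfl⟩
  obtain ⟨e, i', Ψ, hii', hΨ⟩ := exists_isGoodExchange_one_one hc₂ h₂ hn₂ ha hi hj
  obtain ⟨c, d, hc, hd, hcd, hσ⟩ := exists_swap_images h₂ hn₂ hSm ha hi hj
  have hδc : (minimalABS (m + 1) (m + 2) m₂ n₂).δ (Sum.inl c) = 0 :=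
    simple_δ_eq_zero_iff.2 (by omega)
  have hδd : (minimalABS (m + 1) (m + 2) m₂ n₂).δ (Sum.inr d) = 1 :=
    simple_δ_eq_one_iff.2 (by omega)
  have hδ : (minimalABS (m + 1) (m + 2) m₂ n₂).δ (Sum.inl a) =
      (minimalABS (m + 1) (m + 2) m₂ n₂).δ (Sum.inr j) :=
    (simple_δ_eq_one_iff.2 (by omega)).trans (simple_δ_eq_one_iff.2 (by omega)).symm
  -- `e` splits off `{a, c}`; as `a` and `j` trade places, the orbit that splits off is `{j, c}`.
  let e' := (e.sumRight (simple m₂ n₂)).conj (swap (Sum.inl a) (Sum.inr j)) (apply_swap_eq_self hδ)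
  have hi' : e'.toEquiv.symm (Sum.inl (Sum.inl i')) = Sum.inl i := by
    change (swap (Sum.inl a) (Sum.inr j)).symm (Sum.inl (e.toEquiv.symm (Sum.inl i'))) = _
    rw [hii', symm_swap, swap_apply_of_ne_of_ne (by simpa using Fin.ne_of_val_ne (by omega))
      (by simp)]
  have hj' : e'.toEquiv.symm (Sum.inl (Sum.inr j)) = Sum.inl a := by
    change (swap (Sum.inl a) (Sum.inr j)).symm (Sum.inr j) = _
    rw [symm_swap, swap_apply_right]
  obtain ⟨Smm, hSmm⟩ := exists_second_exchange p K h₁ h₂ hξ' (Nat.coprime_one_left 1) hSm hΨ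
    hδc hδd hcd e'
    (by
      rw [hi', hj', ← swap_inl_mul_sum_π, swap_mul_conj_swap (by simp) (by simp), hσ]
      rfl)
    (by
      have := neg_le_abs (((m + 1 : ℕ) + n₂) * (1 : ℕ) - (m + m₂) * (1 : ℕ) : ℤ)
      push_cast at this ⊢
      linarith)
  exact ⟨_, _, Smm, by simp [eltName]; omega, by simp [eltName, hd], hSmm⟩

theorem exists_of_eltName_eq {m₁ n₁ : ℕ} {s t : Elt m₁ n₁ m₂ n₂} {k l : ℕ}
    (hs : eltName s = Sum.inl k) (ht : eltName t = Sum.inr l) :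
    ∃ x y, s = Sum.inl x ∧ t = Sum.inr y ∧ k = x.val + 1 ∧ l = y.val + 1 := by
  rcases s with x | x <;> rcases t with y | y
  · simp [eltName] at ht
  · exact ⟨x, y, rfl, rfl, (Sum.inl_injective hs).symm, (Sum.inr_injective ht).symm⟩
  · simp [eltName] at hs
  · simp [eltName] at hs

end EqualRank

end ABS

theorem proposition5p2 (p : ℕ) [Fact p.Prime] (K : Type*) [Field K] [CharP K p] [PerfectRing K p]
    (m₁ n₁ m₂ n₂ : ℕ) (hξ : IsTwoSegment m₁ n₁ m₂ n₂)
    (h₂ : 0 < segSlope m₂ n₂) (h₁ : segSlope m₁ n₁ < 1) :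
    (m₁ + 1 < n₁ →
      ∃ f g : ℕ, f ≤ m₁ ∧ g ≤ n₁ ∧ f * n₁ = g * m₁ + 1 ∧
        ∀ (i j : ℕ) (s t : Elt m₁ n₁ m₂ n₂) (Sm : ABS (Elt m₁ n₁ m₂ n₂)),
          m₁ < i → i ≤ n₁ → 1 ≤ j → j ≤ n₂ → eltName s = Sum.inl i → eltName t = Sum.inr j →
          (minimalABS m₁ n₁ m₂ n₂).IsGoodExchange s t Sm →
          SecondExchange p K Sm (Sum.inl (m₁ + 1)) (Sum.inl m₁)
              (m₁ - f) (n₁ - g) m₂ n₂ f g ∨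
            SecondExchange p K Sm (Sum.inl (i - 1)) (Sum.inr j)
              (m₁ - f) (n₁ - g) m₂ n₂ f g) ∧
    (n₁ = m₁ + 1 →
      ∃ f g : ℕ,
        ∀ (i j : ℕ) (s t : Elt m₁ n₁ m₂ n₂) (Sm : ABS (Elt m₁ n₁ m₂ n₂)),
          m₁ < i → i ≤ n₁ → 1 ≤ j → j ≤ n₂ → eltName s = Sum.inl i → eltName t = Sum.inr j →
          (minimalABS m₁ n₁ m₂ n₂).IsGoodExchange s t Sm →
          (f ≤ m₂ ∧ g ≤ n₂ ∧ g * m₂ = f * n₂ + 1 ∧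
            (SecondExchange p K Sm (Sum.inr (m₂ + 1)) (Sum.inr m₂)
                m₁ n₁ (m₂ - f) (n₂ - g) f g ∨
              SecondExchange p K Sm (Sum.inl i) (Sum.inr (j + 1))
                m₁ n₁ (m₂ - f) (n₂ - g) f g)) ∨
          (f = 1 ∧ g = 1 ∧
            SecondExchange p K Sm (Sum.inl (m₁ + n₁)) (Sum.inr (n₂ + 1))
              (m₁ - 1) (n₁ - 1) m₂ n₂ f g)) := by
  obtain ⟨hc₁, hc₂, h₂lt, h₁lt⟩ := isTwoSegment_iff.1 hξ
  have hm₁ : 0 < m₁ := pos_of_segSlope_lt_one (by omega) h₁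
  have hn₂ : 0 < n₂ := pos_of_segSlope_pos h₂
  constructor
  · intro hmn
    obtain ⟨f, g, hf, hg, hfg⟩ := ABS.exists_bezout hc₁ hm₁ (by omega)
    refine ⟨f, g, hf, hg, hfg, fun i j s t Sm hi hi' hj hj' hs ht hSm => ?_⟩
    obtain ⟨x, y, rfl, rfl, rfl, rfl⟩ := ABS.exists_of_eltName_eq hs ht
    exact ABS.second_exchange_fst p K hξ hm₁ hmn hf hg hfg (by omega) (by omega) (by omega) hSm
  · rintro rfl
    by_cases hn : n₂ = 1
    · obtain ⟨m, rfl⟩ := Nat.exists_eq_add_one.2 hm₁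
      refine ⟨1, 1, fun i j s t Sm hi hi' hj hj' hs ht hSm => Or.inr ⟨rfl, rfl, ?_⟩⟩
      obtain ⟨x, y, rfl, rfl, rfl, rfl⟩ := ABS.exists_of_eltName_eq hs ht
      exact ABS.second_exchange_one_one p K hξ hn₂ (by omega) (by omega) hSm
    · obtain ⟨g, f, hg, hf, hfg⟩ := ABS.exists_bezout hc₂.symm hn₂ (by omega)
      refine ⟨f, g, fun i j s t Sm hi hi' hj hj' hs ht hSm => Or.inl ⟨hf, hg, hfg, ?_⟩⟩
      obtain ⟨x, y, rfl, rfl, rfl, rfl⟩ := ABS.exists_of_eltName_eq hs ht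
      exact ABS.second_exchange_snd p K hξ hm₁ (by omega) hf hg hfg (by omega) (by omega)
        (by omega) hSm
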